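/- Identify $\mathbb{Z}+i\mathbb{Z}\subset\mathbb{C}$ with $\mathbb{Z}^2\subset\mathbb{R}^2$. For $k\ge 0$ let $P_k(x)=\prod_{j=0}^{k-1}\bigl(x+j-\tfrac{k-1}{2}\bigr)$, let $\Xi$ be the linear map on $\mathbb{C}[x,y]$ with $\Xi(x^ay^b)=P_a(x)P_b(y)$, and for $k\ge1$ let $p_k(z)=q_k(z)-q_k(0)$ with $z=x+iy$, $q_k=\Xi\bigl[(x+iy)^k\bigr]$ (these are discrete harmonic polynomials on $\mathbb{Z}^2$). (a) There is a constant $C$ such that for all $t\ge 1$, $$\bigl|\#\{z\in\mathbb{Z}+i\mathbb{Z}:\pi|z|^2\le t\}-t\bigr|\le C\,t^{1/3}.$$ (b) For every $k\ge1$ there is a constant $C=C(k)$ such that for all $t>0$, $$t^{-k/2}\Bigl|\sum_{z\in\mathbb{Z}+i\mathbb{Z},\ \pi|z|^2\le t} z^k\Bigr|\le C\,t^{1/3}.$$ More generally, for every $d\ge1$ and $k\ge1$ there is a constant $C=C(d,k)$ such that for every real harmonic polynomial $P$ on $\mathbb{R}^d$, homogeneous of degree $k$ and normalized by $\max_{|x|\le1}|P(x)|=1$,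 and for all $R>0$, $$\Bigl|\frac1{R^d}\sum_{x\in\mathbb{Z}^d,\ |x|<R}\frac{P(x)}{R^k}\Bigr|\le C\,R^{-1-\alpha},\qquad \alpha=1-\frac{2}{d+1}.$$ (c) For every $k\ge1$ there is a constant $C=C(k)$ such that for all $t>0$, $$t^{-k/2}\Bigl|\sum_{z\in\mathbb{Z}+i\mathbb{Z},\ \pi|z|^2\le t} p_k(z)\Bigr|\le C\,t^{1/3}.$$ -/

import Mathlib

noncomputable section

/-- The point of `ℝ^d` (with its Euclidean norm) given by an integer vector. -/
def latticePoint {d : ℕ} (x : Fin d → ℤ) : EuclideanSpace ℝ (Fin d) :=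
  WithLp.toLp 2 (fun i => (x i : ℝ))

theorem finite_setOf_norm_latticePoint_lt (d : ℕ) (R : ℝ) :
    {x : Fin d → ℤ | ‖latticePoint x‖ < R}.Finite := by
  refine (Set.Finite.pi' (fun _ : Fin d => Set.finite_Icc (-⌈R⌉) ⌈R⌉)).subset ?_
  intro x hx i
  have h1 : ‖latticePoint x i‖ ≤ ‖latticePoint x‖ := PiLp.norm_apply_le _ i
  have h2 : |(x i : ℝ)| < R := lt_of_le_of_lt h1 hx
  have h3 : |(x i : ℝ)| ≤ (⌈R⌉ : ℝ) := h2.le.trans (Int.le_ceil R)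
  have h4 := abs_le.1 h3
  exact ⟨by exact_mod_cast h4.1, by exact_mod_cast h4.2⟩

/-- The set of `x ∈ ℤ^d` with Euclidean norm `|x| < R`. -/
def latticeBall (d : ℕ) (R : ℝ) : Finset (Fin d → ℤ) :=
  (finite_setOf_norm_latticePoint_lt d R).toFinset

theorem finite_setOf_pi_mul_norm_sq_le (t : ℝ) :
    {z : GaussianInt | Real.pi * ‖(z : ℂ)‖ ^ 2 ≤ t}.Finite := by
  have hbox : ((Set.Icc (-⌈t⌉) ⌈t⌉) ×ˢ (Set.Icc (-⌈t⌉) ⌈t⌉) : Set (ℤ × ℤ)).Finite :=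
    (Set.finite_Icc _ _).prod (Set.finite_Icc _ _)
  have hinj : Function.Injective (fun z : GaussianInt => ((z.re, z.im) : ℤ × ℤ)) := by
    intro a b h
    simp only [Prod.mk.injEq] at h
    exact Zsqrtd.ext h.1 h.2
  refine (hbox.preimage hinj.injOn).subset ?_
  intro z hz
  have hz' : Real.pi * ‖(z : ℂ)‖ ^ 2 ≤ t := hz
  have hn : ‖(z : ℂ)‖ ^ 2 = (z.re : ℝ) ^ 2 + (z.im : ℝ) ^ 2 := by
    rw [Complex.sq_norm, Complex.normSq_apply]; simp; ring
  have hpi : (1 : ℝ) ≤ Real.pi := by linarith [Real.pi_gt_three]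
  have h1 : (z.re : ℝ) ^ 2 + (z.im : ℝ) ^ 2 ≤ (⌈t⌉ : ℝ) := by
    rw [← hn]
    nlinarith [Int.le_ceil t, sq_nonneg ‖(z : ℂ)‖]
  have h2 : z.re ^ 2 + z.im ^ 2 ≤ ⌈t⌉ := by exact_mod_cast h1
  have key : ∀ a : ℤ, a ^ 2 ≤ ⌈t⌉ → a ∈ Set.Icc (-⌈t⌉) ⌈t⌉ := by
    intro a ha
    have h := (Int.natAbs_le_self_sq a).trans ha
    constructor <;> omega
  exact ⟨key _ (by nlinarith [sq_nonneg z.im]), key _ (by nlinarith [sq_nonneg z.re])⟩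

/-- The set of `z ∈ ℤ + iℤ` with `π |z|² ≤ t`, i.e. lying in the closed disk of area `t`. -/
def gaussianDisk (t : ℝ) : Finset GaussianInt :=
  (finite_setOf_pi_mul_norm_sq_le t).toFinset

/-- A polynomial is harmonic when `∑ i, ∂²P/∂xᵢ² = 0`. -/
def IsHarmonicPoly {d : ℕ} (P : MvPolynomial (Fin d) ℝ) : Prop :=
  ∑ i, MvPolynomial.pderiv i (MvPolynomial.pderiv i P) = 0

/-- The central factorial polynomial in the variable `xᵢ`: the product of `xᵢ + j` over
`j = -(k-1)/2, -(k-1)/2 + 1, …, (k-1)/2`. -/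
def centralFactorial {d : ℕ} (i : Fin d) (k : ℕ) : MvPolynomial (Fin d) ℂ :=
  ∏ j ∈ Finset.range k,
    (MvPolynomial.X i + MvPolynomial.C ((j : ℂ) - ((k : ℂ) - 1) / 2))

/-- The linear map sending each monomial `x₁^{k₁} ⋯ x_d^{k_d}` to the product of the central
factorial polynomials of degrees `kᵢ` in `xᵢ` (extended to complex coefficients). -/
def discretize (d : ℕ) : MvPolynomial (Fin d) ℂ →ₗ[ℂ] MvPolynomial (Fin d) ℂ :=
  (MvPolynomial.basisMonomials (Fin d) ℂ).constr ℂ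
    (fun m : Fin d →₀ ℕ => ∏ i, centralFactorial i (m i))

/-- `q_k(z)`: the value at `z = x + iy` of the discretization of `(x + iy)^k`. -/
def discretePower (k : ℕ) (z : ℂ) : ℂ :=
  MvPolynomial.eval ![(z.re : ℂ), (z.im : ℂ)]
    (discretize 2
      ((MvPolynomial.X 0 + MvPolynomial.C Complex.I * MvPolynomial.X 1) ^ k))

/-- `p_0 = 1` and `p_k(z) = q_k(z) - q_k(0)` for `k ≥ 1`. -/
def discreteHarmonic (k : ℕ) (z : ℂ) : ℂ :=
  if k = 0 then 1 else discretePower k z - discretePower k 0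

end

open MeasureTheory Set Filter Topology

noncomputable section

/-! The method is Landau's: smooth the sharp cutoff, apply Poisson summation, undo the smoothing by
finite differences. For a monomial x^{2b} with even exponents, the Riesz mean Σ x^{2b} (v-|x|²)_+^m
/ m! equals, up to 2π, the integral of e^{vs} s^{-m-1} ∏ θ_{b_i}(s) over a vertical line, because
v_+^m / m! is the inverse Laplace transform of s^{-m-1} (`besselIntegral_zero`,
`hasSum_thetaIntegral`). The modular transformation of the theta series
(`exists_hasSum_dualThetaTerm`) turns the same integral into a sum of Bessel-type integrals over
dual frequencies ξ (`hasSum_thetaIntegral_dual`). The frequency ξ = 0 gives the volume term, and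
stationary phase bounds the others (`exists_norm_besselIntegral_le`).

The m-th difference with step h of the Riesz mean lies between h^m times the sharp sums over the
balls of squared radius u and u + mh, since the weights are nonnegative (`differencedSum_mem`). On
the dual side a difference costs the smaller of h^m times an m-th derivative and 2^m times a
supremum. The two cross near |ξ| = √u/h, and summing over ξ gives an error u^{d/4+|b|-1/4}
(√u/h)^{(d-1)/2} (`exists_evenSum_le`). The sandwich itself loses about h u^{d/2+|b|-1}. Both errors
balance at h of order u^{1/(d+1)}, which yields the exponent d/2 + |b| - d/(d+1)
(`exists_abs_evenSum_sub_le`). For d = 2 and b = 0 this is (a).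

The volume coefficient of a monomial is proportional to its Gaussian moment, and odd monomials
contribute nothing on either side. A homogeneous harmonic polynomial of positive degree has zero
Gaussian mean, by integration by parts and Euler's identity (`gaussFunctional_eq_zero`), so its main
terms cancel and only the error remains: this is (b). Uniformity in P is equivalence of norms on the
finite-dimensional space of forms (`exists_coeffNorm_le`); in dimension one the sum vanishes
outright.

For (c), central factorials have a definite parity, so discretization changes a form of degree k
only in degrees at most k-2. Hence p_k(z) - z^k is O(t^{k/2-1}) on the disk, and its sum over O(t)
points is O(t^{k/2}), which (b) absorbs. -/

/-! ### Bessel integrals and stationary phase -/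

/-- The point `c + iy` of the vertical line with real part `c`. -/
def verticalLine (c y : ℝ) : ℂ := c + y * Complex.I

/-- The integrand `e^{vs} s^{-a} e^{-n/s}` at `s = c + iy`. -/
def besselKernel (c a n v y : ℝ) : ℂ :=
  Complex.exp (v * verticalLine c y) * verticalLine c y ^ (-a : ℂ) *
    Complex.exp (-(n / verticalLine c y))

/-- The integral of `e^{vs} s^{-a} e^{-n/s}` over the vertical line with real part `c`, up to the
factor `i` a Bessel function. -/
def besselIntegral (c a n v : ℝ) : ℂ := ∫ y : ℝ, besselKernel c a n v y

@[simp] theorem verticalLine_re (c y : ℝ) : (verticalLine c y).re = c := by simp [verticalLine]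

@[simp] theorem verticalLine_im (c y : ℝ) : (verticalLine c y).im = y := by simp [verticalLine]

theorem verticalLine_ne_zero {c : ℝ} (hc : 0 < c) (y : ℝ) : verticalLine c y ≠ 0 := fun h => by
  have := congrArg Complex.re h
  simp at this
  exact hc.ne' this

theorem verticalLine_mem_slitPlane {c : ℝ} (hc : 0 < c) (y : ℝ) :
    verticalLine c y ∈ Complex.slitPlane := Or.inl (by simpa)

theorem norm_verticalLine_pos {c : ℝ} (hc : 0 < c) (y : ℝ) : 0 < ‖verticalLine c y‖ :=
  norm_pos_iff.2 (verticalLine_ne_zero hc y)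

theorem abs_le_norm_verticalLine (c y : ℝ) : |y| ≤ ‖verticalLine c y‖ := by
  simpa using Complex.abs_im_le_norm (verticalLine c y)

theorem le_norm_verticalLine (c y : ℝ) : c ≤ ‖verticalLine c y‖ := by
  simpa using Complex.re_le_norm (verticalLine c y)

theorem norm_verticalLine_le {c : ℝ} (hc : 0 ≤ c) (y : ℝ) : ‖verticalLine c y‖ ≤ c + |y| := by
  refine (norm_add_le _ _).trans ?_
  simp [abs_of_nonneg hc]

theorem continuous_verticalLine (c : ℝ) : Continuous (verticalLine c) := by
  unfold verticalLine; fun_prop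

theorem hasDerivAt_verticalLine (c y : ℝ) : HasDerivAt (verticalLine c) Complex.I y := by
  unfold verticalLine
  simpa using ((hasDerivAt_id (y : ℂ)).comp_ofReal.mul_const Complex.I).const_add (c : ℂ)

theorem continuous_besselKernel {c : ℝ} (hc : 0 < c) (a n v : ℝ) :
    Continuous (besselKernel c a n v) := by
  unfold besselKernel
  have h := continuous_verticalLine c
  refine (((continuous_const.mul h).cexp).mul ?_).mul ?_
  · exact h.cpow continuous_const fun y => verticalLine_mem_slitPlane hc y
  · exact ((continuous_const.div h (verticalLine_ne_zero hc)).neg).cexp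

theorem norm_besselKernel (c a n v y : ℝ) :
    ‖besselKernel c a n v y‖ =
      Real.exp (v * c - n * c / ‖verticalLine c y‖ ^ 2) * ‖verticalLine c y‖ ^ (-a) := by
  unfold besselKernel
  rw [norm_mul, norm_mul, Complex.norm_exp, Complex.norm_exp, ← Complex.ofReal_neg,
    Complex.norm_cpow_real, mul_right_comm, ← Real.exp_add]
  congr 2
  rw [Complex.neg_re, Complex.div_re, Complex.sq_norm]
  simp
  ring

theorem integrable_norm_verticalLine_rpow {c : ℝ} (hc : 0 < c) {a : ℝ} (ha : 1 < a) :
    Integrable fun y : ℝ => ‖verticalLine c y‖ ^ (-a) := by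
  have h1 : Integrable fun y : ℝ => (1 + ‖y‖) ^ (-a) := integrable_one_add_norm (by simpa)
  -- Averaging the bounds c ≤ ‖w‖ and |y| ≤ ‖w‖ gives (min c 1 / 2)(1 + |y|) ≤ ‖w‖.
  have hm : 0 < min c 1 / 2 := by positivity
  refine (h1.const_mul ((min c 1 / 2) ^ (-a))).mono' ?_ (Eventually.of_forall fun y => ?_)
  · exact (((continuous_verticalLine c).norm).rpow_const
      fun y => Or.inl (norm_verticalLine_pos hc y).ne').aestronglyMeasurable
  · rw [Real.norm_of_nonneg (by positivity), ← Real.mul_rpow hm.le (by positivity)]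
    refine Real.rpow_le_rpow_of_nonpos (by positivity) ?_ (by linarith)
    have h2 := abs_le_norm_verticalLine c y
    have h3 := le_norm_verticalLine c y
    have h4 := min_le_left c 1
    have h5 := min_le_right c 1
    have h6 := abs_nonneg y
    rw [Real.norm_eq_abs]
    nlinarith

theorem norm_besselKernel_le {c a n v : ℝ} (hc : 0 < c) (hn : 0 ≤ n) (y : ℝ) :
    ‖besselKernel c a n v y‖ ≤ Real.exp (v * c) * ‖verticalLine c y‖ ^ (-a) := by
  rw [norm_besselKernel]
  gcongr
  have : 0 ≤ n * c / ‖verticalLine c y‖ ^ 2 := by positivity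
  linarith

theorem integrable_besselKernel {c a n v : ℝ} (hc : 0 < c) (ha : 1 < a) (hn : 0 ≤ n) :
    Integrable (besselKernel c a n v) :=
  ((integrable_norm_verticalLine_rpow hc ha).const_mul _).mono'
    (continuous_besselKernel hc a n v).aestronglyMeasurable
    (Eventually.of_forall fun y => norm_besselKernel_le hc hn y)

/-- The exponential decay of the kernel at small `s` absorbs every negative power of `s`. -/
theorem exists_norm_besselKernel_le (p : ℝ) (hp : 0 ≤ p) : ∃ C : ℝ, 0 < C ∧
    ∀ κ X : ℝ, 1 / 2 ≤ κ → κ ≤ 2 → 0 < X → ∀ y : ℝ, ‖besselKernel (κ / X) p X X y‖ ≤ C := by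
  set N := ⌈p⌉₊
  -- With abscissa κ/X and both parameters X, the norm is exp(κ - κ/r²) r^{-p}, so X survives only
  -- in r. For r ≤ 1 the bound exp(-x) ≤ N!/x^N supplies r^{2N} with 2N ≥ p; for r ≥ 1 every factor
  -- is already bounded.
  refine ⟨Real.exp 2 * (N.factorial * 2 ^ N + 1), by positivity, fun κ X h1 h2 hX y => ?_⟩
  rw [norm_besselKernel]
  have hκ : 0 < κ := by linarith
  set r := ‖verticalLine (κ / X) y‖
  have hr : 0 < r := norm_verticalLine_pos (by positivity) y
  have e1 : X * (κ / X) = κ := by field_simp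
  rw [e1, sub_eq_add_neg, Real.exp_add, mul_assoc]
  have h3 : Real.exp (-(κ / r ^ 2)) ≤ Real.exp (-(1 / (2 * r ^ 2))) := by
    refine Real.exp_le_exp.2 (neg_le_neg ?_)
    rw [div_le_div_iff₀ (by positivity) (by positivity)]
    nlinarith [sq_nonneg r]
  have h4 : Real.exp (-(1 / (2 * r ^ 2))) * r ^ (-p) ≤ N.factorial * 2 ^ N + 1 := by
    rcases le_total r 1 with hr1 | hr1
    · have h5 := Real.pow_div_factorial_le_exp (1 / (2 * r ^ 2)) (by positivity) N
      have h6 : Real.exp (-(1 / (2 * r ^ 2))) ≤ N.factorial * 2 ^ N * r ^ (2 * N) := by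
        rw [Real.exp_neg]
        refine (inv_anti₀ (by positivity) h5).trans (le_of_eq ?_)
        rw [div_pow, one_pow, mul_pow, ← pow_mul]
        field_simp
      have h7 : r ^ (2 * N) * r ^ (-p) ≤ 1 := by
        rw [← Real.rpow_natCast, ← Real.rpow_add hr]
        refine Real.rpow_le_one hr.le hr1 ?_
        have := Nat.le_ceil p
        push_cast
        linarith
      calc _ ≤ N.factorial * 2 ^ N * r ^ (2 * N) * r ^ (-p) := by gcongr
        _ = N.factorial * 2 ^ N * (r ^ (2 * N) * r ^ (-p)) := by ring
        _ ≤ N.factorial * 2 ^ N * 1 := by gcongr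
        _ ≤ _ := by linarith
    · have h5 : Real.exp (-(1 / (2 * r ^ 2))) ≤ 1 := Real.exp_le_one_iff.2 (by
        have : 0 ≤ 1 / (2 * r ^ 2) := by positivity
        linarith)
      have h6 : r ^ (-p) ≤ 1 := Real.rpow_le_one_of_one_le_of_nonpos hr1 (by linarith)
      have h7 : 0 ≤ r ^ (-p) := by positivity
      have h8 : (0 : ℝ) ≤ N.factorial * 2 ^ N := by positivity
      nlinarith [Real.exp_pos (-(1 / (2 * r ^ 2)))]
  calc _ ≤ Real.exp 2 * (Real.exp (-(1 / (2 * r ^ 2))) * r ^ (-p)) := by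
        gcongr
    _ ≤ _ := by gcongr

theorem verticalLine_sq_add_one_ne_zero {c y : ℝ} (hc : 0 < c) :
    verticalLine c y ^ 2 + 1 ≠ 0 := by
  have : verticalLine c y ^ 2 + 1 =
      (verticalLine c y - Complex.I) * (verticalLine c y + Complex.I) := by
    ring_nf; simp; ring
  rw [this]
  refine mul_ne_zero (fun h => ?_) (fun h => ?_)
  all_goals
    have := congrArg Complex.re h
    simp at this
    exact hc.ne' this

/-- The exponent X(s - 1/s) has derivative X(s² + 1)/s², so s = ±i are the stationary points. The
two linear factors are bounded below by their imaginary parts, uniformly in c. -/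
theorem le_norm_verticalLine_sq_add_one {c y : ℝ} (hy : 0 ≤ y) :
    |y - 1| * (1 + y) ≤ ‖verticalLine c y ^ 2 + 1‖ := by
  have : verticalLine c y ^ 2 + 1 =
      (verticalLine c y - Complex.I) * (verticalLine c y + Complex.I) := by
    ring_nf; simp; ring
  rw [this, norm_mul]
  gcongr
  · simpa using Complex.abs_im_le_norm (verticalLine c y - Complex.I)
  · have h := Complex.abs_im_le_norm (verticalLine c y + Complex.I)
    simp at h
    rw [abs_of_nonneg (by linarith)] at h
    linarith

/-- The function whose derivative reproduces the kernel up to a smaller term. -/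
def besselPrimitive (c a X y : ℝ) : ℂ :=
  besselKernel c (a - 2) X X y / (verticalLine c y ^ 2 + 1)

/-- The remainder after one integration by parts in the oscillatory integral. -/
def besselRemainder (c a X y : ℝ) : ℂ :=
  besselKernel c (a - 1) X X y * (2 - a) / (verticalLine c y ^ 2 + 1) -
    2 * besselKernel c (a - 3) X X y / (verticalLine c y ^ 2 + 1) ^ 2

theorem besselKernel_eq_mul {c : ℝ} (hc : 0 < c) (a n v y : ℝ) (k : ℕ) :
    besselKernel c (a - k) n v y = verticalLine c y ^ k * besselKernel c a n v y := by
  unfold besselKernel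
  have : verticalLine c y ^ (-((a - k : ℝ) : ℂ)) =
      verticalLine c y ^ k * verticalLine c y ^ (-(a : ℂ)) := by
    rw [← Complex.cpow_natCast, ← Complex.cpow_add _ _ (verticalLine_ne_zero hc y)]
    congr 1
    push_cast
    ring
  rw [this]
  ring

/-- This is integration by parts: e^{X(s-1/s)} is the derivative of itself divided by X(s² + 1)/s²,
and the remainder collects the derivative of s^{2-a}/(s² + 1). The factor i is the speed of the
path. -/
theorem hasDerivAt_besselPrimitive {c : ℝ} (hc : 0 < c) (a X y : ℝ) :
    HasDerivAt (besselPrimitive c a X)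
      (Complex.I * (X * besselKernel c a X X y + besselRemainder c a X y)) y := by
  set w := verticalLine c y with hw
  have h0 : w ≠ 0 := verticalLine_ne_zero hc y
  have h1 : w ^ 2 + 1 ≠ 0 := verticalLine_sq_add_one_ne_zero hc
  have hs : w ∈ Complex.slitPlane := verticalLine_mem_slitPlane hc y
  have key : HasDerivAt (fun s : ℂ => Complex.exp (X * s) * s ^ (-((a - 2 : ℝ) : ℂ)) *
      Complex.exp (-(X / s)) / (s ^ 2 + 1))
      (X * besselKernel c a X X y + besselRemainder c a X y) w := by
    have e1 : HasDerivAt (fun s : ℂ => Complex.exp (X * s)) (Complex.exp (X * w) * (X * 1)) w :=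
      ((hasDerivAt_id w).const_mul (X : ℂ)).cexp
    have e2 : HasDerivAt (fun s : ℂ => s ^ (-((a - 2 : ℝ) : ℂ)))
        (-((a - 2 : ℝ) : ℂ) * w ^ (-((a - 2 : ℝ) : ℂ) - 1) * 1) w :=
      (hasDerivAt_id w).cpow_const hs
    have e3 : HasDerivAt (fun s : ℂ => Complex.exp (-(X / s)))
        (Complex.exp (-(X / w)) * (-((0 * w - X * 1) / w ^ 2))) w :=
      ((((hasDerivAt_const w (X : ℂ)).div (hasDerivAt_id w) h0)).neg).cexp
    have e4 : HasDerivAt (fun s : ℂ => s ^ 2 + 1) (2 * w) w := by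
      simpa using (hasDerivAt_pow 2 w).add_const (1 : ℂ)
    refine (((e1.mul e2).mul e3).div e4 h1).congr_deriv ?_
    unfold besselRemainder besselKernel
    rw [← hw]
    have p1 : w ^ (-((a - 2 : ℝ) : ℂ)) = w ^ 2 * w ^ (-(a : ℂ)) := by
      rw [← Complex.cpow_natCast, ← Complex.cpow_add _ _ h0]; congr 1; push_cast; ring
    have p2 : w ^ (-((a - 2 : ℝ) : ℂ) - 1) = w * w ^ (-(a : ℂ)) := by
      nth_rw 2 [← Complex.cpow_one w]
      rw [← Complex.cpow_add _ _ h0]; congr 1; push_cast; ring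
    have p3 : w ^ (-((a - 1 : ℝ) : ℂ)) = w * w ^ (-(a : ℂ)) := by
      nth_rw 2 [← Complex.cpow_one w]
      rw [← Complex.cpow_add _ _ h0]; congr 1; push_cast; ring
    have p4 : w ^ (-((a - 3 : ℝ) : ℂ)) = w ^ 3 * w ^ (-(a : ℂ)) := by
      rw [← Complex.cpow_natCast, ← Complex.cpow_add _ _ h0]; congr 1; push_cast; ring
    simp only [Pi.mul_apply, p1, p2, p3, p4]
    field_simp
    push_cast
    ring
  have := key.scomp y (hasDerivAt_verticalLine c y)
  rw [smul_eq_mul] at this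
  exact this

/-- Written with the kernel of order a - 1, the numerator carries one factor w, and ‖w‖ ≤ 1 + y
cancels the harmless factor of the denominator, leaving the distance to the stationary point. -/
theorem norm_besselPrimitive_le {c a X C y : ℝ} (hc : 0 < c) (hc1 : c ≤ 1)
    (hC : ‖besselKernel c (a - 1) X X y‖ ≤ C) (hy : 0 ≤ y) (hy1 : y ≠ 1) :
    ‖besselPrimitive c a X y‖ ≤ C / |y - 1| := by
  have h1 : 0 < |y - 1| := abs_pos.2 (sub_ne_zero.2 hy1)
  have hC0 : 0 ≤ C := (norm_nonneg _).trans hC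
  have h2 : besselKernel c (a - 2) X X y = verticalLine c y * besselKernel c (a - 1) X X y := by
    have := besselKernel_eq_mul hc (a - 1) X X y 1
    rw [pow_one] at this
    rw [← this]
    congr 1
    push_cast
    ring
  rw [besselPrimitive, h2, norm_div, norm_mul]
  have h3 : ‖verticalLine c y‖ ≤ 1 + y := (norm_verticalLine_le hc.le y).trans (by
    rw [abs_of_nonneg hy]; linarith)
  calc _ ≤ (1 + y) * C / (|y - 1| * (1 + y)) := by
        gcongr
        exact le_norm_verticalLine_sq_add_one hy
    _ = _ := by field_simp

/-- Both terms decay like (y-1)^{-2}, which is integrable away from y = 1 with integral at most 1/δ;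
the remainder is thus no worse than the boundary terms. -/
theorem norm_besselRemainder_le {c a X C y : ℝ} (hc : 0 < c) (hc1 : c ≤ 1)
    (hC : ‖besselKernel c (a - 1) X X y‖ ≤ C) (hy : 0 ≤ y) (hy1 : y ≠ 1) :
    ‖besselRemainder c a X y‖ ≤ C * (|2 - a| + 2) * ((y - 1) ^ 2)⁻¹ := by
  have h1 : 0 < |y - 1| := abs_pos.2 (sub_ne_zero.2 hy1)
  have hC0 : 0 ≤ C := (norm_nonneg _).trans hC
  have h2 : besselKernel c (a - 3) X X y =
      verticalLine c y ^ 2 * besselKernel c (a - 1) X X y := by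
    rw [← besselKernel_eq_mul hc (a - 1) X X y 2]
    congr 1
    push_cast
    ring
  have h3 : ‖verticalLine c y‖ ≤ 1 + y := (norm_verticalLine_le hc.le y).trans (by
    rw [abs_of_nonneg hy]; linarith)
  have h4 := le_norm_verticalLine_sq_add_one (c := c) hy
  have h5 : |y - 1| ≤ 1 + y := abs_le.2 ⟨by linarith, by linarith⟩
  have h6 : ‖((2 : ℂ) - a)‖ = |2 - a| := by
    rw [← Real.norm_eq_abs, ← Complex.norm_real]; push_cast; rfl
  have h7 : ‖besselKernel c (a - 1) X X y * (2 - a) / (verticalLine c y ^ 2 + 1)‖ ≤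
      C * |2 - a| * ((y - 1) ^ 2)⁻¹ := by
    rw [norm_div, norm_mul, h6, ← sq_abs (y - 1), ← div_eq_mul_inv]
    gcongr
    nlinarith
  have h8 : ‖2 * besselKernel c (a - 3) X X y / (verticalLine c y ^ 2 + 1) ^ 2‖ ≤
      2 * C * ((y - 1) ^ 2)⁻¹ := by
    rw [h2, norm_div, norm_mul, norm_mul, norm_pow, norm_pow, Complex.norm_two]
    calc _ ≤ 2 * ((1 + y) ^ 2 * C) / (|y - 1| * (1 + y)) ^ 2 := by gcongr
      _ = _ := by rw [mul_pow, sq_abs]; field_simp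
  calc _ ≤ _ := norm_sub_le _ _
    _ ≤ _ := add_le_add h7 h8
    _ = _ := by ring

theorem continuous_besselRemainder {c : ℝ} (hc : 0 < c) (a X : ℝ) :
    Continuous (besselRemainder c a X) := by
  unfold besselRemainder
  have h : Continuous fun y => verticalLine c y ^ 2 + 1 :=
    ((continuous_verticalLine c).pow 2).add continuous_const
  exact (((continuous_besselKernel hc _ _ _).mul continuous_const).div h
    fun y => verticalLine_sq_add_one_ne_zero hc).sub
    ((continuous_const.mul (continuous_besselKernel hc _ _ _)).div (h.pow 2)
    fun y => pow_ne_zero 2 (verticalLine_sq_add_one_ne_zero hc))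

theorem integral_inv_sub_one_sq {p q : ℝ} (h : 1 ∉ uIcc p q) :
    IntervalIntegrable (fun y : ℝ => ((y - 1) ^ 2)⁻¹) volume p q ∧
    ∫ y in p..q, ((y - 1) ^ 2)⁻¹ = (p - 1)⁻¹ - (q - 1)⁻¹ := by
  have hne : ∀ y ∈ uIcc p q, y - 1 ≠ 0 := fun y hy h0 => h (by
    rwa [sub_eq_zero.1 h0] at hy)
  have hi : IntervalIntegrable (fun y : ℝ => ((y - 1) ^ 2)⁻¹) volume p q := by
    refine ContinuousOn.intervalIntegrable ?_
    exact ContinuousOn.inv₀ (by fun_prop) fun y hy => pow_ne_zero 2 (hne y hy)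
  refine ⟨hi, ?_⟩
  rw [intervalIntegral.integral_eq_sub_of_hasDerivAt (f := fun y => -(y - 1)⁻¹) ?_ hi]
  · ring
  · intro y hy
    have := ((((hasDerivAt_id y).sub_const 1).inv (hne y hy))).neg
    refine this.congr_deriv ?_
    simp only [id]
    rw [neg_div, neg_neg, one_div]

/-- The integral of the kernel over an interval that avoids the stationary point `y = 1`. -/
theorem norm_integral_besselKernel_le {c a X C p q δ : ℝ} (hc : 0 < c) (hc1 : c ≤ 1) (hX : 0 < X)
    (hC : ∀ y, ‖besselKernel c (a - 1) X X y‖ ≤ C) (hp : 0 ≤ p) (hpq : p ≤ q) (hδ : 0 < δ)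
    (h : q ≤ 1 - δ ∨ 1 + δ ≤ p) :
    ‖∫ y in p..q, besselKernel c a X X y‖ ≤ C * (|2 - a| + 4) / (X * δ) := by
  have hC0 : 0 ≤ C := (norm_nonneg _).trans (hC 0)
  have h1 : 1 ∉ uIcc p q := by
    rw [uIcc_of_le hpq]
    rintro ⟨h2, h3⟩
    rcases h with h | h <;> linarith
  have hK := (continuous_besselKernel hc a X X).intervalIntegrable (μ := volume) p q
  have hR := (continuous_besselRemainder hc a X).intervalIntegrable (μ := volume) p q
  have e1 := intervalIntegral.integral_eq_sub_of_hasDerivAt (a := p) (b := q)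
    (fun y _ => hasDerivAt_besselPrimitive hc a X y)
    (((hK.const_mul (X : ℂ)).add hR).const_mul Complex.I)
  rw [intervalIntegral.integral_const_mul, intervalIntegral.integral_add (hK.const_mul _) hR,
    intervalIntegral.integral_const_mul] at e1
  have e2 : X * ∫ y in p..q, besselKernel c a X X y =
      -Complex.I * (besselPrimitive c a X q - besselPrimitive c a X p) -
        ∫ y in p..q, besselRemainder c a X y := by
    rw [← e1]
    linear_combination ((X * ∫ y in p..q, besselKernel c a X X y) +
      ∫ y in p..q, besselRemainder c a X y) * Complex.I_sq
  have hdist : ∀ y ∈ Icc p q, δ ≤ |y - 1| := by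
    intro y hy
    rcases h with h | h
    · rw [abs_of_nonpos (by linarith [hy.2])]; linarith [hy.2]
    · rw [abs_of_nonneg (by linarith [hy.1])]; linarith [hy.1]
  have hne : ∀ y ∈ Icc p q, y ≠ 1 := fun y hy h0 => by
    have := hdist y hy
    rw [h0] at this
    simp at this
    linarith
  have hprim : ∀ y ∈ Icc p q, ‖besselPrimitive c a X y‖ ≤ C / δ := fun y hy =>
    (norm_besselPrimitive_le hc hc1 (hC y) (hp.trans hy.1) (hne y hy)).trans (by
      gcongr; exact hdist y hy)
  obtain ⟨hi, hi'⟩ := integral_inv_sub_one_sq h1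
  have hrem : ‖∫ y in p..q, besselRemainder c a X y‖ ≤ C * (|2 - a| + 2) * δ⁻¹ := by
    refine (intervalIntegral.norm_integral_le_of_norm_le hpq (Eventually.of_forall fun y hy =>
      norm_besselRemainder_le hc hc1 (hC y) (hp.trans hy.1.le) (hne y ⟨hy.1.le, hy.2⟩))
      (hi.const_mul _)).trans ?_
    rw [intervalIntegral.integral_const_mul, hi']
    gcongr
    rcases h with h | h
    · have h2 : (1 - q)⁻¹ ≤ δ⁻¹ := inv_anti₀ hδ (by linarith)
      have h3 : 0 ≤ (1 - p)⁻¹ := inv_nonneg.2 (by linarith)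
      have h4 : (q - 1)⁻¹ = -(1 - q)⁻¹ := by rw [← inv_neg]; congr 1; ring
      have h5 : (p - 1)⁻¹ = -(1 - p)⁻¹ := by rw [← inv_neg]; congr 1; ring
      linarith
    · have h2 : (p - 1)⁻¹ ≤ δ⁻¹ := inv_anti₀ hδ (by linarith)
      have h3 : 0 ≤ (q - 1)⁻¹ := inv_nonneg.2 (by linarith)
      linarith
  have e3 : X * ‖∫ y in p..q, besselKernel c a X X y‖ ≤ C * (|2 - a| + 4) / δ := by
    have : ‖(X : ℂ) * ∫ y in p..q, besselKernel c a X X y‖ =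
        X * ‖∫ y in p..q, besselKernel c a X X y‖ := by
      rw [norm_mul, Complex.norm_real, Real.norm_of_nonneg hX.le]
    rw [← this, e2]
    calc _ ≤ ‖-Complex.I * (besselPrimitive c a X q - besselPrimitive c a X p)‖ +
          ‖∫ y in p..q, besselRemainder c a X y‖ := norm_sub_le _ _
      _ ≤ (C / δ + C / δ) + C * (|2 - a| + 2) * δ⁻¹ := by
        gcongr
        rw [norm_mul, norm_neg, Complex.norm_I, one_mul]
        exact (norm_sub_le _ _).trans (add_le_add (hprim q ⟨hpq, le_rfl⟩) (hprim p ⟨le_rfl, hpq⟩))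
      _ = _ := by field_simp; ring
  rw [mul_comm X δ, ← div_div, le_div_iff₀ hX, mul_comm]
  exact e3

theorem norm_integral_Ioi_besselKernel_le {κ a X C C' : ℝ} (hκ : 0 < κ) (hκ2 : κ ≤ 2) (ha : 1 < a)
    (hX : 2 ≤ X) (hC : ∀ y, ‖besselKernel (κ / X) (a - 1) X X y‖ ≤ C)
    (hC' : ∀ y, ‖besselKernel (κ / X) a X X y‖ ≤ C') :
    ‖∫ y in Ioi (0 : ℝ), besselKernel (κ / X) a X X y‖ ≤
      (2 * (C * (|2 - a| + 4)) + 2 * C') / √X := by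
  have hX0 : 0 < X := by linarith
  have hc : 0 < κ / X := by positivity
  have hc1 : κ / X ≤ 1 := by rw [div_le_one hX0]; linarith
  -- The window around y = 1 costs O(δ) and its complement O(1/(Xδ)); δ = 1/√X equalizes them.
  set δ := 1 / √X with hδd
  have hsX : 1 < √X := by rw [Real.lt_sqrt (by norm_num)]; linarith
  have hδ : 0 < δ := by positivity
  have hδ1 : δ < 1 := by rw [hδd, div_lt_one (by positivity)]; exact hsX
  have hXδ : X * δ = √X := by
    rw [hδd, mul_one_div, Real.div_sqrt]
  have hii := fun p q => (continuous_besselKernel hc a X X).intervalIntegrable (μ := volume) p q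
  refine le_of_tendsto (intervalIntegral_tendsto_integral_Ioi 0
    (integrable_besselKernel hc ha hX0.le).integrableOn tendsto_id).norm ?_
  filter_upwards [eventually_ge_atTop (2 : ℝ)] with T hT
  simp only [id]
  rw [← intervalIntegral.integral_add_adjacent_intervals (hii 0 (1 - δ)) (hii (1 - δ) T),
    ← intervalIntegral.integral_add_adjacent_intervals (hii (1 - δ) (1 + δ)) (hii (1 + δ) T)]
  have h1 := norm_integral_besselKernel_le hc hc1 hX0 hC le_rfl (q := 1 - δ) (by linarith) hδ
    (Or.inl le_rfl)
  have h2 := norm_integral_besselKernel_le hc hc1 hX0 hC (p := 1 + δ) (q := T) (by linarith)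
    (by linarith) hδ (Or.inr le_rfl)
  have h3 : ‖∫ y in (1 - δ)..(1 + δ), besselKernel (κ / X) a X X y‖ ≤ C' * (2 * δ) := by
    refine (intervalIntegral.norm_integral_le_of_norm_le_const fun y _ => hC' y).trans
      (le_of_eq ?_)
    rw [abs_of_nonneg (by linarith)]
    ring
  rw [hXδ] at h1 h2
  calc _ ≤ _ := (norm_add_le _ _).trans (add_le_add le_rfl (norm_add_le _ _))
    _ ≤ _ := add_le_add h1 (add_le_add h3 h2)
    _ = _ := by rw [hδd]; field_simp; ring

/-- Conjugate symmetry disposes of the stationary point y = -1: the lower half-line gives the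
conjugate of the upper one. -/
theorem besselKernel_neg {c : ℝ} (hc : 0 < c) (a n v y : ℝ) :
    besselKernel c a n v (-y) = (starRingEnd ℂ) (besselKernel c a n v y) := by
  have h1 : verticalLine c (-y) = (starRingEnd ℂ) (verticalLine c y) := by
    apply Complex.ext <;> simp
  have h2 : (verticalLine c y).arg ≠ Real.pi := Complex.slitPlane_arg_ne_pi
    (verticalLine_mem_slitPlane hc y)
  have h3 := Complex.conj_cpow (verticalLine c y) (-a : ℂ) h2
  unfold besselKernel
  rw [h1, h3]
  simp [← Complex.exp_conj]

theorem exists_norm_besselIntegral_self_le (a : ℝ) (ha : 1 < a) : ∃ C : ℝ, 0 < C ∧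
    ∀ κ X : ℝ, 1 / 2 ≤ κ → κ ≤ 2 → 2 ≤ X → ‖besselIntegral (κ / X) a X X‖ ≤ C / √X := by
  obtain ⟨C, hC, h1⟩ := exists_norm_besselKernel_le (a - 1) (by linarith)
  obtain ⟨C', hC', h2⟩ := exists_norm_besselKernel_le a (by linarith)
  refine ⟨2 * (2 * (C * (|2 - a| + 4)) + 2 * C'), by positivity, fun κ X hκ hκ2 hX => ?_⟩
  have hX0 : 0 < X := by linarith
  have hκ0 : 0 < κ := by linarith
  have hc : 0 < κ / X := by positivity
  have h3 := norm_integral_Ioi_besselKernel_le hκ0 hκ2 ha hX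
    (h1 κ X hκ hκ2 hX0) (h2 κ X hκ hκ2 hX0)
  have hi := integrable_besselKernel (v := X) hc ha hX0.le
  have h4 : ∫ y in Iic (0 : ℝ), besselKernel (κ / X) a X X y =
      (starRingEnd ℂ) (∫ y in Ioi (0 : ℝ), besselKernel (κ / X) a X X y) := by
    have := integral_comp_neg_Ioi 0 (besselKernel (κ / X) a X X)
    rw [neg_zero] at this
    rw [← this, ← integral_conj]
    simp_rw [besselKernel_neg hc]
  rw [besselIntegral, ← intervalIntegral.integral_Iic_add_Ioi (b := 0) hi.integrableOn
    hi.integrableOn, h4]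
  refine (norm_add_le _ _).trans ?_
  rw [RCLike.norm_conj]
  exact (add_le_add h3 h3).trans (le_of_eq (by ring))

theorem ofReal_mul_cpow {l : ℝ} (hl : 0 < l) {w : ℂ} (hw : w ≠ 0) (r : ℂ) :
    (l * w) ^ r = (l : ℂ) ^ r * w ^ r := by
  have hl' : (l : ℂ) ≠ 0 := by exact_mod_cast hl.ne'
  rw [Complex.cpow_def_of_ne_zero (mul_ne_zero hl' hw), Complex.cpow_def_of_ne_zero hl',
    Complex.cpow_def_of_ne_zero hw, Complex.log_ofReal_mul hl hw, ← Complex.exp_add,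
    Complex.ofReal_log hl.le]
  congr 1
  ring

/-- Dilation of s. It reduces general parameters n, v to the symmetric case n = v, where the
stationary points sit at ±i. -/
theorem besselKernel_mul {c a n v l : ℝ} (hc : 0 < c) (hl : 0 < l) (y : ℝ) :
    besselKernel (l * c) a (l * n) (v / l) (l * y) = (l ^ (-a) : ℝ) * besselKernel c a n v y := by
  have h1 : verticalLine (l * c) (l * y) = l * verticalLine c y := by
    simp [verticalLine]; ring
  have hl' : (l : ℂ) ≠ 0 := by exact_mod_cast hl.ne'
  unfold besselKernel
  rw [h1, Complex.ofReal_div, Complex.ofReal_mul, mul_div_mul_left _ _ hl', ← mul_assoc,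
    div_mul_cancel₀ _ hl', ofReal_mul_cpow hl (verticalLine_ne_zero hc y),
    Complex.ofReal_cpow hl.le]
  push_cast
  ring

/-- The decay of the Bessel function: the factor `(vn)^{-1/4}` comes from the stationary phase. -/
theorem exists_norm_besselIntegral_le (a : ℝ) (ha : 1 < a) : ∃ C : ℝ, 0 < C ∧
    ∀ c n v : ℝ, 0 < v → 0 < n → 1 / 2 ≤ v * c → v * c ≤ 2 → 4 ≤ v * n →
      ‖besselIntegral c a n v‖ ≤ C * (v / n) ^ ((a - 1) / 2) * (v * n) ^ (-(1 / 4) : ℝ) := by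
  obtain ⟨C, hC, h⟩ := exists_norm_besselIntegral_self_le a ha
  refine ⟨C, hC, fun c n v hv hn h1 h2 h3 => ?_⟩
  have hc : 0 < c := by
    by_contra h0
    nlinarith
  set X := √(v * n) with hXd
  have hX : 2 ≤ X := Real.le_sqrt_of_sq_le (by linarith)
  have hX0 : 0 < X := by linarith
  have hXX : X * X = v * n := Real.mul_self_sqrt (by positivity)
  -- Here l = √(v/n), the dilation that makes both l n and v/l equal to X = √(vn).
  set l := v / X with hld
  have hl : 0 < l := by positivity
  have hln : l * n = X := by rw [hld]; field_simp; linarith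
  have hvl : v / l = X := by rw [hld]; field_simp
  have hlc : l * c = v * c / X := by rw [hld]; ring
  have e1 : besselIntegral c a n v = (l ^ (a - 1) : ℝ) * besselIntegral (v * c / X) a X X := by
    have h4 : ∀ y, besselKernel c a n v y =
        (l ^ a : ℝ) * besselKernel (v * c / X) a X X (l * y) := fun y => by
      have := besselKernel_mul (a := a) (n := n) (v := v) hc hl y
      rw [hln, hvl, hlc] at this
      rw [this, ← mul_assoc, ← Complex.ofReal_mul, ← Real.rpow_add hl]
      simp
    unfold besselIntegral
    simp_rw [h4]
    rw [integral_const_mul, Measure.integral_comp_mul_left, abs_of_pos (inv_pos.2 hl),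
      Complex.real_smul, ← mul_assoc, ← Complex.ofReal_mul, Real.rpow_sub_one hl.ne',
      div_eq_mul_inv (l ^ a) l]
  have hl2 : l = (v / n) ^ (1 / 2 : ℝ) := by
    rw [← Real.sqrt_eq_rpow, eq_comm, Real.sqrt_eq_iff_mul_self_eq (by positivity) hl.le]
    rw [hld]
    field_simp
    rw [sq, hXX]
  have hX2 : (v * n) ^ (-(1 / 4) : ℝ) = 1 / √X := by
    rw [hXd, Real.sqrt_eq_rpow, Real.sqrt_eq_rpow, ← Real.rpow_mul (by positivity),
      Real.rpow_neg (by positivity), one_div]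
    norm_num
  rw [e1, norm_mul, Complex.norm_real, Real.norm_of_nonneg (by positivity), hX2, hl2,
    ← Real.rpow_mul (by positivity)]
  calc _ ≤ (v / n) ^ (1 / 2 * (a - 1)) * (C / √X) := by
        gcongr
        exact h _ _ h1 h2 hX
    _ = _ := by
        rw [show (1 / 2 * (a - 1)) = (a - 1) / 2 by ring]
        ring

/-! ### Laplace transform of powers and its inversion -/

theorem integrableOn_rpow_mul_exp_neg {a c : ℝ} (ha : 0 < a) (hc : 0 < c) :
    IntegrableOn (fun t : ℝ => t ^ (a - 1) * Real.exp (-(c * t))) (Ioi 0) := by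
  have := integrableOn_rpow_mul_exp_neg_mul_rpow (s := a - 1) (p := 1) (b := c) (by linarith)
    one_pos hc
  simpa using this

theorem aestronglyMeasurable_rpow_mul_cexp (a : ℝ) (r : ℂ) :
    AEStronglyMeasurable (fun t : ℝ => ((t ^ (a - 1) : ℝ) : ℂ) * Complex.exp (-(r * t)))
      (volume.restrict (Ioi 0)) := by
  refine ContinuousOn.aestronglyMeasurable ?_ measurableSet_Ioi
  refine ContinuousOn.mul ?_ (by fun_prop)
  exact Complex.continuous_ofReal.comp_continuousOn
    (continuousOn_id.rpow_const fun t ht => Or.inl (ne_of_gt ht))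

theorem integrableOn_rpow_mul_cexp_neg {a : ℝ} {r : ℂ} (ha : 0 < a) (hr : 0 < r.re) :
    IntegrableOn (fun t : ℝ => ((t ^ (a - 1) : ℝ) : ℂ) * Complex.exp (-(r * t))) (Ioi 0) := by
  refine (integrableOn_rpow_mul_exp_neg ha hr).mono' (aestronglyMeasurable_rpow_mul_cexp a r)
    ((ae_restrict_iff' measurableSet_Ioi).2 (Eventually.of_forall fun t ht => ?_))
  rw [norm_mul, Complex.norm_real, Complex.norm_exp,
    Real.norm_of_nonneg (Real.rpow_nonneg (le_of_lt ht) _)]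
  simp

/-- Holomorphy in r is what allows the Gamma integral to be continued from real r. The r-derivative
adds a factor t, and on the half-plane Re z > Re r / 2 the exponential is dominated uniformly. -/
theorem differentiableAt_integral_rpow_mul_cexp {a : ℝ} {r : ℂ} (ha : 0 < a) (hr : 0 < r.re) :
    DifferentiableAt ℂ
      (fun r : ℂ => ∫ t in Ioi (0 : ℝ), ((t ^ (a - 1) : ℝ) : ℂ) * Complex.exp (-(r * t))) r := by
  have hs : {z : ℂ | r.re / 2 < z.re} ∈ 𝓝 r :=
    (isOpen_lt continuous_const Complex.continuous_re).mem_nhds (by simp; linarith)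
  refine (hasDerivAt_integral_of_dominated_loc_of_deriv_le
    (bound := fun t : ℝ => t ^ (a + 1 - 1) * Real.exp (-(r.re / 2 * t)))
    (F' := fun z (t : ℝ) => ((t ^ (a - 1) : ℝ) : ℂ) * (Complex.exp (-(z * t)) * -(1 * (t : ℂ)))) hs
    (Eventually.of_forall fun z => aestronglyMeasurable_rpow_mul_cexp a z)
    (integrableOn_rpow_mul_cexp_neg ha hr) ?_ ?_
    (integrableOn_rpow_mul_exp_neg (by linarith) (by linarith)) ?_).2.differentiableAt
  · simp_rw [← mul_assoc]
    exact (aestronglyMeasurable_rpow_mul_cexp a r).mul (by fun_prop)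
  · refine (ae_restrict_iff' measurableSet_Ioi).2 (Eventually.of_forall fun t ht z hz => ?_)
    have ht : (0 : ℝ) < t := ht
    have hz : r.re / 2 < z.re := hz
    rw [norm_mul, norm_mul, Complex.norm_real, Complex.norm_exp, norm_neg, one_mul,
      Complex.norm_real, Real.norm_of_nonneg ht.le, Real.norm_of_nonneg (by positivity),
      mul_comm (Real.exp _), ← mul_assoc, ← Real.rpow_add_one ht.ne']
    rw [show a - 1 + 1 = a + 1 - 1 by ring]
    gcongr
    simp
    gcongr
  · refine Eventually.of_forall fun t z _ => ?_
    exact (((hasDerivAt_id z).mul_const (t : ℂ)).neg.cexp).const_mul _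

/-- The Laplace transform of `t ↦ t^{a-1}` in the right half-plane. -/
theorem integral_rpow_mul_cexp_neg {a : ℝ} {r : ℂ} (ha : 0 < a) (hr : 0 < r.re) :
    ∫ t in Ioi (0 : ℝ), ((t ^ (a - 1) : ℝ) : ℂ) * Complex.exp (-(r * t)) =
      Real.Gamma a * r ^ (-a : ℂ) := by
  have hU : IsOpen {z : ℂ | 0 < z.re} := isOpen_lt continuous_const Complex.continuous_re
  have hf : AnalyticOnNhd ℂ (fun r : ℂ => ∫ t in Ioi (0 : ℝ), ((t ^ (a - 1) : ℝ) : ℂ) *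
      Complex.exp (-(r * t))) {z : ℂ | 0 < z.re} :=
    DifferentiableOn.analyticOnNhd
      (fun z hz => (differentiableAt_integral_rpow_mul_cexp ha hz).differentiableWithinAt) hU
  have hg : AnalyticOnNhd ℂ (fun r : ℂ => (Real.Gamma a : ℂ) * r ^ (-a : ℂ)) {z : ℂ | 0 < z.re} :=
    DifferentiableOn.analyticOnNhd (fun z hz =>
      ((differentiableAt_id.cpow_const (Or.inl hz)).const_mul _).differentiableWithinAt) hU
  have hc : IsPreconnected {z : ℂ | 0 < z.re} := (convex_halfSpace_re_gt 0).isPreconnected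
  -- Identity theorem on the right half-plane: both sides agree at real points accumulating at 1,
  -- where the formula is the real Gamma integral.
  refine hf.eqOn_of_preconnected_of_frequently_eq hg hc (z₀ := 1) (by simp) ?_ hr
  have key : ∀ x : ℝ, 0 < x →
      ∫ t in Ioi (0 : ℝ), ((t ^ (a - 1) : ℝ) : ℂ) * Complex.exp (-((x : ℂ) * t)) =
      Real.Gamma a * (x : ℂ) ^ (-a : ℂ) := by
    intro x hx
    have h1 := Real.integral_rpow_mul_exp_neg_mul_Ioi ha hx
    have h2 : ∀ t : ℝ, ((t ^ (a - 1) : ℝ) : ℂ) * Complex.exp (-((x : ℂ) * t)) =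
        ((t ^ (a - 1) * Real.exp (-(x * t)) : ℝ) : ℂ) := fun t => by push_cast; rfl
    simp_rw [h2]
    rw [integral_complex_ofReal, h1, ← Complex.ofReal_neg, ← Complex.ofReal_cpow hx.le,
      ← Complex.ofReal_mul, one_div, Real.inv_rpow hx.le, Real.rpow_neg hx.le, mul_comm]
  have ht : Tendsto (fun x : ℝ => (x : ℂ)) (𝓝[≠] 1) (𝓝[≠] 1) := by
    refine tendsto_nhdsWithin_iff.2 ⟨?_, ?_⟩
    · exact (Complex.continuous_ofReal.tendsto 1).mono_left nhdsWithin_le_nhds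
    · filter_upwards [self_mem_nhdsWithin] with x hx
      simpa using hx
  refine ht.frequently (Eventually.frequently ?_)
  filter_upwards [mem_nhdsWithin_of_mem_nhds (lt_mem_nhds (zero_lt_one' ℝ))] with x hx
  exact key x hx

/-- Inverse Laplace transform of `s ↦ s^{-a}`. -/
theorem besselIntegral_zero {c a : ℝ} (hc : 0 < c) (ha : 1 < a) (v : ℝ) :
    besselIntegral c a 0 v = ((2 * Real.pi * (max v 0) ^ (a - 1) / Real.Gamma a : ℝ) : ℂ) := by
  have hG : Real.Gamma a ≠ 0 := (Real.Gamma_pos_of_pos (by linarith)).ne'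
  -- Fourier inversion of t_+^{a-1} e^{-ct}, whose transform is Γ(a) s^{-a} along the line. The
  -- condition a > 1 makes f continuous and its transform integrable, so inversion holds at every
  -- point.
  set f : ℝ → ℂ := fun t => (((max t 0) ^ (a - 1) : ℝ) : ℂ) * Complex.exp (-((c : ℂ) * t)) with hf
  have hfc : Continuous f := by
    refine Continuous.mul (Complex.continuous_ofReal.comp ?_) (by fun_prop)
    exact (continuous_id.max continuous_const).rpow_const fun t => Or.inr (by linarith)
  have hf0 : ∀ t ∉ Ioi (0 : ℝ), f t = 0 := fun t ht => by
    have : max t 0 = 0 := max_eq_right (not_lt.1 ht)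
    simp only [hf, this]
    rw [Real.zero_rpow (by linarith)]
    simp
  have hfe : ∀ t ∈ Ioi (0 : ℝ), f t = ((t ^ (a - 1) : ℝ) : ℂ) * Complex.exp (-((c : ℂ) * t)) :=
    fun t ht => by
      have : max t 0 = t := max_eq_left (le_of_lt ht)
      simp only [hf, this]
  have hfi : Integrable f := by
    rw [← integrableOn_iff_integrable_of_support_subset (s := Ioi 0)
      (fun t ht => by by_contra h; exact ht (hf0 t h))]
    exact (integrableOn_rpow_mul_cexp_neg (r := (c : ℂ)) (by linarith) (by simpa)).congr_fun
      (fun t ht => (hfe t ht).symm) measurableSet_Ioi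
  have hFT : ∀ ξ : ℝ, FourierTransform.fourier f ξ =
      Real.Gamma a * verticalLine c (2 * Real.pi * ξ) ^ (-a : ℂ) := by
    intro ξ
    rw [Real.fourier_eq', ← integral_rpow_mul_cexp_neg (by linarith) (by simpa),
      ← setIntegral_eq_integral_of_forall_compl_eq_zero (s := Ioi 0)
        (fun t ht => by rw [hf0 t ht, smul_zero])]
    refine setIntegral_congr_fun measurableSet_Ioi fun t ht => ?_
    rw [hfe t ht, smul_eq_mul, mul_left_comm, ← Complex.exp_add]
    congr 2
    simp [verticalLine]
    ring
  have hFi : Integrable (FourierTransform.fourier f) := by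
    have h1 : Integrable fun y => verticalLine c y ^ (-a : ℂ) := by
      have := integrable_besselKernel (v := 0) hc ha le_rfl
      unfold besselKernel at this
      simpa using this
    have h2 := (h1.comp_mul_left' (R := 2 * Real.pi) (by positivity)).const_mul
      (Real.Gamma a : ℂ)
    exact h2.congr (Eventually.of_forall fun ξ => (hFT ξ).symm)
  have hinv := congrFun (hfc.fourierInv_fourier_eq hfi hFi) v
  rw [Real.fourierInv_eq'] at hinv
  simp_rw [hFT] at hinv
  have h3 : ∀ ξ : ℝ, Complex.exp ((↑(2 * Real.pi * inner ℝ ξ v) * Complex.I)) •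
      (Real.Gamma a * verticalLine c (2 * Real.pi * ξ) ^ (-a : ℂ) : ℂ) =
      (Real.Gamma a * Complex.exp (-((c : ℂ) * v))) * besselKernel c a 0 v (2 * Real.pi * ξ) := by
    intro ξ
    unfold besselKernel
    simp only [Complex.ofReal_zero, zero_div, neg_zero, Complex.exp_zero, mul_one, smul_eq_mul]
    have : Complex.exp (↑(2 * Real.pi * inner ℝ ξ v) * Complex.I) =
        Complex.exp (-((c : ℂ) * v)) * Complex.exp (v * verticalLine c (2 * Real.pi * ξ)) := by
      rw [← Complex.exp_add]
      congr 1
      simp [verticalLine]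
      ring
    rw [this]
    ring
  simp_rw [h3] at hinv
  rw [integral_const_mul, Measure.integral_comp_mul_left, abs_of_pos (by positivity),
    Complex.real_smul] at hinv
  change _ * (_ * besselIntegral c a 0 v) = _ at hinv
  simp only [hf] at hinv
  have hE : Complex.exp (-((c : ℂ) * v)) ≠ 0 := Complex.exp_ne_zero _
  have hG' : (Real.Gamma a : ℂ) ≠ 0 := by exact_mod_cast hG
  have hpi : (Real.pi : ℂ) ≠ 0 := by exact_mod_cast Real.pi_ne_zero
  push_cast at hinv ⊢
  field_simp at hinv ⊢
  linear_combination hinv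

/-- Differentiation in v inserts a factor s, lowering the order by one; a > 2 keeps the
differentiated kernel integrable. -/
theorem hasDerivAt_besselIntegral {c a n : ℝ} (hc : 0 < c) (ha : 2 < a) (hn : 0 ≤ n) (v : ℝ) :
    HasDerivAt (besselIntegral c a n) (besselIntegral c (a - 1) n v) v := by
  have hk : ∀ v y, besselKernel c (a - 1) n v y = verticalLine c y * besselKernel c a n v y :=
    fun v y => by simpa using besselKernel_eq_mul hc a n v y 1
  refine (hasDerivAt_integral_of_dominated_loc_of_deriv_le (s := Iio (v + 1))
    (bound := fun y => Real.exp ((v + 1) * c) * ‖verticalLine c y‖ ^ (-(a - 1)))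
    (F' := fun v y => besselKernel c (a - 1) n v y) (Iio_mem_nhds (by linarith))
    (Eventually.of_forall fun v => (continuous_besselKernel hc a n v).aestronglyMeasurable)
    (integrable_besselKernel hc (by linarith) hn)
    (continuous_besselKernel hc (a - 1) n v).aestronglyMeasurable
    (Eventually.of_forall fun y x hx => ?_)
    ((integrable_norm_verticalLine_rpow hc (by linarith)).const_mul _)
    (Eventually.of_forall fun y x _ => ?_)).2
  · refine (norm_besselKernel_le hc hn y).trans ?_
    have : x < v + 1 := hx
    gcongr
  · rw [hk]
    unfold besselKernel
    have h1 : HasDerivAt (fun x : ℝ => Complex.exp (x * verticalLine c y))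
        (Complex.exp (x * verticalLine c y) * (1 * verticalLine c y)) x :=
      (((hasDerivAt_id (x : ℂ)).comp_ofReal).mul_const _).cexp
    refine ((h1.mul_const _).mul_const _).congr_deriv ?_
    ring

/-! ### Theta series and their modular transformation -/

theorem summable_int_pow_mul_exp_neg {δ : ℝ} (hδ : 0 < δ) (k : ℕ) :
    Summable fun n : ℤ => |(n : ℝ)| ^ k * Real.exp (-(δ * (n : ℝ) ^ 2)) := by
  have h1 : Summable fun n : ℤ => ((k + 2).factorial / δ ^ (k + 2)) * (1 / (n : ℝ) ^ 2) :=
    (Real.summable_one_div_int_pow.2 one_lt_two).mul_left _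
  refine Summable.of_norm_bounded_eventually h1 ?_
  have h0 : ({0}ᶜ : Set ℤ) ∈ cofinite := (finite_singleton 0).compl_mem_cofinite
  filter_upwards [h0] with n hn
  have hn0 : (n : ℝ) ≠ 0 := by exact_mod_cast hn
  have hn1 : 1 ≤ |(n : ℝ)| := by exact_mod_cast Int.one_le_abs hn
  have h2 := Real.pow_div_factorial_le_exp (δ * (n : ℝ) ^ 2) (by positivity) (k + 2)
  rw [Real.norm_of_nonneg (by positivity), Real.exp_neg]
  have h3 : (Real.exp (δ * (n : ℝ) ^ 2))⁻¹ ≤ (k + 2).factorial / (δ * (n : ℝ) ^ 2) ^ (k + 2) := by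
    rw [← inv_div]
    exact inv_anti₀ (by positivity) h2
  calc _ ≤ |(n : ℝ)| ^ k * ((k + 2).factorial / (δ * (n : ℝ) ^ 2) ^ (k + 2)) := by gcongr
    _ = ((k + 2).factorial / δ ^ (k + 2)) * (|(n : ℝ)| ^ k / (|(n : ℝ)| ^ 2) ^ (k + 2)) := by
      rw [mul_pow, sq_abs]; ring
    _ ≤ _ := by
      refine mul_le_mul_of_nonneg_left ?_ (by positivity)
      rw [← sq_abs (n : ℝ)]
      rw [div_le_div_iff₀ (by positivity) (by positivity), one_mul, ← pow_add, ← pow_mul]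
      exact pow_le_pow_right₀ hn1 (by omega)

/-- The theta series `∑ n^{2b} e^{-s n²}`. -/
def evenTheta (b : ℕ) (s : ℂ) : ℂ := ∑' n : ℤ, (n : ℂ) ^ (2 * b) * Complex.exp (-(s * (n : ℂ) ^ 2))

theorem norm_evenTheta_term (b : ℕ) (s : ℂ) (n : ℤ) :
    ‖(n : ℂ) ^ (2 * b) * Complex.exp (-(s * (n : ℂ) ^ 2))‖ =
      |(n : ℝ)| ^ (2 * b) * Real.exp (-(s.re * (n : ℝ) ^ 2)) := by
  rw [norm_mul, norm_pow, Complex.norm_intCast, Complex.norm_exp]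
  congr 2
  have : (n : ℂ) ^ 2 = (((n : ℝ) ^ 2 : ℝ) : ℂ) := by push_cast; rfl
  rw [this, Complex.neg_re, Complex.re_mul_ofReal]

/-- Each s-derivative inserts -n², so the weighted theta series of all even weights are obtained
from Jacobi's by repeated differentiation. -/
theorem hasDerivAt_evenTheta (b : ℕ) {s : ℂ} (hs : 0 < s.re) :
    HasSum (fun n : ℤ => -((n : ℂ) ^ (2 * (b + 1)) * Complex.exp (-(s * (n : ℂ) ^ 2))))
      (deriv (evenTheta b) s) := by
  have hd : ∀ (n : ℤ) (z : ℂ), HasDerivAt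
      (fun z : ℂ => (n : ℂ) ^ (2 * b) * Complex.exp (-(z * (n : ℂ) ^ 2)))
      (-((n : ℂ) ^ (2 * (b + 1)) * Complex.exp (-(z * (n : ℂ) ^ 2)))) z := fun n z => by
    refine ((((hasDerivAt_id z).mul_const ((n : ℂ) ^ 2)).neg.cexp).const_mul _).congr_deriv ?_
    simp only [id, Pi.neg_apply]
    ring
  have := Complex.hasSum_deriv_of_summable_norm (U := {z : ℂ | s.re / 2 < z.re})
    (summable_int_pow_mul_exp_neg (δ := s.re / 2) (by linarith) (2 * b))
    (fun n z _ => (hd n z).differentiableAt.differentiableWithinAt)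
    (isOpen_lt continuous_const Complex.continuous_re) ?_
    (show s ∈ {z : ℂ | s.re / 2 < z.re} by simp; linarith)
  · simp_rw [fun n : ℤ => (hd n s).deriv] at this
    exact this
  · intro n z hz
    have hz : s.re / 2 < z.re := hz
    rw [norm_evenTheta_term]
    gcongr

/-- The terms of the theta series after the modular transformation. -/
def dualThetaTerm (γ : ℕ → ℝ) (b : ℕ) (m : ℤ) (s : ℂ) : ℂ :=
  ∑ j ∈ Finset.range (b + 1), γ j * (m : ℂ) ^ (2 * j) * s ^ (-((1 / 2 + b + j : ℝ) : ℂ)) *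
    Complex.exp (-(((Real.pi * m) ^ 2 : ℝ) / s))

theorem norm_exp_neg_div (q : ℝ) (s : ℂ) :
    ‖Complex.exp (-((q : ℂ) / s))‖ = Real.exp (-(q * (s.re / ‖s‖ ^ 2))) := by
  rw [Complex.norm_exp, Complex.neg_re, Complex.div_re, Complex.sq_norm]
  simp
  ring

/-- The bound is uniform on Re s ≥ δ, ‖s‖ ≤ B, where Re(1/s) ≥ δ/B²; this is the domination needed
to differentiate the dual series termwise. -/
theorem norm_dualThetaTerm_le (γ : ℕ → ℝ) (b : ℕ) (m : ℤ) {s : ℂ} {δ B : ℝ} (hδ : 0 < δ)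
    (h1 : δ ≤ s.re) (h2 : ‖s‖ ≤ B) : ‖dualThetaTerm γ b m s‖ ≤
      ∑ j ∈ Finset.range (b + 1), |γ j| * δ ^ (-(1 / 2 + b + j : ℝ)) *
        (|(m : ℝ)| ^ (2 * j) * Real.exp (-(Real.pi ^ 2 * (δ / B ^ 2) * (m : ℝ) ^ 2))) := by
  refine (norm_sum_le _ _).trans (Finset.sum_le_sum fun j _ => ?_)
  have hs : δ ≤ ‖s‖ := h1.trans (Complex.re_le_norm s)
  have hs0 : 0 < ‖s‖ := hδ.trans_le hs
  rw [norm_mul, norm_mul, norm_mul, norm_pow, Complex.norm_real, Complex.norm_intCast,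
    norm_exp_neg_div, ← Complex.ofReal_neg, Complex.norm_cpow_real, Real.norm_eq_abs,
    mul_right_comm |γ j|, mul_assoc (|γ j| * _)]
  gcongr ?_ * ?_ * (?_ * Real.exp ?_)
  · exact Real.rpow_le_rpow_of_nonpos hδ hs (by
      have : (0 : ℝ) ≤ 1 / 2 + b + j := by positivity
      linarith)
  · rw [neg_le_neg_iff]
    have : δ / B ^ 2 ≤ s.re / ‖s‖ ^ 2 := by
      have := hδ.le.trans h1
      gcongr
    calc _ = (Real.pi * m) ^ 2 * (δ / B ^ 2) := by ring
      _ ≤ _ := by gcongr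

theorem summable_dualThetaTerm_bound (γ : ℕ → ℝ) (b : ℕ) {δ B : ℝ} (hδ : 0 < δ) (hB : 0 < B) :
    Summable fun m : ℤ => ∑ j ∈ Finset.range (b + 1), |γ j| * δ ^ (-(1 / 2 + b + j : ℝ)) *
        (|(m : ℝ)| ^ (2 * j) * Real.exp (-(Real.pi ^ 2 * (δ / B ^ 2) * (m : ℝ) ^ 2))) :=
  summable_sum fun j _ => (summable_int_pow_mul_exp_neg (by positivity) _).mul_left _

theorem summable_norm_dualThetaTerm (γ : ℕ → ℝ) (b : ℕ) {s : ℂ} (hs : 0 < s.re) :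
    Summable fun m : ℤ => ‖dualThetaTerm γ b m s‖ :=
  Summable.of_nonneg_of_le (fun _ => norm_nonneg _)
    (fun m => norm_dualThetaTerm_le γ b m hs le_rfl le_rfl)
    (summable_dualThetaTerm_bound γ b hs (hs.trans_le (Complex.re_le_norm s)))

/-- The recursion for the coefficients of the transformed theta series. -/
def dualThetaStep (γ : ℕ → ℝ) (b : ℕ) (j : ℕ) : ℝ :=
  (if j ≤ b then (1 / 2 + b + j) * γ j else 0) - (if j = 0 then 0 else Real.pi ^ 2 * γ (j - 1))

/-- Differentiating the power of s keeps j and raises the exponent by one; differentiating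
exp(-(πm)²/s) raises j by one and the exponent by two. Both fit the same shape with b + 1, and
matching coefficients gives `dualThetaStep`. -/
theorem hasDerivAt_dualThetaTerm (γ : ℕ → ℝ) (b : ℕ) (m : ℤ) {s : ℂ} (hs : 0 < s.re) :
    HasDerivAt (dualThetaTerm γ b m) (-dualThetaTerm (dualThetaStep γ b) (b + 1) m s) s := by
  have h0 : s ≠ 0 := fun h => by simp [h] at hs
  set E := Complex.exp (-(((Real.pi * m) ^ 2 : ℝ) / s)) with hE
  have hj : ∀ j : ℕ, HasDerivAt (fun s : ℂ => γ j * (m : ℂ) ^ (2 * j) *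
      s ^ (-((1 / 2 + b + j : ℝ) : ℂ)) * Complex.exp (-(((Real.pi * m) ^ 2 : ℝ) / s)))
      (-(((1 / 2 + b + j : ℝ) * γ j : ℝ) * (m : ℂ) ^ (2 * j) *
          s ^ (-((1 / 2 + (b + 1 : ℕ) + j : ℝ) : ℂ)) * E) +
        ((Real.pi ^ 2 * γ j : ℝ) * (m : ℂ) ^ (2 * (j + 1)) *
          s ^ (-((1 / 2 + (b + 1 : ℕ) + (j + 1 : ℕ) : ℝ) : ℂ)) * E)) s := by
    intro j
    have e2 : HasDerivAt (fun s : ℂ => s ^ (-((1 / 2 + b + j : ℝ) : ℂ)))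
        (-((1 / 2 + b + j : ℝ) : ℂ) * s ^ (-((1 / 2 + b + j : ℝ) : ℂ) - 1) * 1) s :=
      (hasDerivAt_id s).cpow_const (Or.inl hs)
    have e3 : HasDerivAt (fun s : ℂ => Complex.exp (-(((Real.pi * m) ^ 2 : ℝ) / s)))
        (E * (-((0 * s - ((Real.pi * m) ^ 2 : ℝ) * 1) / s ^ 2))) s :=
      ((((hasDerivAt_const s (((Real.pi * m) ^ 2 : ℝ) : ℂ)).div (hasDerivAt_id s) h0)).neg).cexp
    refine ((e2.const_mul (γ j * (m : ℂ) ^ (2 * j))).mul e3).congr_deriv ?_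
    rw [← hE]
    set P := s ^ (-((1 / 2 + (b + 1 : ℕ) + (j + 1 : ℕ) : ℝ) : ℂ)) with hP
    have p1 : s ^ (-((1 / 2 + b + j : ℝ) : ℂ)) = s ^ 2 * P := by
      rw [hP, ← Complex.cpow_natCast, ← Complex.cpow_add _ _ h0]; congr 1; push_cast; ring
    have p2 : s ^ (-((1 / 2 + b + j : ℝ) : ℂ) - 1) = s * P := by
      nth_rw 2 [← Complex.cpow_one s]
      rw [hP, ← Complex.cpow_add _ _ h0]; congr 1; push_cast; ring
    have p3 : s ^ (-((1 / 2 + (b + 1 : ℕ) + j : ℝ) : ℂ)) = s * P := by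
      nth_rw 2 [← Complex.cpow_one s]
      rw [hP, ← Complex.cpow_add _ _ h0]; congr 1; push_cast; ring
    rw [p1, p2, p3]
    field_simp
    push_cast
    ring
  have hsum := HasDerivAt.fun_sum (u := Finset.range (b + 1)) fun j _ => hj j
  refine hsum.congr_deriv ?_
  unfold dualThetaTerm
  rw [← Finset.sum_neg_distrib, Finset.sum_add_distrib]
  have hA : ∑ j ∈ Finset.range (b + 1 + 1),
      ((if j ≤ b then (1 / 2 + b + j) * γ j else 0 : ℝ) : ℂ) * (m : ℂ) ^ (2 * j) *
        s ^ (-((1 / 2 + (b + 1 : ℕ) + j : ℝ) : ℂ)) * E =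
      ∑ j ∈ Finset.range (b + 1), (((1 / 2 + b + j : ℝ) * γ j : ℝ) : ℂ) * (m : ℂ) ^ (2 * j) *
        s ^ (-((1 / 2 + (b + 1 : ℕ) + j : ℝ) : ℂ)) * E := by
    rw [Finset.sum_range_succ, if_neg (by omega)]
    simp only [Complex.ofReal_zero, zero_mul, add_zero]
    refine Finset.sum_congr rfl fun j hj => ?_
    rw [if_pos (by simpa [Nat.lt_succ_iff] using hj)]
  have hB : ∑ j ∈ Finset.range (b + 1 + 1),
      ((if j = 0 then 0 else Real.pi ^ 2 * γ (j - 1) : ℝ) : ℂ) * (m : ℂ) ^ (2 * j) *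
        s ^ (-((1 / 2 + (b + 1 : ℕ) + j : ℝ) : ℂ)) * E =
      ∑ j ∈ Finset.range (b + 1), ((Real.pi ^ 2 * γ j : ℝ) : ℂ) * (m : ℂ) ^ (2 * (j + 1)) *
        s ^ (-((1 / 2 + (b + 1 : ℕ) + (j + 1 : ℕ) : ℝ) : ℂ)) * E := by
    rw [Finset.sum_range_succ', if_pos rfl]
    simp only [Complex.ofReal_zero, zero_mul, add_zero]
    refine Finset.sum_congr rfl fun j hj => ?_
    rw [if_neg (by omega), Nat.add_sub_cancel]
  rw [Finset.sum_neg_distrib, ← hA, ← hB, ← Finset.sum_neg_distrib, ← Finset.sum_add_distrib]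
  refine Finset.sum_congr rfl fun j _ => ?_
  rw [dualThetaStep, ← hE, Complex.ofReal_sub]
  ring

/-- Jacobi's identity, in the form `Complex.tsum_exp_neg_mul_int_sq` at s/π. -/
theorem hasSum_dualThetaTerm_zero {s : ℂ} (hs : 0 < s.re) :
    HasSum (fun m : ℤ => dualThetaTerm (fun _ => √Real.pi) 0 m s) (evenTheta 0 s) := by
  have h0 : s ≠ 0 := fun h => by simp [h] at hs
  have hpi : (Real.pi : ℂ) ≠ 0 := by exact_mod_cast Real.pi_ne_zero
  have hsm := (summable_norm_dualThetaTerm (fun _ => √Real.pi) 0 hs).of_norm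
  refine hsm.hasSum_iff.2 ?_
  have key := Complex.tsum_exp_neg_mul_int_sq (a := s / Real.pi) (by
    rw [Complex.div_ofReal_re]; positivity)
  have e1 : evenTheta 0 s = ∑' n : ℤ, Complex.exp (-Real.pi * (s / Real.pi) * (n : ℂ) ^ 2) := by
    unfold evenTheta
    refine tsum_congr fun n => ?_
    simp only [mul_zero, pow_zero, one_mul]
    congr 1
    field_simp
  rw [e1, key, ← tsum_mul_left]
  refine tsum_congr fun m => ?_
  simp only [dualThetaTerm, zero_add, Finset.sum_range_one, mul_zero, pow_zero, mul_one,
    Nat.cast_zero, add_zero]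
  have e2 : (1 : ℂ) / (s / Real.pi) ^ (1 / 2 : ℂ) =
      ((√Real.pi : ℝ) : ℂ) * s ^ (-((1 / 2 : ℝ) : ℂ)) := by
    rw [one_div, ← Complex.cpow_neg, div_eq_inv_mul, ← Complex.ofReal_inv,
      ofReal_mul_cpow (inv_pos.2 Real.pi_pos) h0, Real.sqrt_eq_rpow, Complex.ofReal_cpow
      Real.pi_pos.le, Complex.ofReal_inv, Complex.inv_cpow, Complex.cpow_neg, inv_inv]
    · push_cast; rfl
    · rw [Complex.arg_ofReal_of_nonneg Real.pi_pos.le]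
      exact Real.pi_pos.ne
  rw [e2]
  congr 2
  push_cast
  field_simp

/-- The modular transformation of the theta series with weight `n^{2b}`. -/
theorem exists_hasSum_dualThetaTerm (b : ℕ) : ∃ γ : ℕ → ℝ, γ 0 = Real.Gamma (b + 1 / 2) ∧
    ∀ s : ℂ, 0 < s.re → HasSum (fun m : ℤ => dualThetaTerm γ b m s) (evenTheta b s) := by
  induction b with
  | zero =>
    refine ⟨fun _ => √Real.pi, ?_, fun s hs => hasSum_dualThetaTerm_zero hs⟩
    simpa using Real.Gamma_one_half_eq.symm
  | succ b ih =>
    obtain ⟨γ, hγ0, hγ⟩ := ih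
    refine ⟨dualThetaStep γ b, ?_, fun s hs => ?_⟩
    · simp only [dualThetaStep, zero_le, if_true, hγ0, Nat.cast_zero, add_zero, sub_zero]
      have h1 : (b + 1 / 2 : ℝ) ≠ 0 := by positivity
      rw [show ((b + 1 : ℕ) : ℝ) + 1 / 2 = (b + 1 / 2) + 1 by push_cast; ring,
        Real.Gamma_add_one h1]
      ring
    -- The identity for b holds near s, so its two sides have the same derivative; each is
    -- differentiated termwise and the signs cancel.
    · have hU : IsOpen ({z : ℂ | s.re / 2 < z.re} ∩ {z : ℂ | ‖z‖ < ‖s‖ + 1}) :=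
        (isOpen_lt continuous_const Complex.continuous_re).inter
          (isOpen_lt continuous_norm continuous_const)
      have h1 := Complex.hasSum_deriv_of_summable_norm
        (summable_dualThetaTerm_bound γ b (δ := s.re / 2) (B := ‖s‖ + 1) (by linarith)
          (by positivity))
        (fun m z hz => (hasDerivAt_dualThetaTerm γ b m
          (lt_trans (by linarith) hz.1)).differentiableAt.differentiableWithinAt) hU
        (fun m z hz => norm_dualThetaTerm_le γ b m (by linarith) (le_of_lt hz.1)
          (le_of_lt hz.2))
        (show s ∈ {z : ℂ | s.re / 2 < z.re} ∩ {z : ℂ | ‖z‖ < ‖s‖ + 1} from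
          ⟨by simp; linarith, by simp⟩)
      simp_rw [fun m : ℤ => (hasDerivAt_dualThetaTerm γ b m hs).deriv] at h1
      have h2 : deriv (fun w => ∑' m : ℤ, dualThetaTerm γ b m w) s = deriv (evenTheta b) s := by
        refine Filter.EventuallyEq.deriv_eq ?_
        filter_upwards [(isOpen_lt continuous_const Complex.continuous_re).mem_nhds hs] with z hz
        exact (hγ z hz).tsum_eq
      rw [h2, ← (hasDerivAt_evenTheta b hs).tsum_eq, tsum_neg] at h1
      simpa [evenTheta] using h1.neg

/-! ### Lattice sums in dimension d and the two expansions of the theta integral -/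

theorem hasSum_prod_pi {α : Type*} {d : ℕ} (f : Fin d → α → ℂ)
    (hf : ∀ i, Summable fun n => ‖f i n‖) :
    (Summable fun x : Fin d → α => ‖∏ i, f i (x i)‖) ∧
      HasSum (fun x : Fin d → α => ∏ i, f i (x i)) (∏ i, ∑' n, f i n) := by
  induction d with
  | zero =>
    refine ⟨(hasSum_unique _).summable, ?_⟩
    simp
  | succ d ih =>
    obtain ⟨h1, h2⟩ := ih (fun i => f i.succ) (fun i => hf i.succ)
    have h3 := (hf 0).mul_norm h1
    have h4 := (hf 0).of_norm.hasSum.mul h2 h3.of_norm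
    refine ⟨?_, ?_⟩
    · rw [← (Fin.consEquiv fun _ => α).summable_iff]
      refine h3.congr fun p => ?_
      simp [Fin.prod_univ_succ, Fin.consEquiv]
    · rw [← (Fin.consEquiv fun _ => α).hasSum_iff, Fin.prod_univ_succ]
      refine h4.congr_fun fun p => ?_
      simp [Fin.prod_univ_succ, Fin.consEquiv]

/-- The sum of the squares of the coordinates of an integer vector. -/
def sqSum {d : ℕ} (x : Fin d → ℤ) : ℝ := ∑ i, (x i : ℝ) ^ 2

/-- The monomial with all exponents even, evaluated at an integer vector. -/
def evenMonomial {d : ℕ} (b : Fin d → ℕ) (x : Fin d → ℤ) : ℝ := ∏ i, (x i : ℝ) ^ (2 * b i)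

theorem sqSum_nonneg {d : ℕ} (x : Fin d → ℤ) : 0 ≤ sqSum x :=
  Finset.sum_nonneg fun _ _ => sq_nonneg _

theorem evenMonomial_nonneg {d : ℕ} (b : Fin d → ℕ) (x : Fin d → ℤ) : 0 ≤ evenMonomial b x :=
  Finset.prod_nonneg fun _ _ => by rw [pow_mul]; positivity

theorem one_le_sqSum {d : ℕ} {x : Fin d → ℤ} (hx : x ≠ 0) : 1 ≤ sqSum x := by
  obtain ⟨i, hi⟩ := Function.ne_iff.1 hx
  have h1 : (1 : ℝ) ≤ (x i : ℝ) ^ 2 := by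
    have : 0 < (x i) ^ 2 := sq_pos_of_ne_zero hi
    exact_mod_cast this
  exact h1.trans (Finset.single_le_sum (f := fun i => (x i : ℝ) ^ 2) (fun i _ => sq_nonneg _)
    (Finset.mem_univ i))

theorem evenMonomial_le {d : ℕ} (b : Fin d → ℕ) (x : Fin d → ℤ) :
    evenMonomial b x ≤ sqSum x ^ (∑ i, b i) := by
  rw [← Finset.prod_pow_eq_pow_sum]
  refine Finset.prod_le_prod (fun i _ => by rw [pow_mul]; positivity) fun i _ => ?_
  rw [pow_mul]
  gcongr
  exact Finset.single_le_sum (f := fun i => (x i : ℝ) ^ 2) (fun i _ => sq_nonneg _)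
    (Finset.mem_univ i)

theorem cpow_neg_sum {ι : Type*} (t : Finset ι) (p : ι → ℝ) {s : ℂ} (hs : s ≠ 0) :
    ∏ i ∈ t, s ^ (-(p i : ℂ)) = s ^ (-((∑ i ∈ t, p i : ℝ) : ℂ)) := by
  classical
  induction t using Finset.induction_on with
  | empty => simp
  | insert i t hi ih =>
    rw [Finset.prod_insert hi, ih, ← Complex.cpow_add _ _ hs, Finset.sum_insert hi]
    push_cast
    congr 1
    ring

theorem prod_evenTheta_term {d : ℕ} (b : Fin d → ℕ) (s : ℂ) (x : Fin d → ℤ) :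
    ∏ i, ((x i : ℂ) ^ (2 * b i) * Complex.exp (-(s * (x i : ℂ) ^ 2))) =
      evenMonomial b x * Complex.exp (-(s * sqSum x)) := by
  rw [Finset.prod_mul_distrib, ← Complex.exp_sum]
  simp only [evenMonomial, sqSum]
  push_cast
  rw [Finset.mul_sum, Finset.sum_neg_distrib]

theorem hasSum_prod_evenTheta {d : ℕ} (b : Fin d → ℕ) {s : ℂ} (hs : 0 < s.re) :
    (Summable fun x : Fin d → ℤ => ‖(evenMonomial b x : ℂ) * Complex.exp (-(s * sqSum x))‖) ∧
      HasSum (fun x : Fin d → ℤ => (evenMonomial b x : ℂ) * Complex.exp (-(s * sqSum x)))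
        (∏ i, evenTheta (b i) s) := by
  have := hasSum_prod_pi
    (fun (i : Fin d) (n : ℤ) => (n : ℂ) ^ (2 * b i) * Complex.exp (-(s * (n : ℂ) ^ 2)))
    (fun i => by
      simp_rw [norm_evenTheta_term]
      exact summable_int_pow_mul_exp_neg hs _)
  simp_rw [prod_evenTheta_term] at this
  exact this

/-- The multi-indices `J ≤ b`. -/
def subIndices {d : ℕ} (b : Fin d → ℕ) : Finset (Fin d → ℕ) :=
  Fintype.piFinset fun i => Finset.range (b i + 1)

theorem sum_le_of_mem_subIndices {d : ℕ} {b J : Fin d → ℕ} (hJ : J ∈ subIndices b) :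
    ∑ i, J i ≤ ∑ i, b i := by
  refine Finset.sum_le_sum fun i _ => ?_
  have := Fintype.mem_piFinset.1 hJ i
  simpa [Nat.lt_succ_iff] using this

/-- The exponent of `1/s` in the transformed theta series. -/
def dualExponent {d : ℕ} (b J : Fin d → ℕ) : ℝ := d / 2 + ∑ i, (b i : ℝ) + ∑ i, (J i : ℝ)

theorem prod_dualThetaTerm {d : ℕ} (γ : Fin d → ℕ → ℝ) (b : Fin d → ℕ) (ξ : Fin d → ℤ) {s : ℂ}
    (hs : s ≠ 0) : ∏ i, dualThetaTerm (γ i) (b i) (ξ i) s =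
      ∑ J ∈ subIndices b, ((∏ i, γ i (J i) : ℝ) : ℂ) * evenMonomial J ξ *
        s ^ (-(dualExponent b J : ℂ)) * Complex.exp (-((Real.pi ^ 2 * sqSum ξ : ℝ) / s)) := by
  unfold dualThetaTerm
  rw [Finset.prod_univ_sum]
  refine Finset.sum_congr rfl fun J _ => ?_
  rw [Finset.prod_mul_distrib, Finset.prod_mul_distrib, Finset.prod_mul_distrib,
    ← Complex.exp_sum, cpow_neg_sum _ _ hs]
  congr 1
  · congr 1
    · simp [evenMonomial]
    · congr 3
      rw [Finset.sum_add_distrib, Finset.sum_add_distrib]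
      simp [dualExponent]
      ring
  · congr 1
    rw [Finset.sum_neg_distrib, ← Finset.sum_div]
    congr 2
    simp only [sqSum, Finset.mul_sum]
    push_cast
    refine Finset.sum_congr rfl fun i _ => by ring

/-- Each 1 + ξ_i² is at most 2|ξ|² for ξ ≠ 0, so |ξ|^{-2d} is dominated by a product of convergent
one-variable series. The exponent is far from sharp but serves for absolute convergence. -/
theorem summable_sqSum_inv_pow (d : ℕ) : Summable fun ξ : Fin d → ℤ => (sqSum ξ ^ d)⁻¹ := by
  have h1 : Summable fun n : ℤ => ‖(((1 + (n : ℝ) ^ 2)⁻¹ : ℝ) : ℂ)‖ := by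
    have h0 : ({0}ᶜ : Set ℤ) ∈ cofinite := (finite_singleton 0).compl_mem_cofinite
    refine Summable.of_norm_bounded_eventually (Real.summable_one_div_int_pow.2 one_lt_two) ?_
    filter_upwards [h0] with n hn
    have hn0 : (n : ℝ) ≠ 0 := by exact_mod_cast hn
    rw [norm_norm, Complex.norm_real, Real.norm_of_nonneg (by positivity), one_div]
    exact inv_anti₀ (by positivity) (by linarith)
  have h2 := (hasSum_prod_pi (fun (_ : Fin d) (n : ℤ) => (((1 + (n : ℝ) ^ 2)⁻¹ : ℝ) : ℂ))
    fun _ => h1).1.mul_left (2 ^ d)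
  have h0 : ({0}ᶜ : Set (Fin d → ℤ)) ∈ cofinite := (finite_singleton 0).compl_mem_cofinite
  refine Summable.of_norm_bounded_eventually h2 ?_
  filter_upwards [h0] with ξ hξ
  have hq := one_le_sqSum hξ
  rw [← Complex.ofReal_prod, Complex.norm_real,
    Real.norm_of_nonneg (Finset.prod_nonneg fun i _ => by positivity),
    Real.norm_of_nonneg (by positivity), Finset.prod_inv_distrib, ← div_eq_mul_inv,
    inv_eq_one_div, div_le_div_iff₀ (by positivity)
      (Finset.prod_pos fun i _ => by positivity), one_mul, ← mul_pow]
  calc ∏ i, (1 + (ξ i : ℝ) ^ 2) ≤ ∏ _i : Fin d, 2 * sqSum ξ := by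
        refine Finset.prod_le_prod (fun i _ => by positivity) fun i _ => ?_
        have := Finset.single_le_sum (f := fun i => (ξ i : ℝ) ^ 2) (fun i _ => sq_nonneg _)
          (Finset.mem_univ i)
        unfold sqSum at hq ⊢
        linarith
    _ = _ := by simp

/-- The factor exp(-nc/r²) is traded for (nc)^{-M} r^{2M}: M powers of decay in the frequency at the
price of 2M in the order. This crude bound only justifies termwise integration of the dual series.
-/
theorem integral_norm_besselKernel_le {c a n v : ℝ} {M : ℕ} (hc : 0 < c) (hn : 0 < n)
    (ha : 2 * M + 1 < a) : ∫ y, ‖besselKernel c a n v y‖ ≤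
      Real.exp (v * c) * (M.factorial / (n * c) ^ M) *
        ∫ y, ‖verticalLine c y‖ ^ (-(a - 2 * M)) := by
  rw [← integral_const_mul]
  refine integral_mono (integrable_besselKernel hc (by
      have : (0 : ℝ) ≤ M := by positivity
      linarith) hn.le).norm
    ((integrable_norm_verticalLine_rpow hc (by linarith)).const_mul _) fun y => ?_
  have hr := norm_verticalLine_pos hc y
  simp only
  rw [norm_besselKernel]
  set r := ‖verticalLine c y‖
  have h1 := Real.pow_div_factorial_le_exp (n * c / r ^ 2) (by positivity) M
  rw [sub_eq_add_neg, Real.exp_add, Real.exp_neg]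
  have h2 : (Real.exp (n * c / r ^ 2))⁻¹ ≤ M.factorial / (n * c) ^ M * r ^ (2 * M) := by
    refine (inv_anti₀ (by positivity) h1).trans (le_of_eq ?_)
    rw [inv_div, div_pow, ← pow_mul, div_div_eq_mul_div]
    ring
  have h3 : r ^ (-(a - 2 * M)) = r ^ (2 * M) * r ^ (-a) := by
    rw [← Real.rpow_natCast, ← Real.rpow_add hr]
    congr 1
    push_cast
    ring
  rw [h3]
  calc _ ≤ Real.exp (v * c) * (M.factorial / (n * c) ^ M * r ^ (2 * M)) * r ^ (-a) := by gcongr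
    _ = _ := by ring

/-- The contour integral that represents the Riesz means. -/
def thetaIntegral {d : ℕ} (b : Fin d → ℕ) (m : ℕ) (c v : ℝ) : ℂ :=
  ∫ y : ℝ, Complex.exp (v * verticalLine c y) * verticalLine c y ^ (-((m + 1 : ℝ) : ℂ)) *
    ∏ i, evenTheta (b i) (verticalLine c y)

/-- On the line Re s = c each summand has norm at most its value at the real point s = c times an
integrable function of y, so the theta product may be expanded under the integral. -/
theorem hasSum_thetaIntegral {d : ℕ} (b : Fin d → ℕ) {m : ℕ} (hm : 1 ≤ m) {c : ℝ} (hc : 0 < c)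
    (v : ℝ) : HasSum (fun x : Fin d → ℤ =>
      (evenMonomial b x : ℂ) * besselIntegral c (m + 1) 0 (v - sqSum x))
      (thetaIntegral b m c v) := by
  have hm' : (1 : ℝ) < m + 1 := by
    have : (1 : ℝ) ≤ m := by exact_mod_cast hm
    linarith
  have h1 := hasSum_integral_of_summable_integral_norm (μ := volume)
    (F := fun (x : Fin d → ℤ) (y : ℝ) =>
      (evenMonomial b x : ℂ) * besselKernel c (m + 1) 0 (v - sqSum x) y)
    (fun x => (integrable_besselKernel hc hm' le_rfl).const_mul _) ?_
  · simp_rw [integral_const_mul] at h1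
    suffices e : thetaIntegral b m c v = ∫ y, ∑' x : Fin d → ℤ,
        (evenMonomial b x : ℂ) * besselKernel c (m + 1) 0 (v - sqSum x) y by
      rw [e]
      exact h1
    refine integral_congr_ae (Eventually.of_forall fun y => ?_)
    simp only
    have h2 := (hasSum_prod_evenTheta b (s := verticalLine c y) (by simpa)).2
    rw [← h2.tsum_eq, ← tsum_mul_left]
    refine tsum_congr fun x => ?_
    unfold besselKernel
    have h3 : Complex.exp (↑(v - sqSum x) * verticalLine c y) =
        Complex.exp (v * verticalLine c y) * Complex.exp (-(verticalLine c y * sqSum x)) := by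
      rw [← Complex.exp_add]
      push_cast
      congr 1
      ring
    rw [h3]
    simp
    ring
  · have h2 := ((hasSum_prod_evenTheta b (s := c) (by simpa)).1.mul_left
      (Real.exp (v * c) * ∫ y, ‖verticalLine c y‖ ^ (-(m + 1 : ℝ))))
    refine Summable.of_nonneg_of_le (fun x => integral_nonneg fun y => norm_nonneg _)
      (fun x => ?_) h2
    simp_rw [norm_mul, integral_const_mul]
    rw [Complex.norm_exp]
    calc _ ≤ ‖(evenMonomial b x : ℂ)‖ * ∫ y, Real.exp ((v - sqSum x) * c) *
          ‖verticalLine c y‖ ^ (-(m + 1 : ℝ)) := by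
          refine mul_le_mul_of_nonneg_left (integral_mono
            (integrable_besselKernel hc hm' le_rfl).norm
            ((integrable_norm_verticalLine_rpow hc hm').const_mul _)
            fun y => norm_besselKernel_le hc le_rfl y) (norm_nonneg _)
      _ = _ := by
          rw [integral_const_mul, sub_mul, sub_eq_add_neg, Real.exp_add]
          simp
          ring_nf

theorem hasSum_thetaIntegral_dual {d : ℕ} (b : Fin d → ℕ) (γ : Fin d → ℕ → ℝ)
    (hγ : ∀ i, ∀ s : ℂ, 0 < s.re →
      HasSum (fun m : ℤ => dualThetaTerm (γ i) (b i) m s) (evenTheta (b i) s))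
    {m : ℕ} (hm : 2 * (∑ i, b i + d) + 1 ≤ m) {c : ℝ} (hc : 0 < c)
    (v : ℝ) : HasSum (fun ξ : Fin d → ℤ => ∑ J ∈ subIndices b,
      ((∏ i, γ i (J i) : ℝ) : ℂ) * evenMonomial J ξ *
        besselIntegral c (m + 1 + dualExponent b J) (Real.pi ^ 2 * sqSum ξ) v)
      (thetaIntegral b m c v) := by
  -- Of the M inverse powers of |ξ|², Σ b_i absorb the monomial weight and d remain for convergence.
  -- The hypothesis on m keeps the order of every kernel above 2M + 1.
  set M := ∑ i, b i + d with hM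
  have hexp : ∀ J, 2 * (M : ℝ) + 1 < m + 1 + dualExponent b J := fun J => by
    have h1 : (2 * M + 1 : ℝ) ≤ m := by exact_mod_cast hm
    have h2 : 0 ≤ dualExponent b J := by unfold dualExponent; positivity
    linarith
  have hM0 : (0 : ℝ) ≤ M := by positivity
  have hint : ∀ (J : Fin d → ℕ) (ξ : Fin d → ℤ), Integrable
      (besselKernel c (m + 1 + dualExponent b J) (Real.pi ^ 2 * sqSum ξ) v) := fun J ξ =>
    integrable_besselKernel hc (by linarith [hexp J])
      (mul_nonneg (by positivity) (sqSum_nonneg ξ))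
  have h1 := hasSum_integral_of_summable_integral_norm (μ := volume)
    (F := fun (ξ : Fin d → ℤ) (y : ℝ) => ∑ J ∈ subIndices b,
      ((∏ i, γ i (J i) : ℝ) : ℂ) * evenMonomial J ξ *
        besselKernel c (m + 1 + dualExponent b J) (Real.pi ^ 2 * sqSum ξ) v y)
    (fun ξ => integrable_finsetSum _ fun J _ => (hint J ξ).const_mul _) ?_
  · have h2 : ∀ ξ : Fin d → ℤ, ∫ y, ∑ J ∈ subIndices b,
        ((∏ i, γ i (J i) : ℝ) : ℂ) * evenMonomial J ξ *
          besselKernel c (m + 1 + dualExponent b J) (Real.pi ^ 2 * sqSum ξ) v y =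
        ∑ J ∈ subIndices b, ((∏ i, γ i (J i) : ℝ) : ℂ) * evenMonomial J ξ *
          besselIntegral c (m + 1 + dualExponent b J) (Real.pi ^ 2 * sqSum ξ) v := fun ξ => by
      rw [integral_finsetSum _ fun J _ => (hint J ξ).const_mul _]
      simp_rw [integral_const_mul]
      rfl
    simp_rw [h2] at h1
    suffices e : thetaIntegral b m c v = ∫ y, ∑' ξ : Fin d → ℤ, ∑ J ∈ subIndices b,
        ((∏ i, γ i (J i) : ℝ) : ℂ) * evenMonomial J ξ *
          besselKernel c (m + 1 + dualExponent b J) (Real.pi ^ 2 * sqSum ξ) v y by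
      rw [e]
      exact h1
    refine integral_congr_ae (Eventually.of_forall fun y => ?_)
    simp only
    have hs : 0 < (verticalLine c y).re := by simpa
    have hs0 := verticalLine_ne_zero hc y
    have h3 := (hasSum_prod_pi (fun i m => dualThetaTerm (γ i) (b i) m (verticalLine c y))
      fun i => summable_norm_dualThetaTerm (γ i) (b i) hs).2
    simp_rw [fun i => (hγ i _ hs).tsum_eq, prod_dualThetaTerm γ b _ hs0] at h3
    rw [← h3.tsum_eq, ← tsum_mul_left]
    refine tsum_congr fun ξ => ?_
    rw [Finset.mul_sum]
    refine Finset.sum_congr rfl fun J _ => ?_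
    unfold besselKernel
    have h4 : verticalLine c y ^ (-((m + 1 + dualExponent b J : ℝ) : ℂ)) =
        verticalLine c y ^ (-((m + 1 : ℝ) : ℂ)) * verticalLine c y ^ (-(dualExponent b J : ℂ)) := by
      rw [← Complex.cpow_add _ _ hs0]
      push_cast
      congr 1
      ring
    rw [h4]
    ring
  · have hB : Summable fun ξ : Fin d → ℤ => (∑ J ∈ subIndices b, |∏ i, γ i (J i)| *
        (Real.exp (v * c) * (M.factorial / c ^ M) *
        ∫ y, ‖verticalLine c y‖ ^ (-(m + 1 + dualExponent b J - 2 * M)))) * (sqSum ξ ^ d)⁻¹ :=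
      (summable_sqSum_inv_pow d).mul_left _
    have h0 : ({0}ᶜ : Set (Fin d → ℤ)) ∈ cofinite := (finite_singleton 0).compl_mem_cofinite
    refine Summable.of_norm_bounded_eventually hB ?_
    filter_upwards [h0] with ξ hξ
    have hq := one_le_sqSum hξ
    have hn : 0 < Real.pi ^ 2 * sqSum ξ := by positivity
    rw [Real.norm_of_nonneg (integral_nonneg fun y => norm_nonneg _)]
    have h2 : ∫ y, ‖∑ J ∈ subIndices b, ((∏ i, γ i (J i) : ℝ) : ℂ) * evenMonomial J ξ *
        besselKernel c (m + 1 + dualExponent b J) (Real.pi ^ 2 * sqSum ξ) v y‖ ≤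
        ∫ y, ∑ J ∈ subIndices b, (|∏ i, γ i (J i)| * evenMonomial J ξ) *
        ‖besselKernel c (m + 1 + dualExponent b J) (Real.pi ^ 2 * sqSum ξ) v y‖ := by
      refine integral_mono (integrable_finsetSum _ fun J _ => (hint J ξ).const_mul _).norm
        (integrable_finsetSum _ fun J _ => (hint J ξ).norm.const_mul _) fun y => ?_
      refine (norm_sum_le _ _).trans (le_of_eq (Finset.sum_congr rfl fun J _ => ?_))
      rw [norm_mul, norm_mul, Complex.norm_real, Complex.norm_real,
        Real.norm_of_nonneg (evenMonomial_nonneg J ξ), Real.norm_eq_abs]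
    refine h2.trans ?_
    rw [integral_finsetSum _ fun J _ => (hint J ξ).norm.const_mul _, Finset.sum_mul]
    refine Finset.sum_le_sum fun J hJ => ?_
    rw [integral_const_mul]
    have h3 := integral_norm_besselKernel_le (v := v) hc hn (hexp J)
    set K := ∫ y, ‖verticalLine c y‖ ^ (-(m + 1 + dualExponent b J - 2 * M))
    have hK : 0 ≤ K := integral_nonneg fun y => by positivity
    have h4 : evenMonomial J ξ ≤ sqSum ξ ^ (∑ i, b i) :=
      (evenMonomial_le J ξ).trans (pow_le_pow_right₀ hq (sum_le_of_mem_subIndices hJ))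
    have h5 : (M.factorial : ℝ) / (Real.pi ^ 2 * sqSum ξ * c) ^ M ≤
        M.factorial / c ^ M * (sqSum ξ ^ M)⁻¹ := by
      rw [mul_pow, mul_pow, div_mul_eq_div_div, ← div_eq_mul_inv, div_right_comm]
      gcongr
      refine le_mul_of_one_le_left (by positivity) (one_le_pow₀ ?_)
      nlinarith [Real.pi_gt_three]
    have h6 : sqSum ξ ^ (∑ i, b i) * (sqSum ξ ^ M)⁻¹ = (sqSum ξ ^ d)⁻¹ := by
      rw [hM, pow_add]
      field_simp
    calc _ ≤ |∏ i, γ i (J i)| * sqSum ξ ^ (∑ i, b i) *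
          (Real.exp (v * c) * (M.factorial / c ^ M * (sqSum ξ ^ M)⁻¹) * K) := by
          gcongr
          exact h3.trans (by gcongr)
      _ = |∏ i, γ i (J i)| * (Real.exp (v * c) * (M.factorial / c ^ M) * K) *
          (sqSum ξ ^ (∑ i, b i) * (sqSum ξ ^ M)⁻¹) := by ring
      _ = _ := by rw [h6]

/-! ### Finite differences of smooth functions and of truncated powers -/

/-- Iterated mean value theorem: the `m`-th forward difference of a function lies between `h^m`
times the bounds of its `m`-th derivative. -/
theorem fwdDiff_iter_mem_Icc {h : ℝ} (hh : 0 < h) (m : ℕ) (f : ℕ → ℝ → ℝ) {u lo hi : ℝ}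
    (hf : ∀ j < m, ∀ v ∈ Icc u (u + m * h), HasDerivAt (f j) (f (j + 1) v) v)
    (hlo : ∀ v ∈ Icc u (u + m * h), lo ≤ f m v) (hhi : ∀ v ∈ Icc u (u + m * h), f m v ≤ hi) :
    (fwdDiff h)^[m] (f 0) u ∈ Icc (h ^ m * lo) (h ^ m * hi) := by
  induction m generalizing f lo hi with
  | zero =>
    simpa using And.intro (hlo u (by simp)) (hhi u (by simp))
  | succ m ih =>
    rw [Function.iterate_succ_apply, pow_succ, mul_assoc, mul_assoc]
    have hmem : ∀ v ∈ Icc u (u + m * h), ∀ w ∈ Icc v (v + h), w ∈ Icc u (u + (m + 1 : ℕ) * h) := by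
      intro v hv w hw
      push_cast
      exact ⟨hv.1.trans hw.1, by linarith [hv.2, hw.2]⟩
    have hmvt : ∀ v ∈ Icc u (u + m * h), ∃ w ∈ Icc u (u + (m + 1 : ℕ) * h),
        f m (v + h) - f m v = h * f (m + 1) w := by
      intro v hv
      have hd : ∀ w ∈ Icc v (v + h), HasDerivAt (f m) (f (m + 1) w) w := fun w hw =>
        hf m (by omega) w (hmem v hv w hw)
      obtain ⟨w, hw, he⟩ := exists_hasDerivAt_eq_slope (f m) (f (m + 1)) (by linarith : v < v + h)
        (fun w hw => (hd w hw).continuousAt.continuousWithinAt)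
        (fun w hw => hd w (Ioo_subset_Icc_self hw))
      refine ⟨w, hmem v hv w (Ioo_subset_Icc_self hw), ?_⟩
      rw [he, add_sub_cancel_left, mul_div_cancel₀ _ hh.ne']
    -- Induction is applied to the family of first differences; the mean value theorem identifies
    -- its last member with h times a value of f (m + 1).
    refine ih (fun j v => f j (v + h) - f j v) ?_ ?_ ?_
    · intro j hj v hv
      refine HasDerivAt.sub ?_ ?_
      · exact (hf j (by omega) _ (hmem v hv _ ⟨by linarith, le_rfl⟩)).comp_add_const v h
      · exact hf j (by omega) _ (hmem v hv _ ⟨le_rfl, by linarith⟩)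
    · intro v hv
      obtain ⟨w, hw, he⟩ := hmvt v hv
      simp only [he]
      exact mul_le_mul_of_nonneg_left (hlo w hw) hh.le
    · intro v hv
      obtain ⟨w, hw, he⟩ := hmvt v hv
      simp only [he]
      exact mul_le_mul_of_nonneg_left (hhi w hw) hh.le

theorem norm_fwdDiff_iter_le_of_deriv {h : ℝ} (hh : 0 < h) (m : ℕ) (f : ℕ → ℝ → ℂ) {u B : ℝ}
    (hf : ∀ j < m, ∀ v, HasDerivAt (f j) (f (j + 1) v) v)
    (hB : ∀ v ∈ Icc u (u + m * h), ‖f m v‖ ≤ B) :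
    ‖(fwdDiff h)^[m] (f 0) u‖ ≤ h ^ m * B := by
  induction m generalizing f B with
  | zero => simpa using hB u (by simp)
  | succ m ih =>
    rw [Function.iterate_succ_apply, pow_succ, mul_assoc]
    refine ih (fun j v => f j (v + h) - f j v) ?_ ?_
    · intro j hj v
      exact ((hf j (by omega) _).comp_add_const v h).sub (hf j (by omega) _)
    · intro v hv
      have := (convex_Icc v (v + h)).norm_image_sub_le_of_norm_hasDerivWithin_le
        (f := f m) (f' := f (m + 1)) (C := B) (x := v) (y := v + h)
        (fun w _ => (hf m (by omega) w).hasDerivWithinAt)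
        (fun w hw => hB w ⟨hv.1.trans hw.1, by push_cast; linarith [hv.2, hw.2]⟩)
        ⟨le_rfl, by linarith⟩ ⟨by linarith, le_rfl⟩
      rw [add_sub_cancel_left, Real.norm_of_nonneg hh.le] at this
      rw [mul_comm h]
      exact this

/-- The trivial bound, to be used at high frequencies, where derivatives are more expensive than the
2^m terms of the difference. -/
theorem norm_fwdDiff_iter_le {h : ℝ} (hh : 0 < h) (m : ℕ) (f : ℝ → ℂ) {u B : ℝ}
    (hB : ∀ v ∈ Icc u (u + m * h), ‖f v‖ ≤ B) : ‖(fwdDiff h)^[m] f u‖ ≤ 2 ^ m * B := by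
  induction m generalizing f B with
  | zero => simpa using hB u (by simp)
  | succ m ih =>
    rw [Function.iterate_succ_apply, pow_succ, mul_assoc]
    refine ih (fwdDiff h f) fun v hv => ?_
    rw [two_mul]
    refine (norm_sub_le _ _).trans (add_le_add (hB _ ?_) (hB _ ?_))
    · push_cast
      exact ⟨by linarith [hv.1], by linarith [hv.2]⟩
    · push_cast
      exact ⟨hv.1, by linarith [hv.2]⟩

theorem hasSum_fwdDiff_iter {ι : Type*} (h : ℝ) (m : ℕ) {F : ι → ℝ → ℂ} {Z : ℝ → ℂ}
    (hF : ∀ v, HasSum (fun i => F i v) (Z v)) (u : ℝ) :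
    HasSum (fun i => (fwdDiff h)^[m] (F i) u) ((fwdDiff h)^[m] Z u) := by
  induction m generalizing F Z with
  | zero => exact hF u
  | succ m ih =>
    simp_rw [Function.iterate_succ_apply]
    exact ih fun v => (hF (v + h)).sub (hF v)

/-- The truncated power `v_+^j / j!`. -/
def truncPow (j : ℕ) (v : ℝ) : ℝ := max v 0 ^ j / j.factorial

theorem hasDerivAt_truncPow {j : ℕ} (hj : 1 ≤ j) (v : ℝ) :
    HasDerivAt (truncPow (j + 1)) (truncPow j v) v := by
  have hpow : ∀ w : ℝ, HasDerivAt (fun v : ℝ => v ^ (j + 1) / (j + 1).factorial)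
      (w ^ j / j.factorial) w := fun w => by
    refine ((hasDerivAt_pow (j + 1) w).div_const _).congr_deriv ?_
    rw [Nat.factorial_succ]
    push_cast
    field_simp
  rcases lt_trichotomy v 0 with hv | rfl | hv
  · have : truncPow j v = 0 := by
      rw [truncPow, max_eq_right hv.le, zero_pow (by omega), zero_div]
    rw [this]
    refine (hasDerivAt_const v (0 : ℝ)).congr_of_eventuallyEq ?_
    filter_upwards [gt_mem_nhds hv] with w hw
    rw [truncPow, max_eq_right hw.le, zero_pow (by omega), zero_div]
  -- At the kink the one-sided derivatives both vanish because j ≥ 1, and they are glued.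
  · have h0 : truncPow j 0 = 0 := by
      rw [truncPow, max_self, zero_pow (by omega), zero_div]
    have h1 : HasDerivWithinAt (truncPow (j + 1)) 0 (Iic 0) 0 := by
      refine (hasDerivWithinAt_const (0 : ℝ) (Iic 0) (0 : ℝ)).congr (fun w hw => ?_) ?_
      · rw [truncPow, max_eq_right hw, zero_pow (by omega), zero_div]
      · rw [truncPow, max_self, zero_pow (by omega), zero_div]
    have h2 : HasDerivWithinAt (truncPow (j + 1)) 0 (Ici 0) 0 := by
      have := (hpow 0).hasDerivWithinAt (s := Ici 0)
      rw [zero_pow (by omega), zero_div] at this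
      refine this.congr (fun w hw => ?_) ?_
      · rw [truncPow, max_eq_left hw]
      · rw [truncPow, max_self]
    rw [h0, ← hasDerivWithinAt_univ, ← Iic_union_Ici (a := (0 : ℝ))]
    exact h1.union h2
  · have : truncPow j v = v ^ j / j.factorial := by rw [truncPow, max_eq_left hv.le]
    rw [this]
    refine (hpow v).congr_of_eventuallyEq ?_
    filter_upwards [lt_mem_nhds hv] with w hw
    rw [truncPow, max_eq_left hw.le]

/-- This converts smooth weights back into sharp cutoffs. Formally the m-th derivative of v_+^m / m!
is the indicator of v ≥ 0, and the difference averages it over [u, u + mh]. -/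
theorem fwdDiff_iter_truncPow_mem {h : ℝ} (hh : 0 < h) {m : ℕ} (hm : 1 ≤ m) (u : ℝ) :
    (fwdDiff h)^[m] (truncPow m) u ∈
      Icc (h ^ m * if 0 ≤ u then 1 else 0) (h ^ m * if 0 ≤ u + m * h then 1 else 0) := by
  obtain ⟨m, rfl⟩ : ∃ k, m = k + 1 := ⟨m - 1, by omega⟩
  rw [Function.iterate_succ_apply, pow_succ, mul_assoc, mul_assoc]
  have hone : ∀ v, truncPow 1 v = max v 0 := fun v => by simp [truncPow]
  -- Since v_+ is not differentiable at 0, only all but one of the differences go through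
  -- derivatives; the remaining one, v ↦ (v+h)_+ - v_+, is bounded directly between 0 and h.
  have h0 := fwdDiff_iter_mem_Icc hh m
    (fun j v => truncPow (m + 1 - j) (v + h) - truncPow (m + 1 - j) v) (u := u)
    (lo := h * if 0 ≤ u then 1 else 0) (hi := h * if 0 ≤ u + (m + 1 : ℕ) * h then 1 else 0)
    ?_ ?_ ?_
  · exact h0
  · intro j hj v hv
    obtain ⟨k, hk⟩ : ∃ k, m - j = k + 1 := ⟨m - j - 1, by omega⟩
    have e1 : m + 1 - j = k + 1 + 1 := by omega
    have e2 : m + 1 - (j + 1) = k + 1 := by omega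
    simp only [e1, e2]
    exact ((hasDerivAt_truncPow (by omega) _).comp_add_const v h).sub
      (hasDerivAt_truncPow (by omega) _)
  · intro v hv
    simp only [Nat.add_sub_cancel_left, hone]
    split_ifs with hu
    · rw [max_eq_left (by linarith [hv.1]), max_eq_left (by linarith [hv.1])]
      linarith
    · have := max_le_max_right 0 (by linarith : v ≤ v + h)
      linarith
  · intro v hv
    simp only [Nat.add_sub_cancel_left, hone]
    split_ifs with hu
    · have : max (v + h) 0 ≤ max v 0 + h := by
        refine max_le (by linarith [le_max_left v 0]) (by linarith [le_max_right v 0])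
      linarith
    · push_cast at hu
      have hv2 := hv.2
      rw [max_eq_right (by linarith), max_eq_right (by linarith)]
      linarith

theorem hasDerivAt_rpow_div_Gamma {p : ℝ} (hp : 0 < p) {v : ℝ} (hv : 0 < v) :
    HasDerivAt (fun v : ℝ => v ^ p / Real.Gamma (p + 1)) (v ^ (p - 1) / Real.Gamma p) v := by
  refine ((Real.hasDerivAt_rpow_const (Or.inl hv.ne')).div_const _).congr_deriv ?_
  rw [Real.Gamma_add_one hp.ne']
  field_simp

/-- The analogue for the volume term: the m-th derivative is v^p / Γ(p + 1), monotone in v, so its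
extremes over the range are at the endpoints. -/
theorem fwdDiff_iter_rpow_mem {h : ℝ} (hh : 0 < h) (m : ℕ) {p : ℝ} (hp : 0 < p) {u : ℝ}
    (hu : 0 < u) :
    (fwdDiff h)^[m] (fun v : ℝ => v ^ (p + m) / Real.Gamma (p + m + 1)) u ∈
      Icc (h ^ m * (u ^ p / Real.Gamma (p + 1)))
        (h ^ m * ((u + m * h) ^ p / Real.Gamma (p + 1))) := by
  have hG : 0 < Real.Gamma (p + 1) := Real.Gamma_pos_of_pos (by linarith)
  have h0 := fwdDiff_iter_mem_Icc hh m
    (fun j v => v ^ (p + m - j) / Real.Gamma (p + m - j + 1)) (u := u)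
    (lo := u ^ p / Real.Gamma (p + 1)) (hi := (u + m * h) ^ p / Real.Gamma (p + 1)) ?_ ?_ ?_
  · simpa using h0
  · intro j hj v hv
    have hj' : (j : ℝ) < m := by exact_mod_cast hj
    have := hasDerivAt_rpow_div_Gamma (p := p + m - j) (by linarith) (v := v)
      (hu.trans_le hv.1)
    refine this.congr_deriv ?_
    push_cast
    congr 2 <;> ring
  · intro v hv
    simp only [add_sub_cancel_right]
    gcongr
    exact hv.1
  · intro v hv
    simp only [add_sub_cancel_right]
    have := hu.trans_le hv.1
    gcongr
    exact hv.2

/-! ### Summation over dual frequencies -/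

/-- The shell has (2k+3)^d - (2k+1)^d points, at most 2d(2k+3)^{d-1}, and 2k + 3 ≤ 3(k+1). -/
theorem card_box_sdiff_le (d k : ℕ) :
    (((Fintype.piFinset fun _ : Fin d => Finset.Icc (-((k + 1 : ℕ) : ℤ)) (k + 1 : ℕ)) \
      Fintype.piFinset fun _ : Fin d => Finset.Icc (-(k : ℤ)) k).card : ℝ) ≤
      2 * d * 3 ^ (d - 1) * ((k + 1 : ℕ) : ℝ) ^ (d - 1) := by
  have hsub : (Fintype.piFinset fun _ : Fin d => Finset.Icc (-(k : ℤ)) k) ⊆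
      Fintype.piFinset fun _ : Fin d => Finset.Icc (-((k + 1 : ℕ) : ℤ)) (k + 1 : ℕ) := by
    refine Fintype.piFinset_subset _ _ fun i => ?_
    exact Finset.Icc_subset_Icc (by push_cast; linarith) (by push_cast; linarith)
  have h1 : ((Fintype.piFinset fun _ : Fin d => Finset.Icc (-((k + 1 : ℕ) : ℤ)) (k + 1 : ℕ)) \
      Fintype.piFinset fun _ : Fin d => Finset.Icc (-(k : ℤ)) k).card ≤
      2 * d * (2 * k + 3) ^ (d - 1) := by
    rw [Finset.card_sdiff_of_subset hsub]
    have e1 : (((k + 1 : ℕ) : ℤ) + 1 - -((k + 1 : ℕ) : ℤ)).toNat = 2 * k + 3 := by omega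
    have e2 : ((k : ℤ) + 1 - -(k : ℤ)).toNat = 2 * k + 1 := by omega
    simp only [Fintype.card_piFinset, Int.card_Icc, Finset.prod_const, Finset.card_univ,
      Fintype.card_fin, e1, e2]
    have h := (le_abs_self _).trans (abs_pow_sub_pow_le (α := ℤ) (2 * k + 3) (2 * k + 1) d)
    rw [abs_of_nonneg (by positivity : (0 : ℤ) ≤ 2 * k + 3),
      abs_of_nonneg (by positivity : (0 : ℤ) ≤ 2 * k + 1), max_eq_left (by omega),
      show (2 * (k : ℤ) + 3) - (2 * k + 1) = 2 by ring, abs_two] at h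
    rw [tsub_le_iff_right]
    zify
    linarith
  have h2 : 2 * d * (2 * k + 3) ^ (d - 1) ≤ 2 * d * 3 ^ (d - 1) * (k + 1) ^ (d - 1) := by
    rw [mul_assoc (2 * d), ← mul_pow]
    gcongr
    omega
  exact_mod_cast h1.trans h2

/-- A radially decreasing sum over the nonzero lattice points, compared with a sum over `ℕ`. -/
theorem sum_lattice_le {d : ℕ} {F : ℝ → ℝ} (hF0 : ∀ r, 0 < r → 0 ≤ F r)
    (hF : ∀ r r', 0 < r → r ≤ r' → F r' ≤ F r) {B : ℝ}
    (hB : ∀ N : ℕ, ∑ k ∈ Finset.range N, ((k + 1 : ℕ) : ℝ) ^ (d - 1) *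
      F (((k + 1 : ℕ) : ℝ) ^ 2) ≤ B)
    (t : Finset (Fin d → ℤ)) (ht : ∀ ξ ∈ t, ξ ≠ 0) :
    ∑ ξ ∈ t, F (sqSum ξ) ≤ 2 * d * 3 ^ (d - 1) * B := by
  classical
  let s (n : ℕ) : Finset (Fin d → ℤ) := Fintype.piFinset fun _ : Fin d => Finset.Icc (-(n : ℤ)) n
  have hs : Monotone s := fun a b hab => Fintype.piFinset_subset _ _ fun i =>
    Finset.Icc_subset_Icc (by simpa using hab) (by simpa using hab)
  have hs0 : s 0 = {0} := by ext; simp [s, funext_iff]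
  obtain ⟨N, hN⟩ : ∃ N, t ⊆ s N := by
    refine ⟨t.sup fun ξ => ∑ i, (ξ i).natAbs, fun ξ hξ => ?_⟩
    refine Fintype.mem_piFinset.2 fun i => ?_
    have h1 : (ξ i).natAbs ≤ t.sup fun ξ => ∑ i, (ξ i).natAbs :=
      (Finset.single_le_sum (f := fun i => (ξ i).natAbs) (fun _ _ => Nat.zero_le _)
        (Finset.mem_univ i)).trans (Finset.le_sup (f := fun ξ : Fin d → ℤ => ∑ i, (ξ i).natAbs) hξ)
    rw [Finset.mem_Icc]
    omega
  have hpos : ∀ k : ℕ, ∀ ξ ∈ s (k + 1) \ s k, ((k + 1 : ℕ) : ℝ) ^ 2 ≤ sqSum ξ := by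
    intro k ξ hξ
    obtain ⟨i, hi⟩ : ∃ i, ξ i ∉ Finset.Icc (-(k : ℤ)) k := by
      simpa [s] using (Finset.mem_sdiff.1 hξ).2
    have h1 : ((k + 1 : ℕ) : ℤ) ≤ |ξ i| := by
      by_contra! H
      push_cast at H
      rw [Int.lt_add_one_iff, abs_le, ← Finset.mem_Icc] at H
      exact hi H
    have h2 : ((k + 1 : ℕ) : ℝ) ≤ |(ξ i : ℝ)| := by exact_mod_cast h1
    calc ((k + 1 : ℕ) : ℝ) ^ 2 ≤ |(ξ i : ℝ)| ^ 2 := by gcongr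
      _ = (ξ i : ℝ) ^ 2 := sq_abs _
      _ ≤ _ := Finset.single_le_sum (f := fun i => (ξ i : ℝ) ^ 2) (fun i _ => sq_nonneg _)
        (Finset.mem_univ i)
  -- Nothing is assumed of F at 0, so the origin is given weight zero before the sum is enlarged to
  -- a full box.
  let G : (Fin d → ℤ) → ℝ := fun ξ => if ξ = 0 then 0 else F (sqSum ξ)
  have hG0 : ∀ ξ, 0 ≤ G ξ := fun ξ => by
    by_cases h : ξ = 0
    · simp [G, h]
    · simp only [G, h, if_false]
      exact hF0 _ (lt_of_lt_of_le one_pos (one_le_sqSum h))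
  calc ∑ ξ ∈ t, F (sqSum ξ) = ∑ ξ ∈ t, G ξ :=
        Finset.sum_congr rfl fun ξ hξ => by simp [G, ht ξ hξ]
    _ ≤ ∑ ξ ∈ s N, G ξ := Finset.sum_le_sum_of_subset_of_nonneg hN fun ξ _ _ => hG0 ξ
    _ = ∑ k ∈ Finset.range N, ∑ ξ ∈ s (k + 1) \ s k, G ξ := by
        rw [Finset.sum_eq_sum_range_sdiff _ @hs, hs0]
        simp [G]
    _ ≤ ∑ k ∈ Finset.range N, ∑ ξ ∈ s (k + 1) \ s k, F (((k + 1 : ℕ) : ℝ) ^ 2) := by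
        refine Finset.sum_le_sum fun k _ => Finset.sum_le_sum fun ξ hξ => ?_
        have h1 := hpos k ξ hξ
        have h2 : 0 < ((k + 1 : ℕ) : ℝ) ^ 2 := by positivity
        by_cases h : ξ = 0
        · simp only [G, h, if_true]
          exact hF0 _ h2
        · simp only [G, h, if_false]
          exact hF _ _ h2 h1
    _ ≤ ∑ k ∈ Finset.range N, 2 * d * 3 ^ (d - 1) * (((k + 1 : ℕ) : ℝ) ^ (d - 1) *
          F (((k + 1 : ℕ) : ℝ) ^ 2)) := by
        refine Finset.sum_le_sum fun k _ => ?_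
        rw [Finset.sum_const, nsmul_eq_mul, ← mul_assoc]
        exact mul_le_mul_of_nonneg_right (card_box_sdiff_le d k) (hF0 _ (by positivity))
    _ ≤ _ := by
        rw [← Finset.mul_sum]
        exact mul_le_mul_of_nonneg_left (hB N) (by positivity)

/-- Bernoulli's inequality for p ≤ 1, and (1 - 1/r)^p ≤ 1 - 1/r for p ≥ 1. Its use is to telescope
the sum of k^{p-1} without integrals. -/
theorem rpow_sub_one_le_sub {p : ℝ} (hp : 0 < p) {r : ℝ} (hr : 1 ≤ r) :
    min p 1 * r ^ (p - 1) ≤ r ^ p - (r - 1) ^ p := by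
  have hr0 : 0 < r := by linarith
  have h1 : (r - 1) ^ p = r ^ p * (1 - 1 / r) ^ p := by
    rw [← Real.mul_rpow hr0.le (by rw [sub_nonneg, div_le_one hr0]; exact hr)]
    congr 1
    field_simp
  have h2 : r ^ (p - 1) = r ^ p * (1 / r) := by
    rw [Real.rpow_sub_one hr0.ne']; ring
  have h3 : (1 - 1 / r) ^ p ≤ 1 - min p 1 * (1 / r) := by
    have hx : 0 ≤ 1 - 1 / r := by rw [sub_nonneg, div_le_one hr0]; exact hr
    have hx1 : 1 - 1 / r ≤ 1 := by
      have : 0 < 1 / r := by positivity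
      linarith
    rcases le_total p 1 with hp1 | hp1
    · rw [min_eq_left hp1]
      have := rpow_one_add_le_one_add_mul_self (s := -(1 / r)) (by linarith) hp.le hp1
      calc (1 - 1 / r) ^ p = (1 + -(1 / r)) ^ p := by rw [sub_eq_add_neg]
        _ ≤ _ := this
        _ = _ := by ring
    · rw [min_eq_right hp1, one_mul]
      calc (1 - 1 / r) ^ p ≤ (1 - 1 / r) ^ (1 : ℝ) :=
            Real.rpow_le_rpow_of_exponent_ge' hx hx1 (by norm_num) hp1
        _ = _ := Real.rpow_one _
  rw [h1, h2]
  have : 0 < r ^ p := by positivity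
  nlinarith

theorem sum_rpow_sub_one_le {p : ℝ} (hp : 0 < p) (N : ℕ) :
    ∑ k ∈ Finset.range N, ((k + 1 : ℕ) : ℝ) ^ (p - 1) ≤ (min p 1)⁻¹ * (N : ℝ) ^ p := by
  have hm : 0 < min p 1 := by positivity
  rw [← div_eq_inv_mul, le_div_iff₀ hm, Finset.sum_mul]
  calc _ ≤ ∑ k ∈ Finset.range N, (((k + 1 : ℕ) : ℝ) ^ p - (k : ℝ) ^ p) := by
        refine Finset.sum_le_sum fun k _ => ?_
        have := rpow_sub_one_le_sub hp (r := ((k + 1 : ℕ) : ℝ)) (by simp)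
        rw [mul_comm]
        refine this.trans (le_of_eq ?_)
        push_cast
        simp
    _ = _ := by
        rw [Finset.sum_range_sub (fun k : ℕ => (k : ℝ) ^ p)]
        simp [Real.zero_rpow hp.ne']

/-- The sum splits at X. Below, the first entry sums to O(X^p); above, m ≥ p + 1 bounds the second
entry by X^{p+1} k^{-2}, whose tail is O(X^p). -/
theorem sum_min_rpow_le {p : ℝ} (hp : 0 < p) {m : ℕ} (hm : p + 1 ≤ m) {X : ℝ} (hX : 1 ≤ X)
    (N : ℕ) : ∑ k ∈ Finset.range N, min (((k + 1 : ℕ) : ℝ) ^ (p - 1))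
      (X ^ m * ((k + 1 : ℕ) : ℝ) ^ (p - 1 - m)) ≤ ((min p 1)⁻¹ + 2) * X ^ p := by
  have hX0 : 0 < X := by linarith
  set K := ⌊X⌋₊
  have hK1 : 1 ≤ K := (Nat.one_le_floor_iff X).2 hX
  have hKX : (K : ℝ) ≤ X := Nat.floor_le hX0.le
  have hXK : X < K + 1 := Nat.lt_floor_add_one X
  have hnn : ∀ k : ℕ, 0 ≤ min (((k + 1 : ℕ) : ℝ) ^ (p - 1))
      (X ^ m * ((k + 1 : ℕ) : ℝ) ^ (p - 1 - m)) := fun k => by positivity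
  have h1 : ∑ k ∈ Finset.range K, min (((k + 1 : ℕ) : ℝ) ^ (p - 1))
      (X ^ m * ((k + 1 : ℕ) : ℝ) ^ (p - 1 - m)) ≤ (min p 1)⁻¹ * X ^ p := by
    refine (Finset.sum_le_sum fun k _ => min_le_left _ _).trans
      ((sum_rpow_sub_one_le hp K).trans ?_)
    have : 0 < min p 1 := by positivity
    gcongr
  have h2 : ∑ k ∈ Finset.Ico K (K + N), min (((k + 1 : ℕ) : ℝ) ^ (p - 1))
      (X ^ m * ((k + 1 : ℕ) : ℝ) ^ (p - 1 - m)) ≤ 2 * X ^ p := by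
    have hterm : ∀ k ∈ Finset.Ico K (K + N), min (((k + 1 : ℕ) : ℝ) ^ (p - 1))
        (X ^ m * ((k + 1 : ℕ) : ℝ) ^ (p - 1 - m)) ≤
        X ^ (p + 1) * (((k + 1 : ℕ) : ℝ) ^ 2)⁻¹ := by
      intro k hk
      have hk1 : X ≤ ((k + 1 : ℕ) : ℝ) := by
        have : (K : ℝ) ≤ k := by exact_mod_cast (Finset.mem_Ico.1 hk).1
        push_cast
        linarith
      have hk0 : 0 < ((k + 1 : ℕ) : ℝ) := by positivity
      refine (min_le_right _ _).trans ?_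
      have e1 : ((k + 1 : ℕ) : ℝ) ^ (p - 1 - m) =
          ((k + 1 : ℕ) : ℝ) ^ (p + 1 - m) * (((k + 1 : ℕ) : ℝ) ^ 2)⁻¹ := by
        rw [← Real.rpow_natCast _ 2, ← Real.rpow_neg hk0.le, ← Real.rpow_add hk0]
        congr 1
        push_cast
        ring
      have e2 : X ^ (p + 1) = X ^ m * X ^ (p + 1 - m) := by
        rw [← Real.rpow_natCast X m, ← Real.rpow_add hX0]
        congr 1
        ring
      rw [e1, e2, ← mul_assoc]
      have : ((k + 1 : ℕ) : ℝ) ^ (p + 1 - m) ≤ X ^ (p + 1 - m) :=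
        Real.rpow_le_rpow_of_nonpos hX0 hk1 (by linarith)
      gcongr
    refine (Finset.sum_le_sum hterm).trans ?_
    rw [← Finset.mul_sum, Finset.sum_Ico_add' (fun k : ℕ => ((k : ℝ) ^ 2)⁻¹) K (K + N) 1]
    have h3 : ∑ k ∈ Finset.Ico (K + 1) (K + N + 1), ((k : ℝ) ^ 2)⁻¹ ≤ 2 / (K + 1 : ℝ) := by
      have := sum_Ioo_inv_sq_le (α := ℝ) K (K + N + 1)
      refine le_trans (le_of_eq (Finset.sum_congr ?_ fun _ _ => rfl)) this
      ext k
      simp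
    calc X ^ (p + 1) * _ ≤ X ^ (p + 1) * (2 / X) := by
          gcongr
          refine h3.trans ?_
          gcongr
      _ = _ := by rw [Real.rpow_add_one hX0.ne']; field_simp
  calc _ ≤ ∑ k ∈ Finset.range (K + N), min (((k + 1 : ℕ) : ℝ) ^ (p - 1))
          (X ^ m * ((k + 1 : ℕ) : ℝ) ^ (p - 1 - m)) :=
        Finset.sum_le_sum_of_subset_of_nonneg
          (Finset.range_mono (by omega)) fun k _ _ => hnn k
    _ = _ := (Finset.sum_range_add_sum_Ico _ (by omega : K ≤ K + N)).symm
    _ ≤ _ := by rw [add_mul]; exact add_le_add h1 h2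

/-- Shell counting weighs radius k by k^{d-1}, and k^{d-1} k^{-(d+1)/2} = k^{p-1} with p = (d-1)/2.
Positivity of p is where d ≥ 2 is needed. -/
theorem sum_lattice_min_le {d : ℕ} (hd : 2 ≤ d) {m : ℕ} (hm : d ≤ m) : ∃ C : ℝ, 0 < C ∧
    ∀ X : ℝ, 1 ≤ X → ∀ t : Finset (Fin d → ℤ), (∀ ξ ∈ t, ξ ≠ 0) →
      ∑ ξ ∈ t, min (sqSum ξ ^ (-((d + 1) / 4 : ℝ)))
        (X ^ m * sqSum ξ ^ (-(m / 2 + (d + 1) / 4 : ℝ))) ≤ C * X ^ ((d - 1) / 2 : ℝ) := by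
  have hd' : (2 : ℝ) ≤ d := by exact_mod_cast hd
  have hm' : (d : ℝ) ≤ m := by exact_mod_cast hm
  have hp : (0 : ℝ) < (d - 1) / 2 := by linarith
  refine ⟨2 * d * 3 ^ (d - 1) * ((min ((d - 1) / 2 : ℝ) 1)⁻¹ + 2), by positivity,
    fun X hX t ht => ?_⟩
  have hX0 : 0 < X := by linarith
  have key := sum_lattice_le (d := d)
    (F := fun q => min (q ^ (-((d + 1) / 4 : ℝ))) (X ^ m * q ^ (-(m / 2 + (d + 1) / 4 : ℝ))))
    (fun r hr => by positivity) ?_ (B := ((min ((d - 1) / 2 : ℝ) 1)⁻¹ + 2) * X ^ ((d - 1) / 2 : ℝ))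
    ?_ t ht
  · rw [mul_assoc _ _ (X ^ _)]
    exact key
  · intro r r' hr hrr
    refine min_le_min ?_ (mul_le_mul_of_nonneg_left ?_ (by positivity))
    · exact Real.rpow_le_rpow_of_nonpos hr hrr (by linarith)
    · exact Real.rpow_le_rpow_of_nonpos hr hrr (by
        have : (0 : ℝ) ≤ m := by positivity
        linarith)
  · intro N
    refine (le_of_eq (Finset.sum_congr rfl fun k _ => ?_)).trans
      (sum_min_rpow_le hp (m := m) (by linarith) hX N)
    have hk0 : 0 < ((k + 1 : ℕ) : ℝ) := by positivity
    have hpow : ∀ e : ℝ, ((k + 1 : ℕ) : ℝ) ^ (d - 1) * (((k + 1 : ℕ) : ℝ) ^ 2) ^ e =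
        ((k + 1 : ℕ) : ℝ) ^ (d - 1 + 2 * e) := fun e => by
      rw [← Real.rpow_natCast _ (d - 1), ← Real.rpow_natCast _ 2, ← Real.rpow_mul hk0.le,
        ← Real.rpow_add hk0, Nat.cast_sub (by omega)]
      push_cast
      rfl
    rw [mul_min_of_nonneg _ _ (by positivity), mul_left_comm, hpow, hpow]
    congr 2 <;> ring_nf

/-! ### Differencing the Riesz means -/

theorem norm_latticePoint_sq {d : ℕ} (x : Fin d → ℤ) : ‖latticePoint x‖ ^ 2 = sqSum x := by
  rw [EuclideanSpace.norm_sq_eq]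
  simp [latticePoint, sqSum]

theorem finite_setOf_sqSum_le (d : ℕ) (u : ℝ) : {x : Fin d → ℤ | sqSum x ≤ u}.Finite := by
  refine (finite_setOf_norm_latticePoint_lt d (√u + 1)).subset fun x hx => ?_
  have h1 : ‖latticePoint x‖ ≤ √u := by
    rw [← Real.sqrt_sq (norm_nonneg (latticePoint x)), norm_latticePoint_sq]
    exact Real.sqrt_le_sqrt hx
  exact h1.trans_lt (by linarith)

/-- The integer vectors in the closed ball of squared radius `u`. -/
def sqBall (d : ℕ) (u : ℝ) : Finset (Fin d → ℤ) := (finite_setOf_sqSum_le d u).toFinset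

@[simp] theorem mem_sqBall {d : ℕ} {u : ℝ} {x : Fin d → ℤ} : x ∈ sqBall d u ↔ sqSum x ≤ u := by
  simp [sqBall]

theorem sqBall_mono {d : ℕ} {u v : ℝ} (h : u ≤ v) : sqBall d u ⊆ sqBall d v := fun x hx => by
  rw [mem_sqBall] at hx ⊢
  exact hx.trans h

/-- The sum of an even monomial over the integer points of a ball. -/
def evenSum {d : ℕ} (b : Fin d → ℕ) (u : ℝ) : ℝ := ∑ x ∈ sqBall d u, evenMonomial b x

theorem evenSum_nonneg {d : ℕ} (b : Fin d → ℕ) (u : ℝ) : 0 ≤ evenSum b u :=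
  Finset.sum_nonneg fun x _ => evenMonomial_nonneg b x

/-- The abscissa 1/u suits every v in [u, 2u]. The exponents of u and |ξ|² depend on |J| through
(|b|+|J|)/2 and (|J|-|b|)/2; since |J| ≤ |b| and u, |ξ|² ≥ 1, the case |J| = |b| is the worst. -/
theorem exists_norm_dualTerm_le {d : ℕ} {b J : Fin d → ℕ} (hJ : J ∈ subIndices b) (m : ℕ)
    (hd : 1 ≤ d) : ∃ C : ℝ, 0 < C ∧
    ∀ u v : ℝ, 1 ≤ u → u ≤ v → v ≤ 2 * u → ∀ ξ : Fin d → ℤ, ξ ≠ 0 →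
      evenMonomial J ξ *
        ‖besselIntegral (1 / u) (m + 1 + dualExponent b J) (Real.pi ^ 2 * sqSum ξ) v‖ ≤
      C * (u ^ (m / 2 + d / 4 + (∑ i, (b i : ℝ)) - 1 / 4) *
        sqSum ξ ^ (-(m / 2 + (d + 1) / 4 : ℝ))) := by
  have hd' : (1 : ℝ) ≤ d := by exact_mod_cast hd
  set B := ∑ i, (b i : ℝ) with hB
  set j := ∑ i, (J i : ℝ) with hj
  have hjB : j ≤ B := by
    have := sum_le_of_mem_subIndices hJ
    rw [hj, hB]
    exact_mod_cast this
  have hj0 : 0 ≤ j := Finset.sum_nonneg fun i _ => by positivity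
  have hB0 : 0 ≤ B := Finset.sum_nonneg fun i _ => by positivity
  set e := dualExponent b J with he
  have hee : e = d / 2 + B + j := rfl
  have hm0 : (0 : ℝ) ≤ m := by positivity
  obtain ⟨C, hC, h⟩ := exists_norm_besselIntegral_le (m + 1 + e) (by linarith)
  refine ⟨C * 2 ^ ((m + e) / 2), by positivity, fun u v hu huv hvu ξ hξ => ?_⟩
  set q := sqSum ξ with hq
  have hq1 : 1 ≤ q := one_le_sqSum hξ
  have hpi : 4 ≤ Real.pi ^ 2 := by nlinarith [Real.pi_gt_three]
  have hu0 : 0 < u := by linarith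
  have hv0 : 0 < v := by linarith
  have hq0 : 0 < q := by linarith
  have hqn : q ≤ Real.pi ^ 2 * q := by nlinarith
  have h1 := h (1 / u) (Real.pi ^ 2 * q) v hv0 (by positivity)
    (by rw [mul_one_div, le_div_iff₀ hu0]; linarith)
    (by rw [mul_one_div, div_le_iff₀ hu0]; linarith) (by nlinarith)
  have e1 : ((m : ℝ) + 1 + e - 1) / 2 = (m + e) / 2 := by ring
  rw [e1] at h1
  have h2 : (v / (Real.pi ^ 2 * q)) ^ ((m + e) / 2) ≤
      2 ^ ((m + e) / 2) * (u ^ ((m + e) / 2) * q ^ (-((m + e) / 2))) := by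
    rw [Real.rpow_neg hq0.le, ← div_eq_mul_inv, ← Real.div_rpow hu0.le hq0.le,
      ← Real.mul_rpow (by norm_num) (by positivity), ← mul_div_assoc]
    exact Real.rpow_le_rpow (by positivity) (by gcongr) (by linarith)
  have h3 : (v * (Real.pi ^ 2 * q)) ^ (-(1 / 4) : ℝ) ≤ u ^ (-(1 / 4) : ℝ) * q ^ (-(1 / 4) : ℝ) := by
    rw [← Real.mul_rpow hu0.le hq0.le]
    exact Real.rpow_le_rpow_of_nonpos (by positivity) (by gcongr) (by norm_num)
  have h4 : evenMonomial J ξ ≤ q ^ j := by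
    have := evenMonomial_le J ξ
    rw [hj, ← Nat.cast_sum, Real.rpow_natCast]
    exact this
  have h5 : u ^ ((m + e) / 2) * u ^ (-(1 / 4) : ℝ) ≤ u ^ (m / 2 + d / 4 + B - 1 / 4) := by
    rw [← Real.rpow_add hu0]
    exact Real.rpow_le_rpow_of_exponent_le hu (by rw [hee]; linarith)
  have h6 : q ^ j * (q ^ (-((m + e) / 2)) * q ^ (-(1 / 4) : ℝ)) ≤
      q ^ (-(m / 2 + (d + 1) / 4 : ℝ)) := by
    rw [← Real.rpow_add hq0, ← Real.rpow_add hq0]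
    exact Real.rpow_le_rpow_of_exponent_le hq1 (by rw [hee]; linarith)
  calc _ ≤ q ^ j * (C * (2 ^ ((m + e) / 2) * (u ^ ((m + e) / 2) * q ^ (-((m + e) / 2)))) *
        (u ^ (-(1 / 4) : ℝ) * q ^ (-(1 / 4) : ℝ))) := by
        refine mul_le_mul h4 (h1.trans ?_) (norm_nonneg _) (by positivity)
        gcongr
    _ = C * 2 ^ ((m + e) / 2) * ((u ^ ((m + e) / 2) * u ^ (-(1 / 4) : ℝ)) *
        (q ^ j * (q ^ (-((m + e) / 2)) * q ^ (-(1 / 4) : ℝ)))) := by ring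
    _ ≤ _ := by gcongr

theorem fwdDiff_iter_ofReal (h : ℝ) (m : ℕ) (f : ℝ → ℝ) (u : ℝ) :
    (fwdDiff h)^[m] (fun v => (f v : ℂ)) u = (((fwdDiff h)^[m] f u : ℝ) : ℂ) := by
  rw [fwdDiff_iter_eq_sum_shift, fwdDiff_iter_eq_sum_shift]
  push_cast
  refine Finset.sum_congr rfl fun k _ => ?_
  simp

theorem fwdDiff_iter_const_mul_comp_sub (h : ℝ) (m : ℕ) (f : ℝ → ℝ) (K a u : ℝ) :
    (fwdDiff h)^[m] (fun v => K * f (v - a)) u = K * (fwdDiff h)^[m] f (u - a) := by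
  rw [fwdDiff_iter_eq_sum_shift, fwdDiff_iter_eq_sum_shift, Finset.mul_sum]
  refine Finset.sum_congr rfl fun k _ => ?_
  rw [add_sub_right_comm]
  simp
  ring

theorem fwdDiff_iter_congr {h : ℝ} (hh : 0 ≤ h) (m : ℕ) {f g : ℝ → ℝ} {u : ℝ}
    (hfg : ∀ v, u ≤ v → f v = g v) : (fwdDiff h)^[m] f u = (fwdDiff h)^[m] g u := by
  rw [fwdDiff_iter_eq_sum_shift, fwdDiff_iter_eq_sum_shift]
  refine Finset.sum_congr rfl fun k _ => ?_
  rw [hfg]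
  rw [nsmul_eq_mul]
  have : 0 ≤ (k : ℝ) * h := by positivity
  linarith

/-- The weighted sum of the `m`-th differences of truncated powers. -/
def differencedSum {d : ℕ} (b : Fin d → ℕ) (m : ℕ) (h u : ℝ) : ℝ :=
  ∑ x ∈ sqBall d (u + m * h), evenMonomial b x * (fwdDiff h)^[m] (truncPow m) (u - sqSum x)

theorem differencedSum_mem {d : ℕ} (b : Fin d → ℕ) {m : ℕ} (hm : 1 ≤ m) {h : ℝ} (hh : 0 < h)
    (u : ℝ) : differencedSum b m h u ∈ Icc (h ^ m * evenSum b u) (h ^ m * evenSum b (u + m * h)) := by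
  have hle : u ≤ u + m * h := by
    have : 0 ≤ m * h := by positivity
    linarith
  constructor
  · calc h ^ m * evenSum b u = ∑ x ∈ sqBall d u, evenMonomial b x * h ^ m := by
          rw [evenSum, mul_comm, Finset.sum_mul]
      _ ≤ ∑ x ∈ sqBall d u, evenMonomial b x * (fwdDiff h)^[m] (truncPow m) (u - sqSum x) := by
          refine Finset.sum_le_sum fun x hx => mul_le_mul_of_nonneg_left ?_
            (evenMonomial_nonneg b x)
          have := (fwdDiff_iter_truncPow_mem hh hm (u - sqSum x)).1
          rw [mem_sqBall] at hx
          rwa [if_pos (by linarith), mul_one] at this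
      _ ≤ _ := by
          refine Finset.sum_le_sum_of_subset_of_nonneg (sqBall_mono hle) fun x _ _ =>
            mul_nonneg (evenMonomial_nonneg b x) ?_
          refine le_trans ?_ (fwdDiff_iter_truncPow_mem hh hm (u - sqSum x)).1
          split_ifs <;> positivity
  · rw [evenSum, mul_comm, Finset.sum_mul]
    refine Finset.sum_le_sum fun x hx => mul_le_mul_of_nonneg_left ?_
      (evenMonomial_nonneg b x)
    refine (fwdDiff_iter_truncPow_mem hh hm (u - sqSum x)).2.trans ?_
    split_ifs
    · simp
    · simp only [mul_zero]
      positivity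

/-- The lattice side: order m + 1 with n = 0 gives 2π times the truncated power, and the differenced
terms vanish once |x|² > u + mh, so the series is a finite sum. -/
theorem fwdDiff_thetaIntegral {d : ℕ} (b : Fin d → ℕ) {m : ℕ} (hm : 1 ≤ m) {c : ℝ} (hc : 0 < c)
    {h : ℝ} (hh : 0 < h) (u : ℝ) :
    (fwdDiff h)^[m] (thetaIntegral b m c) u = ((2 * Real.pi * differencedSum b m h u : ℝ) : ℂ) := by
  have hm' : (1 : ℝ) < m + 1 := by
    have : (1 : ℝ) ≤ m := by exact_mod_cast hm
    linarith
  have h1 := hasSum_fwdDiff_iter h m (fun v => hasSum_thetaIntegral b hm hc v) u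
  have h2 : ∀ x : Fin d → ℤ, (fwdDiff h)^[m] (fun v => (evenMonomial b x : ℂ) *
      besselIntegral c (m + 1) 0 (v - sqSum x)) u =
      ((2 * Real.pi * (evenMonomial b x * (fwdDiff h)^[m] (truncPow m) (u - sqSum x)) : ℝ) : ℂ) := by
    intro x
    have h3 : (fun v => (evenMonomial b x : ℂ) * besselIntegral c (m + 1) 0 (v - sqSum x)) =
        fun v => ((2 * Real.pi * evenMonomial b x * truncPow m (v - sqSum x) : ℝ) : ℂ) := by
      funext v
      rw [besselIntegral_zero hc hm', add_sub_cancel_right, Real.rpow_natCast,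
        Real.Gamma_nat_eq_factorial, truncPow]
      push_cast
      ring
    rw [h3, fwdDiff_iter_ofReal, fwdDiff_iter_const_mul_comp_sub, mul_assoc]
  simp_rw [h2] at h1
  refine h1.unique ?_
  have h4 : ((2 * Real.pi * differencedSum b m h u : ℝ) : ℂ) = ∑ x ∈ sqBall d (u + m * h),
      ((2 * Real.pi * (evenMonomial b x * (fwdDiff h)^[m] (truncPow m) (u - sqSum x)) : ℝ) : ℂ) := by
    rw [differencedSum, Finset.mul_sum, Complex.ofReal_sum]
  rw [h4]
  refine hasSum_sum_of_ne_finset_zero fun x hx => ?_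
  rw [mem_sqBall, not_le] at hx
  have h5 := fwdDiff_iter_truncPow_mem hh hm (u - sqSum x)
  have h6 : 0 ≤ m * h := by positivity
  rw [if_neg (by linarith), if_neg (by linarith), mul_zero] at h5
  rw [le_antisymm h5.2 h5.1]
  simp

/-- The leading coefficient in the asymptotics of the sum of an even monomial over a ball. -/
def evenConst {d : ℕ} (b : Fin d → ℕ) : ℝ :=
  (∏ i, Real.Gamma (b i + 1 / 2)) / Real.Gamma (d / 2 + ∑ i, (b i : ℝ) + 1)

theorem evenConst_pos {d : ℕ} (b : Fin d → ℕ) : 0 < evenConst b := by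
  unfold evenConst
  exact div_pos (Finset.prod_pos fun i _ => Real.Gamma_pos_of_pos (by positivity))
    (Real.Gamma_pos_of_pos (by positivity))

/-- The first entry of the minimum comes from m derivatives, which lower the order to that of the
case m = 0; the second from the trivial bound 2^m sup. The condition mh ≤ u keeps all arguments in
[u, 2u]. -/
theorem exists_norm_fwdDiff_dualTerm_le {d : ℕ} (hd : 1 ≤ d) {b J : Fin d → ℕ}
    (hJ : J ∈ subIndices b) (m : ℕ) : ∃ C : ℝ, 0 < C ∧
    ∀ u h : ℝ, 1 ≤ u → 0 < h → m * h ≤ u → ∀ ξ : Fin d → ℤ, ξ ≠ 0 →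
      evenMonomial J ξ * ‖(fwdDiff h)^[m] (besselIntegral (1 / u) (m + 1 + dualExponent b J)
        (Real.pi ^ 2 * sqSum ξ)) u‖ ≤
      C * (h ^ m * u ^ (d / 4 + (∑ i, (b i : ℝ)) - 1 / 4) *
        min (sqSum ξ ^ (-((d + 1) / 4 : ℝ)))
          ((√u / h) ^ m * sqSum ξ ^ (-(m / 2 + (d + 1) / 4 : ℝ)))) := by
  obtain ⟨C₀, hC₀, h₀⟩ := exists_norm_dualTerm_le hJ 0 hd
  obtain ⟨C₁, hC₁, h₁⟩ := exists_norm_dualTerm_le hJ m hd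
  set B := ∑ i, (b i : ℝ) with hB
  set e := dualExponent b J with he
  have hd' : (1 : ℝ) ≤ d := by exact_mod_cast hd
  have he0 : 0 < e := by
    rw [he, dualExponent]
    positivity
  refine ⟨max C₀ (2 ^ m * C₁), by positivity, fun u h hu hh hmh ξ hξ => ?_⟩
  have hu0 : 0 < u := by linarith
  have hq1 := one_le_sqSum hξ
  set q := sqSum ξ with hq
  have hq0 : 0 < q := by linarith
  have hn : 0 ≤ Real.pi ^ 2 * q := by positivity
  have hc : 0 < 1 / u := by positivity
  have hw : 0 ≤ evenMonomial J ξ := evenMonomial_nonneg J ξ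
  have hwn : ‖(evenMonomial J ξ : ℂ)‖ = evenMonomial J ξ := by
    rw [Complex.norm_real, Real.norm_of_nonneg hw]
  have hsmul : evenMonomial J ξ * ‖(fwdDiff h)^[m] (besselIntegral (1 / u) (m + 1 + e)
        (Real.pi ^ 2 * q)) u‖ = ‖(fwdDiff h)^[m] (fun v => (evenMonomial J ξ : ℂ) *
          besselIntegral (1 / u) (m + 1 + e) (Real.pi ^ 2 * q) v) u‖ := by
    have := congrFun (fwdDiff_iter_const_smul (h := h) (evenMonomial J ξ : ℂ)
      (besselIntegral (1 / u) (m + 1 + e) (Real.pi ^ 2 * q)) m) u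
    rw [Pi.smul_apply, smul_eq_mul] at this
    change _ = ‖(fwdDiff h)^[m] ((evenMonomial J ξ : ℂ) •
      besselIntegral (1 / u) (m + 1 + e) (Real.pi ^ 2 * q)) u‖
    rw [this, norm_mul, hwn]
  rw [hsmul]
  have b0 : ‖(fwdDiff h)^[m] (fun v => (evenMonomial J ξ : ℂ) *
      besselIntegral (1 / u) (m + 1 + e) (Real.pi ^ 2 * q) v) u‖ ≤
      h ^ m * (C₀ * (u ^ (d / 4 + B - 1 / 4) * q ^ (-((d + 1) / 4 : ℝ)))) := by
    have key := norm_fwdDiff_iter_le_of_deriv hh m (fun j v => (evenMonomial J ξ : ℂ) *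
      besselIntegral (1 / u) (m + 1 + e - j) (Real.pi ^ 2 * q) v) (u := u)
      (B := C₀ * (u ^ (d / 4 + B - 1 / 4) * q ^ (-((d + 1) / 4 : ℝ)))) ?_ ?_
    · simpa using key
    · intro j hj v
      have hj' : (j : ℝ) + 1 ≤ m := by exact_mod_cast hj
      have := (hasDerivAt_besselIntegral hc (a := m + 1 + e - j) (by linarith) hn v).const_mul
        (evenMonomial J ξ : ℂ)
      refine this.congr_deriv ?_
      push_cast
      congr 2
      ring
    · intro v hv
      have := h₀ u v hu hv.1 (by linarith [hv.2]) ξ hξ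
      rw [norm_mul, hwn, show (m : ℝ) + 1 + e - m = (0 : ℕ) + 1 + e by push_cast; ring]
      refine this.trans (le_of_eq ?_)
      rw [Nat.cast_zero, zero_div, zero_add, zero_add]
  have b1 : ‖(fwdDiff h)^[m] (fun v => (evenMonomial J ξ : ℂ) *
      besselIntegral (1 / u) (m + 1 + e) (Real.pi ^ 2 * q) v) u‖ ≤
      2 ^ m * (C₁ * (u ^ (m / 2 + d / 4 + B - 1 / 4) * q ^ (-(m / 2 + (d + 1) / 4 : ℝ)))) := by
    refine norm_fwdDiff_iter_le hh m _ fun v hv => ?_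
    rw [norm_mul, hwn]
    exact h₁ u v hu hv.1 (by linarith [hv.2]) ξ hξ
  have e1 : u ^ (m / 2 + d / 4 + B - 1 / 4 : ℝ) =
      h ^ m * u ^ (d / 4 + B - 1 / 4) * (√u / h) ^ m := by
    rw [div_pow, Real.sqrt_eq_rpow, ← Real.rpow_natCast (u ^ (1 / 2 : ℝ)), ← Real.rpow_mul hu0.le,
      show (m / 2 + d / 4 + B - 1 / 4 : ℝ) = (d / 4 + B - 1 / 4) + 1 / 2 * m by ring,
      Real.rpow_add hu0]
    field_simp
  rw [e1] at b1
  rcases le_total (q ^ (-((d + 1) / 4 : ℝ))) ((√u / h) ^ m * q ^ (-(m / 2 + (d + 1) / 4 : ℝ)))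
    with hmin | hmin
  · rw [min_eq_left hmin]
    calc _ ≤ _ := b0
      _ = C₀ * (h ^ m * u ^ (d / 4 + B - 1 / 4) * q ^ (-((d + 1) / 4 : ℝ))) := by ring
      _ ≤ _ := by gcongr; exact le_max_left _ _
  · rw [min_eq_right hmin]
    calc _ ≤ _ := b1
      _ = (2 ^ m * C₁) * (h ^ m * u ^ (d / 4 + B - 1 / 4) *
          ((√u / h) ^ m * q ^ (-(m / 2 + (d + 1) / 4 : ℝ)))) := by ring
      _ ≤ _ := by gcongr; exact le_max_right _ _

/-- The terms of the dual expansion of the Riesz mean. -/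
def dualTerm {d : ℕ} (γ : Fin d → ℕ → ℝ) (b : Fin d → ℕ) (m : ℕ) (c : ℝ) (ξ : Fin d → ℤ)
    (v : ℝ) : ℂ :=
  ∑ J ∈ subIndices b, ((∏ i, γ i (J i) : ℝ) : ℂ) * evenMonomial J ξ *
    besselIntegral c (m + 1 + dualExponent b J) (Real.pi ^ 2 * sqSum ξ) v

theorem exists_norm_fwdDiff_dualTerm_sum_le {d : ℕ} (hd : 1 ≤ d) (b : Fin d → ℕ)
    (γ : Fin d → ℕ → ℝ) (m : ℕ) : ∃ C : ℝ, 0 < C ∧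
    ∀ u h : ℝ, 1 ≤ u → 0 < h → m * h ≤ u → ∀ ξ : Fin d → ℤ, ξ ≠ 0 →
      ‖(fwdDiff h)^[m] (dualTerm γ b m (1 / u) ξ) u‖ ≤
      C * (h ^ m * u ^ (d / 4 + (∑ i, (b i : ℝ)) - 1 / 4) *
        min (sqSum ξ ^ (-((d + 1) / 4 : ℝ)))
          ((√u / h) ^ m * sqSum ξ ^ (-(m / 2 + (d + 1) / 4 : ℝ)))) := by
  have hex : ∀ J : Fin d → ℕ, ∃ C : ℝ, 0 < C ∧ (J ∈ subIndices b →
    ∀ u h : ℝ, 1 ≤ u → 0 < h → m * h ≤ u → ∀ ξ : Fin d → ℤ, ξ ≠ 0 →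
      evenMonomial J ξ * ‖(fwdDiff h)^[m] (besselIntegral (1 / u) (m + 1 + dualExponent b J)
        (Real.pi ^ 2 * sqSum ξ)) u‖ ≤
      C * (h ^ m * u ^ (d / 4 + (∑ i, (b i : ℝ)) - 1 / 4) *
        min (sqSum ξ ^ (-((d + 1) / 4 : ℝ)))
          ((√u / h) ^ m * sqSum ξ ^ (-(m / 2 + (d + 1) / 4 : ℝ))))) := fun J => by
    by_cases hJ : J ∈ subIndices b
    · obtain ⟨C, hC, h⟩ := exists_norm_fwdDiff_dualTerm_le hd hJ m
      exact ⟨C, hC, fun _ => h⟩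
    · exact ⟨1, one_pos, fun h => absurd h hJ⟩
  choose C hC h using hex
  refine ⟨∑ J ∈ subIndices b, |∏ i, γ i (J i)| * C J + 1, ?_, fun u t hu ht hmt ξ hξ => ?_⟩
  · have : 0 ≤ ∑ J ∈ subIndices b, |∏ i, γ i (J i)| * C J :=
      Finset.sum_nonneg fun J _ => mul_nonneg (abs_nonneg _) (hC J).le
    linarith
  · have e1 : dualTerm γ b m (1 / u) ξ = ∑ J ∈ subIndices b,
        (((∏ i, γ i (J i) : ℝ) : ℂ) * evenMonomial J ξ) •
        besselIntegral (1 / u) (m + 1 + dualExponent b J) (Real.pi ^ 2 * sqSum ξ) := by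
      funext v
      simp [dualTerm]
    rw [e1, fwdDiff_iter_finsetSum, Finset.sum_apply]
    have hq := sqSum_nonneg ξ
    set E := t ^ m * u ^ (d / 4 + (∑ i, (b i : ℝ)) - 1 / 4) *
        min (sqSum ξ ^ (-((d + 1) / 4 : ℝ)))
          ((√u / t) ^ m * sqSum ξ ^ (-(m / 2 + (d + 1) / 4 : ℝ))) with hE
    have hE0 : 0 ≤ E := by positivity
    calc _ ≤ ∑ J ∈ subIndices b, |∏ i, γ i (J i)| * (C J * E) := by
          refine (norm_sum_le _ _).trans (Finset.sum_le_sum fun J hJ => ?_)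
          rw [fwdDiff_iter_const_smul, Pi.smul_apply, norm_smul, norm_mul, Complex.norm_real,
            Complex.norm_real, Real.norm_eq_abs, Real.norm_of_nonneg (evenMonomial_nonneg J ξ),
            mul_assoc]
          exact mul_le_mul_of_nonneg_left (h J hJ u t hu ht hmt ξ hξ) (abs_nonneg _)
      _ = (∑ J ∈ subIndices b, |∏ i, γ i (J i)| * C J) * E := by
          rw [Finset.sum_mul]
          exact Finset.sum_congr rfl fun J _ => by ring
      _ ≤ _ := by nlinarith

/-- At ξ = 0 every J ≠ 0 has a vanishing monomial, so only ∏ Γ(b_i + 1/2) times an inverse Laplace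
transform of a power of s remains: this is the volume term. -/
theorem fwdDiff_dualTerm_zero {d : ℕ} (hd : 1 ≤ d) (b : Fin d → ℕ) {γ : Fin d → ℕ → ℝ}
    (hγ : ∀ i, γ i 0 = Real.Gamma (b i + 1 / 2)) (m : ℕ) {u h : ℝ} (hu : 0 < u) (hh : 0 < h) :
    ∃ D ∈ Icc (h ^ m * (evenConst b * u ^ (d / 2 + ∑ i, (b i : ℝ))))
      (h ^ m * (evenConst b * (u + m * h) ^ (d / 2 + ∑ i, (b i : ℝ)))),
      (fwdDiff h)^[m] (dualTerm γ b m (1 / u) 0) u = ((2 * Real.pi * D : ℝ) : ℂ) := by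
  set p := d / 2 + ∑ i, (b i : ℝ) with hp
  have hd' : (1 : ℝ) ≤ d := by exact_mod_cast hd
  have hp0 : 0 < p := by positivity
  have hm0 : (0 : ℝ) ≤ m := by positivity
  set K := ∏ i, Real.Gamma (b i + 1 / 2) with hK
  have hK0 : 0 < K := Finset.prod_pos fun i _ => Real.Gamma_pos_of_pos (by positivity)
  have h0 : (0 : Fin d → ℕ) ∈ subIndices b := by simp [subIndices]
  have e1 : dualTerm γ b m (1 / u) 0 = fun v =>
      ((2 * Real.pi * K * ((max v 0) ^ (p + m) / Real.Gamma (p + m + 1)) : ℝ) : ℂ) := by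
    funext v
    rw [dualTerm, Finset.sum_eq_single_of_mem 0 h0]
    · have h1 : evenMonomial (0 : Fin d → ℕ) 0 = 1 := by simp [evenMonomial]
      have h2 : sqSum (0 : Fin d → ℤ) = 0 := by simp [sqSum]
      have h3 : dualExponent b 0 = p := by simp [dualExponent, hp]
      rw [h1, h2, h3, mul_zero, besselIntegral_zero (by positivity) (by linarith)]
      simp only [Pi.zero_apply, hγ]
      rw [show (m : ℝ) + 1 + p - 1 = p + m by ring, show (m : ℝ) + 1 + p = p + m + 1 by ring,
        ← hK]
      push_cast
      ring
    · intro J _ hJ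
      obtain ⟨i, hi⟩ := Function.ne_iff.1 hJ
      have h1 : evenMonomial J (0 : Fin d → ℤ) = 0 := by
        refine Finset.prod_eq_zero (Finset.mem_univ i) ?_
        have : J i ≠ 0 := hi
        simp [this]
      rw [h1]
      simp
  set D₀ := (fwdDiff h)^[m] (fun v : ℝ => v ^ (p + m) / Real.Gamma (p + m + 1)) u with hD₀
  have hmem := fwdDiff_iter_rpow_mem hh m hp0 hu
  have e2 : evenConst b = K / Real.Gamma (p + 1) := rfl
  refine ⟨K * D₀, ⟨?_, ?_⟩, ?_⟩
  · rw [e2]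
    calc _ = K * (h ^ m * (u ^ p / Real.Gamma (p + 1))) := by ring
      _ ≤ _ := mul_le_mul_of_nonneg_left hmem.1 hK0.le
  · rw [e2]
    calc _ ≤ K * (h ^ m * ((u + m * h) ^ p / Real.Gamma (p + 1))) :=
          mul_le_mul_of_nonneg_left hmem.2 hK0.le
      _ = _ := by ring
  · rw [e1, fwdDiff_iter_ofReal]
    congr 1
    have := fwdDiff_iter_const_mul_comp_sub h m
      (fun v : ℝ => (max v 0) ^ (p + m) / Real.Gamma (p + m + 1)) (2 * Real.pi * K) 0 u
    simp only [sub_zero] at this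
    rw [this, fwdDiff_iter_congr hh.le m (g := fun v : ℝ => v ^ (p + m) / Real.Gamma (p + m + 1))]
    · ring
    · intro v hv
      rw [max_eq_left (by linarith)]

/-- The two-sided comparison obtained from the Riesz means by differencing with step `h`. -/
theorem exists_evenSum_le {d : ℕ} (hd : 2 ≤ d) (b : Fin d → ℕ) : ∃ (m : ℕ) (C : ℝ), 1 ≤ m ∧ 0 < C ∧
    ∀ u h : ℝ, 1 ≤ u → 0 < h → m * h ≤ u → h ≤ √u →
      evenSum b u ≤ evenConst b * (u + m * h) ^ (d / 2 + ∑ i, (b i : ℝ)) +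
        C * (u ^ (d / 4 + (∑ i, (b i : ℝ)) - 1 / 4) * (√u / h) ^ ((d - 1) / 2 : ℝ)) ∧
      evenConst b * u ^ (d / 2 + ∑ i, (b i : ℝ)) ≤ evenSum b (u + m * h) +
        C * (u ^ (d / 4 + (∑ i, (b i : ℝ)) - 1 / 4) * (√u / h) ^ ((d - 1) / 2 : ℝ)) := by
  choose γ hγ0 hγ using fun i => exists_hasSum_dualThetaTerm (b i)
  -- The least order for which the dual expansion was justified; it also exceeds d, as the frequency
  -- sum requires.
  set m := 2 * (∑ i, b i + d) + 1 with hm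
  obtain ⟨C₁, hC₁, h₁⟩ := exists_norm_fwdDiff_dualTerm_sum_le (by omega) b γ m
  obtain ⟨C₂, hC₂, h₂⟩ := sum_lattice_min_le hd (m := m) (by omega)
  refine ⟨m, C₁ * C₂, by omega, by positivity, fun u h hu hh hmh hhu => ?_⟩
  have hu0 : 0 < u := by linarith
  have hc : 0 < 1 / u := by positivity
  have hX : 1 ≤ √u / h := by rwa [one_le_div hh]
  set p := d / 2 + ∑ i, (b i : ℝ) with hp
  set E := u ^ (d / 4 + (∑ i, (b i : ℝ)) - 1 / 4) * (√u / h) ^ ((d - 1) / 2 : ℝ) with hE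
  obtain ⟨D, hD, hD'⟩ := fwdDiff_dualTerm_zero (by omega) b (fun i => hγ0 i) m hu0 hh
  have hsum := hasSum_fwdDiff_iter h m
    (fun v => hasSum_thetaIntegral_dual b γ (fun i => hγ i) le_rfl hc v) u
  change HasSum (fun ξ => (fwdDiff h)^[m] (dualTerm γ b m (1 / u) ξ) u) _ at hsum
  rw [fwdDiff_thetaIntegral b (by omega) hc hh] at hsum
  have hbound : ‖((2 * Real.pi * differencedSum b m h u : ℝ) : ℂ) -
      ((2 * Real.pi * D : ℝ) : ℂ)‖ ≤ C₁ * C₂ * (h ^ m * E) := by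
    -- Partial sums containing ξ = 0 are used, so that the volume term cancels exactly and the rest
    -- is bounded uniformly.
    refine le_of_tendsto (hsum.sub_const _).norm ?_
    filter_upwards [eventually_ge_atTop ({0} : Finset (Fin d → ℤ))] with t ht
    have h0 : (0 : Fin d → ℤ) ∈ t := ht (by simp)
    rw [← Finset.add_sum_erase t _ h0, hD', add_sub_cancel_left]
    refine (norm_sum_le _ _).trans ?_
    have hne : ∀ ξ ∈ t.erase 0, ξ ≠ 0 := fun ξ hξ => Finset.ne_of_mem_erase hξ
    calc _ ≤ ∑ ξ ∈ t.erase 0, C₁ * (h ^ m * u ^ (d / 4 + (∑ i, (b i : ℝ)) - 1 / 4)) *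
          min (sqSum ξ ^ (-((d + 1) / 4 : ℝ)))
          ((√u / h) ^ m * sqSum ξ ^ (-(m / 2 + (d + 1) / 4 : ℝ))) := by
          refine Finset.sum_le_sum fun ξ hξ => ?_
          rw [mul_assoc]
          exact h₁ u h hu hh hmh ξ (hne ξ hξ)
      _ ≤ C₁ * (h ^ m * u ^ (d / 4 + (∑ i, (b i : ℝ)) - 1 / 4)) *
          (C₂ * (√u / h) ^ ((d - 1) / 2 : ℝ)) := by
          rw [← Finset.mul_sum]
          exact mul_le_mul_of_nonneg_left (h₂ _ hX _ hne) (by positivity)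
      _ = _ := by rw [hE]; ring
  rw [← Complex.ofReal_sub, Complex.norm_real, Real.norm_eq_abs, abs_le] at hbound
  obtain ⟨hA1, hA2⟩ := differencedSum_mem b (by omega : 1 ≤ m) hh u
  have hhm : 0 < h ^ m := by positivity
  have hE0 : 0 ≤ C₁ * C₂ * (h ^ m * E) := by positivity
  have hpi : (1 : ℝ) ≤ 2 * Real.pi := by linarith [Real.pi_gt_three]
  have hdiff1 : differencedSum b m h u - D ≤ C₁ * C₂ * (h ^ m * E) := by
    by_contra! H
    nlinarith [hbound.2]
  have hdiff2 : D - differencedSum b m h u ≤ C₁ * C₂ * (h ^ m * E) := by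
    by_contra! H
    nlinarith [hbound.1]
  constructor
  · refine le_of_mul_le_mul_left ?_ hhm
    calc _ ≤ _ := hA1
      _ ≤ D + C₁ * C₂ * (h ^ m * E) := by linarith
      _ ≤ h ^ m * (evenConst b * (u + m * h) ^ p) + C₁ * C₂ * (h ^ m * E) := by linarith [hD.2]
      _ = _ := by ring
  · refine le_of_mul_le_mul_left ?_ hhm
    calc _ ≤ _ := hD.1
      _ ≤ differencedSum b m h u + C₁ * C₂ * (h ^ m * E) := by linarith
      _ ≤ h ^ m * evenSum b (u + m * h) + C₁ * C₂ * (h ^ m * E) := by linarith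
      _ = _ := by ring

/-! ### Choice of the step and the asymptotics for even monomials -/

theorem add_rpow_le {p u t : ℝ} (hp : 1 ≤ p) (hu : 0 < u) (ht : 0 ≤ t) (htu : t ≤ u) :
    (u + t) ^ p ≤ u ^ p + 2 ^ p * (t * u ^ (p - 1)) := by
  set x := t / u with hx
  have hx0 : 0 ≤ x := by positivity
  have hx1 : x ≤ 1 := by rwa [hx, div_le_one hu]
  have h1 : (1 + x) ^ p ≤ 1 + 2 ^ p * x := by
    have := (convexOn_rpow hp).2 (x := 1) (y := 2) (by simp) (by simp) (sub_nonneg.2 hx1) hx0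
      (by ring)
    simp only [smul_eq_mul, Real.one_rpow] at this
    rw [show (1 - x) * 1 + x * 2 = 1 + x by ring] at this
    refine this.trans ?_
    nlinarith
  have h2 : u + t = u * (1 + x) := by rw [hx]; field_simp
  rw [h2, Real.mul_rpow hu.le (by linarith), Real.rpow_sub_one hu.ne']
  have h3 : 0 < u ^ p := by positivity
  calc u ^ p * (1 + x) ^ p ≤ u ^ p * (1 + 2 ^ p * x) := by gcongr
    _ = _ := by rw [hx]; field_simp

/-- The lattice point asymptotics for an even monomial. -/
theorem exists_abs_evenSum_sub_le {d : ℕ} (hd : 2 ≤ d) (b : Fin d → ℕ) : ∃ C : ℝ, 0 < C ∧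
    ∀ v : ℝ, 1 ≤ v → |evenSum b v - evenConst b * v ^ (d / 2 + ∑ i, (b i : ℝ))| ≤
      C * v ^ (d / 2 + ∑ i, (b i : ℝ) - d / (d + 1)) := by
  obtain ⟨m, C, hm, hC, key⟩ := exists_evenSum_le hd b
  have hd' : (2 : ℝ) ≤ d := by exact_mod_cast hd
  have hm' : (1 : ℝ) ≤ m := by exact_mod_cast hm
  set B := ∑ i, (b i : ℝ) with hB
  have hB0 : 0 ≤ B := Finset.sum_nonneg fun i _ => by positivity
  set p := d / 2 + B with hp
  have hp1 : 1 ≤ p := by linarith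
  set K := evenConst b with hK
  have hK0 : 0 < K := evenConst_pos b
  set r := p - d / (d + 1) with hr
  have hdd : (d : ℝ) / (d + 1) ≤ 1 := by rw [div_le_one (by linarith)]; linarith
  have hr0 : 0 ≤ r := by linarith
  set E := C * (2 * m) ^ ((d - 1) / 2 : ℝ) with hE
  have hE0 : 0 < E := by positivity
  -- With h = v^{1/(d+1)}/(2m) the oscillatory error has exponent d/4 + B - 1/4 + (1/2 -
  -- 1/(d+1))(d-1)/2 = p - d/(d+1), the same as the sandwich loss h v^{p-1}. The denominator 2m
  -- guarantees mh ≤ v/2.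
  have hEeq : ∀ v h : ℝ, 1 ≤ v → h = v ^ (1 / (d + 1) : ℝ) / (2 * m) →
      C * (v ^ (d / 4 + B - 1 / 4) * (√v / h) ^ ((d - 1) / 2 : ℝ)) = E * v ^ r := by
    intro v h hv hh
    have hv0 : 0 < v := by linarith
    have h1 : √v / h = (2 * m) * v ^ (1 / 2 - 1 / (d + 1) : ℝ) := by
      rw [hh, Real.sqrt_eq_rpow, Real.rpow_sub hv0]
      field_simp
    rw [h1, Real.mul_rpow (by positivity) (by positivity), ← Real.rpow_mul hv0.le, hE,
      mul_left_comm (v ^ _), ← Real.rpow_add hv0, ← mul_assoc]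
    congr 2
    rw [hr, hp]
    field_simp
    ring
  have hmain : ∀ v h : ℝ, 1 ≤ v → h = v ^ (1 / (d + 1) : ℝ) / (2 * m) →
      (m * h) * v ^ (p - 1) ≤ v ^ r := by
    intro v h hv hh
    have hv0 : 0 < v := by linarith
    have h1 : (m * h) * v ^ (p - 1) = v ^ r / 2 := by
      have : v ^ r = v ^ (1 / (d + 1) : ℝ) * v ^ (p - 1) := by
        rw [← Real.rpow_add hv0]
        congr 1
        rw [hr]
        field_simp
        ring
      rw [this, hh]
      field_simp
    rw [h1]
    have : 0 < v ^ r := by positivity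
    linarith
  have hmh : ∀ v h : ℝ, 1 ≤ v → h = v ^ (1 / (d + 1) : ℝ) / (2 * m) →
      0 < h ∧ m * h ≤ v / 2 ∧ h ≤ √v / 2 := by
    intro v h hv hh
    have hv0 : 0 < v := by linarith
    have h1 : v ^ (1 / (d + 1) : ℝ) ≤ √v := by
      rw [Real.sqrt_eq_rpow]
      refine Real.rpow_le_rpow_of_exponent_le hv ?_
      rw [div_le_div_iff₀ (by linarith) (by norm_num)]
      linarith
    have h2 : √v ≤ v := by
      rw [Real.sqrt_le_left hv0.le]
      nlinarith
    refine ⟨by rw [hh]; positivity, ?_, ?_⟩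
    · have : m * h = v ^ (1 / (d + 1) : ℝ) / 2 := by rw [hh]; field_simp
      rw [this]
      linarith
    · rw [hh, div_le_div_iff₀ (by positivity) (by norm_num)]
      have : 0 ≤ √v := Real.sqrt_nonneg v
      nlinarith
  refine ⟨E + K * 2 ^ p + evenSum b 2, by have := evenSum_nonneg b 2; positivity, fun v hv => ?_⟩
  have hv0 : 0 < v := by linarith
  have hvr : 1 ≤ v ^ r := Real.one_le_rpow hv hr0
  have hS2 := evenSum_nonneg b 2
  have hSv := evenSum_nonneg b v
  set h := v ^ (1 / (d + 1) : ℝ) / (2 * m) with hh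
  obtain ⟨hh0, hmh1, hh2⟩ := hmh v h hv hh
  have hsv : 0 ≤ √v := Real.sqrt_nonneg v
  rw [abs_le]
  constructor
  -- The lower bound starts from u = v - mh ≥ v/2, which must be at least 1; for v ≤ 2 the main term
  -- is bounded and goes into the constant.
  · rcases le_total v 2 with hv2 | hv2
    · have h1 : v ^ p ≤ 2 ^ p := Real.rpow_le_rpow hv0.le hv2 (by linarith)
      have h2 : K * v ^ p ≤ K * 2 ^ p := by gcongr
      have h3 : 0 < K * 2 ^ p := by positivity
      nlinarith
    · set u := v - m * h with hu
      have hu1 : 1 ≤ u := by linarith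
      have hu0 : 0 < u := by linarith
      have huv : u ≤ v := by
        have : 0 ≤ m * h := by positivity
        linarith
      have hhu : h ≤ √u := by
        refine hh2.trans (Real.le_sqrt_of_sq_le ?_)
        rw [div_pow, Real.sq_sqrt hv0.le]
        linarith
      have h1 := (key u h hu1 hh0 (by linarith) hhu).2
      rw [show u + m * h = v by rw [hu]; ring] at h1
      have h2 : C * (u ^ (d / 4 + B - 1 / 4) * (√u / h) ^ ((d - 1) / 2 : ℝ)) ≤ E * v ^ r := by
        rw [← hEeq v h hv hh]
        have e1 : u ^ (d / 4 + B - 1 / 4) ≤ v ^ (d / 4 + B - 1 / 4) :=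
          Real.rpow_le_rpow hu0.le huv (by linarith)
        have e2 : (√u / h) ^ ((d - 1) / 2 : ℝ) ≤ (√v / h) ^ ((d - 1) / 2 : ℝ) :=
          Real.rpow_le_rpow (by positivity) (by gcongr) (by linarith)
        gcongr
      have h3 := add_rpow_le hp1 hu0 (t := m * h) (by positivity) (by linarith)
      rw [show u + m * h = v by rw [hu]; ring] at h3
      have h4 : (m * h) * u ^ (p - 1) ≤ v ^ r := by
        refine le_trans ?_ (hmain v h hv hh)
        have : u ^ (p - 1) ≤ v ^ (p - 1) := Real.rpow_le_rpow hu0.le huv (by linarith)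
        gcongr
      have h5 : K * v ^ p ≤ K * u ^ p + K * 2 ^ p * v ^ r := by
        calc K * v ^ p ≤ K * (u ^ p + 2 ^ p * (m * h * u ^ (p - 1))) := by gcongr
          _ ≤ K * (u ^ p + 2 ^ p * v ^ r) := by gcongr
          _ = _ := by ring
      nlinarith
  · have h1 := (key v h hv hh0 (by linarith) (by linarith)).1
    rw [hEeq v h hv hh] at h1
    have h2 := add_rpow_le hp1 hv0 (t := m * h) (by positivity) (by linarith)
    have h3 := hmain v h hv hh
    have h4 : K * (v + m * h) ^ p ≤ K * v ^ p + K * 2 ^ p * v ^ r := by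
      calc _ ≤ K * (v ^ p + 2 ^ p * (m * h * v ^ (p - 1))) := by gcongr
        _ ≤ K * (v ^ p + 2 ^ p * v ^ r) := by gcongr
        _ = _ := by ring
    nlinarith

/-! ### Gaussian moments and cancellation of the main term -/

/-- The moments `∫ xⁿ e^{-x²} dx`. -/
def gaussMoment (n : ℕ) : ℝ := if Even n then Real.Gamma ((n + 1) / 2) else 0

/-- Integration by parts against e^{-x²}, that is, the functional equation of Γ. At n = 0 the
truncated subtraction is harmless because its factor is 0. -/
theorem two_mul_gaussMoment_succ (n : ℕ) : 2 * gaussMoment (n + 1) = n * gaussMoment (n - 1) := by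
  rcases Nat.even_or_odd n with hn | hn
  · have h1 : ¬Even (n + 1) := by simpa [Nat.even_add_one] using hn
    rcases Nat.eq_zero_or_pos n with rfl | hpos
    · simp [gaussMoment]
    · have h2 : ¬Even (n - 1) := by
        obtain ⟨k, rfl⟩ := hn
        rw [Nat.not_even_iff_odd]
        exact ⟨k - 1, by omega⟩
      simp [gaussMoment, h1, h2]
  · obtain ⟨k, rfl⟩ := hn
    have h1 : Even (2 * k + 1 + 1) := ⟨k + 1, by ring⟩
    have h2 : Even (2 * k + 1 - 1) := ⟨k, by omega⟩
    rw [gaussMoment, gaussMoment, if_pos h1, if_pos h2]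
    have h3 : (((2 * k + 1 - 1 : ℕ) : ℝ) + 1) / 2 = k + 1 / 2 := by
      rw [Nat.add_sub_cancel]; push_cast; ring
    have h4 : (((2 * k + 1 + 1 : ℕ) : ℝ) + 1) / 2 = (k + 1 / 2) + 1 := by push_cast; ring
    rw [h3, h4, Real.Gamma_add_one (by positivity)]
    push_cast
    ring

/-- The Gaussian integral of a monomial. -/
def monomialMoment {d : ℕ} (α : Fin d →₀ ℕ) : ℝ := ∏ i, gaussMoment (α i)

theorem two_mul_monomialMoment_add_single {d : ℕ} (α : Fin d →₀ ℕ) (i : Fin d) :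
    2 * monomialMoment (α + Finsupp.single i 1) =
      α i * monomialMoment (α - Finsupp.single i 1) := by
  unfold monomialMoment
  rw [← Finset.mul_prod_erase _ _ (Finset.mem_univ i), ← Finset.mul_prod_erase _ _
    (Finset.mem_univ i), ← mul_assoc, ← mul_assoc]
  congr 1
  · simpa using two_mul_gaussMoment_succ (α i)
  · refine Finset.prod_congr rfl fun j hj => ?_
    have : i ≠ j := (Finset.ne_of_mem_erase hj).symm
    simp [this]

/-- Gaussian integration as a linear functional on polynomials. -/
def gaussFunctional (d : ℕ) : MvPolynomial (Fin d) ℂ →ₗ[ℂ] ℂ :=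
  (MvPolynomial.basisMonomials (Fin d) ℂ).constr ℂ fun α => (monomialMoment α : ℂ)

theorem gaussFunctional_monomial {d : ℕ} (α : Fin d →₀ ℕ) (c : ℂ) :
    gaussFunctional d (MvPolynomial.monomial α c) = c * monomialMoment α := by
  have h1 : MvPolynomial.monomial α c =
      c • (MvPolynomial.basisMonomials (Fin d) ℂ) α := by
    simp [MvPolynomial.smul_monomial]
  rw [h1, map_smul, gaussFunctional, Module.Basis.constr_basis, smul_eq_mul]

/-- The same integration by parts, for polynomials in several variables. -/
theorem gaussFunctional_pderiv {d : ℕ} (i : Fin d) (Q : MvPolynomial (Fin d) ℂ) :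
    gaussFunctional d (MvPolynomial.pderiv i Q) =
      2 * gaussFunctional d (MvPolynomial.X i * Q) := by
  induction Q using MvPolynomial.induction_on' with
  | monomial α c =>
    rw [MvPolynomial.pderiv_monomial, gaussFunctional_monomial, mul_comm (MvPolynomial.X i),
      ← pow_one (MvPolynomial.X i), ← MvPolynomial.monomial_add_single, gaussFunctional_monomial]
    have := congrArg (fun r : ℝ => (r : ℂ)) (two_mul_monomialMoment_add_single α i)
    push_cast at this
    linear_combination -c * this
  | add p q hp hq => rw [map_add, map_add, hp, hq, mul_add, map_add, mul_add]

/-- Harmonic polynomials of positive degree have vanishing Gaussian integral. -/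
theorem gaussFunctional_eq_zero {d k : ℕ} (hk : 1 ≤ k) {P : MvPolynomial (Fin d) ℂ}
    (hP : P.IsHomogeneous k)
    (hh : ∑ i, MvPolynomial.pderiv i (MvPolynomial.pderiv i P) = 0) : gaussFunctional d P = 0 := by
  have h1 := congrArg (gaussFunctional d) hh
  rw [map_sum, map_zero] at h1
  simp_rw [gaussFunctional_pderiv] at h1
  -- One derivative of each ∂_i² becomes 2 X_i, and Euler's identity turns Σ X_i ∂_i P into kP;
  -- hence 2k times the Gaussian mean of P is zero.
  rw [← Finset.mul_sum, ← map_sum, hP.sum_X_mul_pderiv, map_nsmul, nsmul_eq_mul] at h1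
  have hk' : (k : ℂ) ≠ 0 := by exact_mod_cast (by omega : k ≠ 0)
  simpa [hk'] using h1

theorem sqSum_update_neg {d : ℕ} (x : Fin d → ℤ) (i : Fin d) :
    sqSum (Function.update x i (-x i)) = sqSum x := by
  refine Finset.sum_congr rfl fun j _ => ?_
  by_cases h : j = i
  · subst h; simp
  · simp [h]

theorem sum_monomial_eq_zero {d : ℕ} {α : Fin d →₀ ℕ} {i : Fin d} (hi : Odd (α i)) (u : ℝ) :
    ∑ x ∈ sqBall d u, ∏ j, (x j : ℝ) ^ α j = 0 := by
  have hneg : ∑ x ∈ sqBall d u, ∏ j, (x j : ℝ) ^ α j =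
      ∑ x ∈ sqBall d u, -∏ j, (x j : ℝ) ^ α j := by
    refine Finset.sum_bij' (fun x _ => Function.update x i (-x i))
      (fun x _ => Function.update x i (-x i)) ?_ ?_ ?_ ?_ ?_
    · intro x hx
      rwa [mem_sqBall, sqSum_update_neg, ← mem_sqBall]
    · intro x hx
      rwa [mem_sqBall, sqSum_update_neg, ← mem_sqBall]
    · intro x _
      simp
    · intro x _
      simp
    · intro x _
      rw [← Finset.mul_prod_erase _ _ (Finset.mem_univ i), ← Finset.mul_prod_erase _ _
        (Finset.mem_univ i), ← neg_mul]
      congr 1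
      · simp [hi.neg_pow]
      · refine Finset.prod_congr rfl fun j hj => ?_
        rw [Function.update_of_ne (Finset.ne_of_mem_erase hj)]
  rw [Finset.sum_neg_distrib] at hneg
  linarith

/-- With moments in place of Gamma products both parities have the same form: if some exponent is
odd, reflection kills the sum and the moment is 0. -/
theorem exists_abs_sum_monomial_sub_le {d : ℕ} (hd : 2 ≤ d) (k : ℕ) (α : Fin d →₀ ℕ)
    (hα : ∑ i, α i = k) : ∃ C : ℝ, 0 < C ∧ ∀ v : ℝ, 1 ≤ v →
      |∑ x ∈ sqBall d v, ∏ j, (x j : ℝ) ^ α j -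
        monomialMoment α / Real.Gamma (d / 2 + k / 2 + 1) * v ^ (d / 2 + k / 2 : ℝ)| ≤
      C * v ^ (d / 2 + k / 2 - d / (d + 1) : ℝ) := by
  by_cases h : ∀ i, Even (α i)
  · choose b hb using h
    have hb' : ∀ i, α i = 2 * b i := fun i => by rw [hb i]; ring
    obtain ⟨C, hC, key⟩ := exists_abs_evenSum_sub_le hd b
    refine ⟨C, hC, fun v hv => ?_⟩
    have hk : (k : ℝ) / 2 = ∑ i, (b i : ℝ) := by
      rw [← hα]
      simp only [hb', Nat.cast_sum, Nat.cast_mul, Nat.cast_ofNat, ← Finset.mul_sum]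
      ring
    have h1 : monomialMoment α / Real.Gamma (d / 2 + k / 2 + 1) = evenConst b := by
      rw [evenConst, hk, monomialMoment]
      congr 1
      refine Finset.prod_congr rfl fun i _ => ?_
      rw [gaussMoment, if_pos ⟨b i, hb i⟩, hb']
      congr 1
      push_cast
      ring
    have h2 : ∑ x ∈ sqBall d v, ∏ j, (x j : ℝ) ^ α j = evenSum b v := by
      simp only [evenSum, evenMonomial, hb']
    rw [h1, h2, hk]
    exact key v hv
  · push Not at h
    obtain ⟨i, hi⟩ := h
    refine ⟨1, one_pos, fun v hv => ?_⟩
    have h1 : monomialMoment α = 0 :=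
      Finset.prod_eq_zero (Finset.mem_univ i) (by rw [gaussMoment, if_neg hi])
    rw [sum_monomial_eq_zero (Nat.not_even_iff_odd.1 hi), h1]
    simp
    positivity

/-- The sum of the absolute values of the coefficients of degree `k`. -/
def coeffNorm {d : ℕ} (k : ℕ) (P : MvPolynomial (Fin d) ℂ) : ℝ :=
  ∑ α ∈ Finset.univ.finsuppAntidiag k, ‖P.coeff α‖

theorem support_subset_finsuppAntidiag {d k : ℕ} {P : MvPolynomial (Fin d) ℂ}
    (hP : P.IsHomogeneous k) : P.support ⊆ Finset.univ.finsuppAntidiag k := by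
  intro α hα
  rw [Finset.mem_finsuppAntidiag]
  refine ⟨?_, Finset.subset_univ _⟩
  have h1 := hP (MvPolynomial.mem_support_iff.1 hα)
  rw [Finsupp.weight_apply, Finsupp.sum_fintype _ _ (by simp)] at h1
  simpa using h1

theorem eval_eq_sum_finsuppAntidiag {d k : ℕ} {P : MvPolynomial (Fin d) ℂ}
    (hP : P.IsHomogeneous k) (x : Fin d → ℂ) : MvPolynomial.eval x P =
      ∑ α ∈ Finset.univ.finsuppAntidiag k, P.coeff α * ∏ j, x j ^ α j := by
  rw [MvPolynomial.eval_eq']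
  refine Finset.sum_subset (support_subset_finsuppAntidiag hP) fun α _ hα => ?_
  rw [MvPolynomial.notMem_support_iff.1 hα, zero_mul]

theorem gaussFunctional_eq_sum {d k : ℕ} {P : MvPolynomial (Fin d) ℂ} (hP : P.IsHomogeneous k) :
    gaussFunctional d P =
      ∑ α ∈ Finset.univ.finsuppAntidiag k, P.coeff α * monomialMoment α := by
  conv_lhs => rw [P.as_sum, map_sum]
  simp_rw [gaussFunctional_monomial]
  refine Finset.sum_subset (support_subset_finsuppAntidiag hP) fun α _ hα => ?_
  rw [MvPolynomial.notMem_support_iff.1 hα, zero_mul]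

/-- The sum of a harmonic polynomial over the lattice points of a ball. -/
theorem exists_norm_sum_harmonic_le {d : ℕ} (hd : 2 ≤ d) (k : ℕ) (hk : 1 ≤ k) : ∃ C : ℝ, 0 < C ∧
    ∀ P : MvPolynomial (Fin d) ℂ, P.IsHomogeneous k →
      ∑ i, MvPolynomial.pderiv i (MvPolynomial.pderiv i P) = 0 → ∀ v : ℝ, 1 ≤ v →
      ‖∑ x ∈ sqBall d v, MvPolynomial.eval (fun i => (x i : ℂ)) P‖ ≤
        C * coeffNorm k P * v ^ (d / 2 + k / 2 - d / (d + 1) : ℝ) := by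
  have hex : ∀ α : Fin d →₀ ℕ, ∃ C : ℝ, 0 < C ∧ (∑ i, α i = k → ∀ v : ℝ, 1 ≤ v →
      |∑ x ∈ sqBall d v, ∏ j, (x j : ℝ) ^ α j -
        monomialMoment α / Real.Gamma (d / 2 + k / 2 + 1) * v ^ (d / 2 + k / 2 : ℝ)| ≤
      C * v ^ (d / 2 + k / 2 - d / (d + 1) : ℝ)) := fun α => by
    by_cases h : ∑ i, α i = k
    · obtain ⟨C, hC, h'⟩ := exists_abs_sum_monomial_sub_le hd k α h
      exact ⟨C, hC, fun _ => h'⟩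
    · exact ⟨1, one_pos, fun h' => absurd h' h⟩
  choose C hC key using hex
  refine ⟨∑ α ∈ Finset.univ.finsuppAntidiag k, C α + 1, ?_, fun P hP hh v hv => ?_⟩
  · have : 0 ≤ ∑ α ∈ Finset.univ.finsuppAntidiag k, C α := Finset.sum_nonneg fun α _ => (hC α).le
    linarith
  set A : Finset (Fin d →₀ ℕ) := Finset.univ.finsuppAntidiag k with hA
  have hv0 : 0 < v := by linarith
  set V := v ^ (d / 2 + k / 2 - d / (d + 1) : ℝ) with hV
  have hV0 : 0 < V := by positivity
  set G : ℝ := v ^ (d / 2 + k / 2 : ℝ) / Real.Gamma (d / 2 + k / 2 + 1) with hG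
  -- The Gamma factor and the power of v depend only on d and k, so the main terms add up to a
  -- multiple of the Gaussian mean, which is zero.
  have h0 : ∑ α ∈ A, P.coeff α * monomialMoment α = 0 := by
    rw [← gaussFunctional_eq_sum hP, gaussFunctional_eq_zero hk hP hh]
  have h1 : ∑ x ∈ sqBall d v, MvPolynomial.eval (fun i => (x i : ℂ)) P =
      ∑ α ∈ A, P.coeff α * ((∑ x ∈ sqBall d v, ∏ j, (x j : ℝ) ^ α j -
        monomialMoment α / Real.Gamma (d / 2 + k / 2 + 1) * v ^ (d / 2 + k / 2 : ℝ) : ℝ) : ℂ) := by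
    have e1 : ∑ x ∈ sqBall d v, MvPolynomial.eval (fun i => (x i : ℂ)) P =
        ∑ α ∈ A, P.coeff α * ((∑ x ∈ sqBall d v, ∏ j, (x j : ℝ) ^ α j : ℝ) : ℂ) := by
      simp_rw [eval_eq_sum_finsuppAntidiag hP]
      rw [Finset.sum_comm]
      refine Finset.sum_congr rfl fun α _ => ?_
      rw [← Finset.mul_sum]
      push_cast
      rfl
    have e2 : ∑ α ∈ A, P.coeff α * ((monomialMoment α / Real.Gamma (d / 2 + k / 2 + 1) *
        v ^ (d / 2 + k / 2 : ℝ) : ℝ) : ℂ) = 0 := by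
      calc _ = (∑ α ∈ A, P.coeff α * monomialMoment α) * (G : ℂ) := by
            rw [Finset.sum_mul]
            refine Finset.sum_congr rfl fun α _ => ?_
            rw [hG, mul_assoc, ← Complex.ofReal_mul]
            congr 2
            ring
        _ = 0 := by rw [h0, zero_mul]
    rw [e1, ← sub_zero (∑ α ∈ A, _), ← e2, ← Finset.sum_sub_distrib]
    refine Finset.sum_congr rfl fun α _ => ?_
    rw [← mul_sub, ← Complex.ofReal_sub]
  rw [h1]
  calc _ ≤ ∑ α ∈ A, ‖P.coeff α‖ * (C α * V) := by
        refine (norm_sum_le _ _).trans (Finset.sum_le_sum fun α hα => ?_)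
        rw [norm_mul, Complex.norm_real, Real.norm_eq_abs]
        exact mul_le_mul_of_nonneg_left
          (key α (by simpa using (Finset.mem_finsuppAntidiag.1 hα).1) v hv) (norm_nonneg _)
    _ ≤ ∑ α ∈ A, ‖P.coeff α‖ * ((∑ β ∈ A, C β + 1) * V) := by
        refine Finset.sum_le_sum fun α hα => ?_
        have := Finset.single_le_sum (f := C) (fun β _ => (hC β).le) hα
        gcongr
        linarith
    _ = _ := by rw [← Finset.sum_mul, coeffNorm]; ring

/-- In one variable the sum of a harmonic form over a symmetric interval vanishes. -/
theorem sum_harmonic_one_eq_zero {k : ℕ} (hk : 1 ≤ k) {P : MvPolynomial (Fin 1) ℂ}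
    (hP : P.IsHomogeneous k)
    (hh : ∑ i, MvPolynomial.pderiv i (MvPolynomial.pderiv i P) = 0) (v : ℝ) :
    ∑ x ∈ sqBall 1 v, MvPolynomial.eval (fun i => (x i : ℂ)) P = 0 := by
  rcases hk.eq_or_lt with rfl | hk
  · simp_rw [eval_eq_sum_finsuppAntidiag hP]
    rw [Finset.sum_comm]
    refine Finset.sum_eq_zero fun α hα => ?_
    have h1 : α 0 = 1 := by simpa using (Finset.mem_finsuppAntidiag.1 hα).1
    have h2 := congrArg (fun r : ℝ => (r : ℂ)) (sum_monomial_eq_zero (α := α) (i := 0)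
      (by rw [h1]; exact odd_one) v)
    push_cast at h2
    rw [← Finset.mul_sum, h2, mul_zero]
  · rw [Fin.sum_univ_one] at hh
    -- For k ≥ 2, Euler's identity for P' together with P'' = 0 gives P' = 0, and Euler's identity
    -- for P then gives P = 0.
    have h1 := hP.sum_X_mul_pderiv
    have h2 := (hP.pderiv (i := 0)).sum_X_mul_pderiv
    rw [Fin.sum_univ_one] at h1 h2
    rw [hh, mul_zero, eq_comm, smul_eq_zero] at h2
    have h3 : MvPolynomial.pderiv 0 P = 0 := h2.resolve_left (by omega)
    rw [h3, mul_zero, eq_comm, smul_eq_zero] at h1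
    rw [h1.resolve_left (by omega)]
    simp

theorem exists_norm_sum_harmonic_le_of_pos {d : ℕ} (hd : 1 ≤ d) (k : ℕ) (hk : 1 ≤ k) :
    ∃ C : ℝ, 0 < C ∧ ∀ P : MvPolynomial (Fin d) ℂ, P.IsHomogeneous k →
      ∑ i, MvPolynomial.pderiv i (MvPolynomial.pderiv i P) = 0 → ∀ v : ℝ, 1 ≤ v →
      ‖∑ x ∈ sqBall d v, MvPolynomial.eval (fun i => (x i : ℂ)) P‖ ≤
        C * coeffNorm k P * v ^ (d / 2 + k / 2 - d / (d + 1) : ℝ) := by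
  rcases hd.eq_or_lt with rfl | hd
  · refine ⟨1, one_pos, fun P hP hh v hv => ?_⟩
    rw [sum_harmonic_one_eq_zero hk hP hh, norm_zero]
    have : 0 ≤ coeffNorm k P := Finset.sum_nonneg fun _ _ => norm_nonneg _
    positivity
  · exact exists_norm_sum_harmonic_le hd k hk

/-! ### Uniformity over normalized harmonic forms in all dimensions -/

/-- The homogeneous polynomial with given coefficients. -/
def formOfCoeffs (d k : ℕ) : (↥((Finset.univ : Finset (Fin d)).finsuppAntidiag k) → ℝ) →ₗ[ℝ]
    MvPolynomial (Fin d) ℝ :=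
  ∑ α, (MvPolynomial.monomial α.1).comp (LinearMap.proj α)

theorem coeff_formOfCoeffs {d k : ℕ} (c : ↥((Finset.univ : Finset (Fin d)).finsuppAntidiag k) → ℝ)
    (α : ↥((Finset.univ : Finset (Fin d)).finsuppAntidiag k)) :
    (formOfCoeffs d k c).coeff α.1 = c α := by
  classical
  simp only [formOfCoeffs, LinearMap.sum_apply, LinearMap.comp_apply, LinearMap.proj_apply,
    MvPolynomial.coeff_sum, MvPolynomial.coeff_monomial]
  rw [Finset.sum_eq_single α]
  · simp
  · intro β _ hβ
    rw [if_neg fun h => hβ (Subtype.ext h)]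
  · simp

/-- The restriction of a polynomial to the closed unit ball. -/
def ballEval (d : ℕ) : MvPolynomial (Fin d) ℝ →ₗ[ℝ]
    C(Metric.closedBall (0 : EuclideanSpace ℝ (Fin d)) 1, ℝ) where
  toFun P := ⟨fun x => MvPolynomial.eval (fun i => x.1 i) P, by
    refine (MvPolynomial.continuous_eval P).comp ?_
    fun_prop⟩
  map_add' P Q := by ext; simp
  map_smul' c P := by ext; simp [MvPolynomial.smul_eval]

theorem ballEval_injective (d : ℕ) : Function.Injective (ballEval d) := by
  intro P Q h
  -- The cube [0, 1/(d+1)]^d lies in the unit ball, and a polynomial is determined by its values on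
  -- a product of infinite sets.
  refine MvPolynomial.funext_set (fun _ => Icc (0 : ℝ) (1 / (d + 1)))
    (fun _ => Icc_infinite (by positivity)) fun x hx => ?_
  have hx' : WithLp.toLp 2 x ∈ Metric.closedBall (0 : EuclideanSpace ℝ (Fin d)) 1 := by
    rw [mem_closedBall_zero_iff, ← sq_le_one_iff₀ (norm_nonneg _), EuclideanSpace.norm_sq_eq]
    calc ∑ i, ‖x i‖ ^ 2 ≤ ∑ _i : Fin d, (1 / (d + 1 : ℝ)) := by
          refine Finset.sum_le_sum fun i _ => ?_
          have h1 := hx i (mem_univ i)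
          have h2 : (1 / (d + 1) : ℝ) ≤ 1 := by
            rw [div_le_one (by positivity)]
            have : (0 : ℝ) ≤ d := by positivity
            linarith
          rw [Real.norm_of_nonneg h1.1]
          nlinarith [h1.1, h1.2]
      _ ≤ 1 := by
          rw [Finset.sum_const, Finset.card_univ, Fintype.card_fin, nsmul_eq_mul, mul_one_div,
            div_le_one (by positivity)]
          linarith
  have := DFunLike.congr_fun h (⟨WithLp.toLp 2 x, hx'⟩ : Metric.closedBall _ _)
  simpa [ballEval] using this

/-- Restriction to the ball is injective on the finite-dimensional coefficient space, hence
antilipschitz; the constant depends on d and k alone. -/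
theorem exists_coeffNorm_le (d k : ℕ) : ∃ C : ℝ, 0 < C ∧ ∀ P : MvPolynomial (Fin d) ℝ,
    P.IsHomogeneous k →
    (∀ x ∈ Metric.closedBall (0 : EuclideanSpace ℝ (Fin d)) 1,
      |MvPolynomial.eval (fun i => x i) P| ≤ 1) →
    coeffNorm k (P.map (algebraMap ℝ ℂ)) ≤ C := by
  set A : Finset (Fin d →₀ ℕ) := Finset.univ.finsuppAntidiag k with hA
  have hinj : LinearMap.ker ((ballEval d).comp (formOfCoeffs d k)) = ⊥ := by
    refine LinearMap.ker_eq_bot.2 ((ballEval_injective d).comp fun c c' h => ?_)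
    funext α
    rw [← coeff_formOfCoeffs c α, h, coeff_formOfCoeffs]
  obtain ⟨K, hK, hanti⟩ := LinearMap.exists_antilipschitzWith _ hinj
  refine ⟨A.card * K + 1, by positivity, fun P hP hb => ?_⟩
  have hPc : formOfCoeffs d k (fun α => P.coeff α.1) = P := by
    ext α
    by_cases hα : α ∈ A
    · exact coeff_formOfCoeffs (fun α => P.coeff α.1) ⟨α, hα⟩
    · classical
      have h1 : P.coeff α = 0 := by
        by_contra h
        refine hα (Finset.mem_finsuppAntidiag.2 ⟨?_, Finset.subset_univ _⟩)
        have h1 := hP h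
        rw [Finsupp.weight_apply, Finsupp.sum_fintype _ _ (by simp)] at h1
        simpa using h1
      rw [h1]
      simp only [formOfCoeffs, LinearMap.sum_apply, LinearMap.comp_apply, LinearMap.proj_apply,
        MvPolynomial.coeff_sum, MvPolynomial.coeff_monomial]
      refine Finset.sum_eq_zero fun β _ => ?_
      rw [if_neg]
      rintro rfl
      exact hα β.2
  have h1 : ‖fun α : A => P.coeff α.1‖ ≤ K := by
    have h2 := hanti.le_mul_dist (fun α : A => P.coeff α.1) 0
    rw [map_zero, dist_zero_right, dist_zero_right, LinearMap.comp_apply, hPc] at h2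
    refine h2.trans (mul_le_of_le_one_right K.2 ?_)
    rw [ContinuousMap.norm_le _ zero_le_one]
    exact fun x => hb x.1 x.2
  have h2 : ∀ α ∈ A, ‖(P.map (algebraMap ℝ ℂ)).coeff α‖ ≤ K := fun α hα => by
    rw [MvPolynomial.coeff_map, Complex.coe_algebraMap, Complex.norm_real]
    exact (norm_le_pi_norm (fun α : A => P.coeff α.1) ⟨α, hα⟩).trans h1
  calc coeffNorm k (P.map (algebraMap ℝ ℂ)) ≤ ∑ _α ∈ A, (K : ℝ) := Finset.sum_le_sum h2
    _ = A.card * K := by simp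
    _ ≤ _ := by linarith

/-- Squared norms of lattice points are integers, so the strict inequality |x|² < R² is the weak one
with ⌈R²⌉ - 1. -/
theorem latticeBall_eq_sqBall (d : ℕ) {R : ℝ} (hR : 0 < R) :
    latticeBall d R = sqBall d ((⌈R ^ 2⌉ - 1 : ℤ) : ℝ) := by
  ext x
  have h1 : sqSum x = ((∑ i, (x i) ^ 2 : ℤ) : ℝ) := by simp [sqSum]
  rw [mem_sqBall, latticeBall, Set.Finite.mem_toFinset, Set.mem_ofPred_eq,
    ← sq_lt_sq₀ (norm_nonneg _) hR.le, norm_latticePoint_sq, h1, Int.cast_le, Int.le_sub_one_iff,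
    Int.lt_ceil]

theorem eq_zero_of_mem_sqBall {d : ℕ} {v : ℝ} (hv : v < 1) {x : Fin d → ℤ} (hx : x ∈ sqBall d v) :
    x = 0 := by
  by_contra h
  rw [mem_sqBall] at hx
  linarith [one_le_sqSum h]

theorem exists_abs_sum_latticeBall_le (d k : ℕ) (hd : 1 ≤ d) (hk : 1 ≤ k) :
    ∃ C : ℝ, ∀ P : MvPolynomial (Fin d) ℝ, P.IsHomogeneous k → IsHarmonicPoly P →
      IsGreatest ((fun x : EuclideanSpace ℝ (Fin d) => |MvPolynomial.eval (fun i => x i) P|) ''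
        Metric.closedBall 0 1) 1 →
      ∀ R : ℝ, 0 < R →
        |1 / R ^ d * ∑ x ∈ latticeBall d R, MvPolynomial.eval (fun i => (x i : ℝ)) P / R ^ k|
          ≤ C * R ^ (-1 - (1 - 2 / ((d : ℝ) + 1))) := by
  obtain ⟨C₁, hC₁, h₁⟩ := exists_norm_sum_harmonic_le_of_pos hd k hk
  obtain ⟨C₂, hC₂, h₂⟩ := exists_coeffNorm_le d k
  refine ⟨C₁ * C₂, fun P hP hh hmax R hR => ?_⟩
  have hd0 : (0 : ℝ) ≤ d := by positivity
  set Q := P.map (algebraMap ℝ ℂ) with hQ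
  have hcn : coeffNorm k Q ≤ C₂ := h₂ P hP fun x hx => hmax.2 ⟨x, hx, rfl⟩
  have hQh : ∑ i, MvPolynomial.pderiv i (MvPolynomial.pderiv i Q) = 0 := by
    have := congrArg (MvPolynomial.map (algebraMap ℝ ℂ)) hh
    rw [map_sum, map_zero] at this
    simpa only [hQ, MvPolynomial.pderiv_map] using this
  set v : ℝ := ((⌈R ^ 2⌉ - 1 : ℤ) : ℝ) with hv
  have hcast : ‖∑ x ∈ sqBall d v, MvPolynomial.eval (fun i => (x i : ℂ)) Q‖ =
      |∑ x ∈ sqBall d v, MvPolynomial.eval (fun i => (x i : ℝ)) P| := by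
    rw [← Real.norm_eq_abs, ← Complex.norm_real, Complex.ofReal_sum]
    congr 1
    refine Finset.sum_congr rfl fun x _ => ?_
    have h3 := MvPolynomial.eval₂_comp (algebraMap ℝ ℂ) (fun i => (x i : ℝ)) P
    simp only [Complex.coe_algebraMap, Function.comp_def, Complex.ofReal_intCast] at h3
    rw [hQ, MvPolynomial.eval_map, h3]
  rw [← Finset.sum_div, latticeBall_eq_sqBall d hR]
  -- The estimates need v ≥ 1. For R ≤ 1 only the origin is counted, and a form of positive degree
  -- vanishes there.
  by_cases hR1 : R ≤ 1
  · have hv1 : v < 1 := by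
      have h3 : ⌈R ^ 2⌉ ≤ 1 := Int.ceil_le.2 (by push_cast; nlinarith)
      have h4 : ⌈R ^ 2⌉ - 1 < 1 := by omega
      rw [hv]
      exact_mod_cast h4
    have h0 : ∑ x ∈ sqBall d v, MvPolynomial.eval (fun i => (x i : ℝ)) P = 0 := by
      refine Finset.sum_eq_zero fun x hx => ?_
      rw [eq_zero_of_mem_sqBall hv1 hx]
      have h5 : P.coeff 0 = 0 := hP.coeff_eq_zero (by simp; omega)
      have h6 : (fun i : Fin d => (((0 : Fin d → ℤ) i : ℤ) : ℝ)) = 0 := by funext i; simp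
      rw [h6, MvPolynomial.eval_zero]
      exact h5
    rw [h0, zero_div, mul_zero, abs_zero]
    positivity
  · push Not at hR1
    have hv1 : 1 ≤ v := by
      have h3 : 1 < ⌈R ^ 2⌉ := Int.lt_ceil.2 (by push_cast; nlinarith)
      rw [hv]
      exact_mod_cast (by omega : (1 : ℤ) ≤ ⌈R ^ 2⌉ - 1)
    have hvR : v ≤ R ^ 2 := by
      rw [hv]
      push_cast
      linarith [Int.ceil_lt_add_one (R ^ 2)]
    have h3 := h₁ Q (hP.map _) hQh v hv1
    rw [hcast] at h3
    have he : (0 : ℝ) ≤ d / 2 + k / 2 - d / (d + 1) := by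
      have hd1 : (1 : ℝ) ≤ d := by exact_mod_cast hd
      have hk1 : (1 : ℝ) ≤ k := by exact_mod_cast hk
      have : (d : ℝ) / (d + 1) ≤ 1 := by rw [div_le_one (by positivity)]; linarith
      linarith
    have h4 : v ^ (d / 2 + k / 2 - d / (d + 1) : ℝ) ≤
        R ^ d * R ^ k * R ^ (-1 - (1 - 2 / ((d : ℝ) + 1))) := by
      calc _ ≤ (R ^ 2) ^ (d / 2 + k / 2 - d / (d + 1) : ℝ) :=
            Real.rpow_le_rpow (by linarith) hvR he
        _ = _ := by
            rw [← Real.rpow_natCast R 2, ← Real.rpow_mul hR.le, ← Real.rpow_natCast R d,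
              ← Real.rpow_natCast R k, ← Real.rpow_add hR, ← Real.rpow_add hR]
            congr 1
            push_cast
            field_simp
            ring
    rw [abs_mul, abs_div, abs_div, abs_one, abs_of_pos (by positivity : 0 < R ^ d),
      abs_of_pos (by positivity : 0 < R ^ k)]
    calc _ ≤ 1 / R ^ d * ((C₁ * C₂ * (R ^ d * R ^ k * R ^ (-1 - (1 - 2 / ((d : ℝ) + 1))))) /
          R ^ k) := by
          gcongr
          refine h3.trans ?_
          gcongr
      _ = _ := by field_simp

/-! ### Gaussian integers: counting and power sums -/

theorem norm_gaussianInt_sq (z : GaussianInt) :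
    ‖(z : ℂ)‖ ^ 2 = (z.re : ℝ) ^ 2 + (z.im : ℝ) ^ 2 := by
  rw [Complex.sq_norm, Complex.normSq_apply]
  simp
  ring

theorem mem_gaussianDisk {t : ℝ} {z : GaussianInt} :
    z ∈ gaussianDisk t ↔ Real.pi * ‖(z : ℂ)‖ ^ 2 ≤ t := by
  rw [gaussianDisk, Set.Finite.mem_toFinset, Set.mem_ofPred_eq]

theorem sum_gaussianDisk {M : Type*} [AddCommMonoid M] (t : ℝ) (f : GaussianInt → M) :
    ∑ z ∈ gaussianDisk t, f z = ∑ x ∈ sqBall 2 (t / Real.pi), f ⟨x 0, x 1⟩ := by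
  have hmem : ∀ a b : ℤ, (⟨a, b⟩ : GaussianInt) ∈ gaussianDisk t ↔
      ![a, b] ∈ sqBall 2 (t / Real.pi) := fun a b => by
    rw [mem_gaussianDisk, mem_sqBall, norm_gaussianInt_sq, sqSum, Fin.sum_univ_two,
      le_div_iff₀' Real.pi_pos]
    rfl
  refine Finset.sum_bij' (fun z _ => ![z.re, z.im]) (fun x _ => ⟨x 0, x 1⟩)
    (fun z hz => (hmem _ _).1 hz) (fun x hx => (hmem _ _).2 ?_) (fun z _ => rfl)
    (fun x _ => ?_) (fun z _ => rfl)
  · rwa [show ![x 0, x 1] = x from by ext i; fin_cases i <;> rfl]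
  · ext i; fin_cases i <;> rfl

theorem gaussianDisk_of_lt_pi {t : ℝ} (ht0 : 0 < t) (ht : t < Real.pi) : gaussianDisk t = {0} := by
  ext z
  rw [mem_gaussianDisk, Finset.mem_singleton]
  constructor
  · intro h
    by_contra hz
    have h1 : (1 : ℝ) ≤ ‖(z : ℂ)‖ ^ 2 := by
      have h2 : 0 < ‖(z : ℂ)‖ ^ 2 := by
        have : (z : ℂ) ≠ 0 := by simpa [GaussianInt.toComplex_eq_zero] using hz
        positivity
      rw [norm_gaussianInt_sq] at h2 ⊢
      exact_mod_cast h2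
    nlinarith [Real.pi_pos]
  · rintro rfl
    simp [ht0.le]

theorem evenConst_zero_two : evenConst (0 : Fin 2 → ℕ) = Real.pi := by
  have h : Real.Gamma (2 / 2 + 0 + 1) = 1 := by
    rw [show (2 / 2 + 0 + 1 : ℝ) = 2 by norm_num, Real.Gamma_two]
  simp only [evenConst, Fin.prod_univ_two, Pi.zero_apply, Nat.cast_zero,
    Finset.sum_const_zero]
  push_cast
  rw [h, zero_add, Real.Gamma_one_half_eq, div_one, Real.mul_self_sqrt Real.pi_pos.le]

theorem exists_abs_card_gaussianDisk_sub_le : ∃ C : ℝ, 0 < C ∧ ∀ t : ℝ, 1 ≤ t →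
    |((gaussianDisk t).card : ℝ) - t| ≤ C * t ^ ((1 : ℝ) / 3) := by
  obtain ⟨C, hC, h⟩ := exists_abs_evenSum_sub_le le_rfl (0 : Fin 2 → ℕ)
  refine ⟨C + Real.pi, by positivity, fun t ht => ?_⟩
  have ht1 : 1 ≤ t ^ ((1 : ℝ) / 3) := Real.one_le_rpow ht (by norm_num)
  have hpi := Real.pi_pos
  -- Below t = π the disk contains only 0 and |1 - t| < π, which accounts for the π in the constant.
  rcases lt_or_ge t Real.pi with htp | htp
  · rw [gaussianDisk_of_lt_pi (by linarith) htp, Finset.card_singleton, Nat.cast_one, abs_sub_comm,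
      abs_of_nonneg (by linarith)]
    nlinarith
  · have hcard : ((gaussianDisk t).card : ℝ) = evenSum (0 : Fin 2 → ℕ) (t / Real.pi) := by
      have h1 := sum_gaussianDisk t (fun _ => (1 : ℝ))
      simp only [Finset.sum_const, nsmul_eq_mul, mul_one] at h1
      rw [h1]
      simp [evenSum, evenMonomial]
    have h2 := h (t / Real.pi) ((one_le_div hpi).2 htp)
    rw [evenConst_zero_two, ← hcard] at h2
    simp only [Pi.zero_apply, Nat.cast_zero, Finset.sum_const_zero] at h2
    rw [show (((2 : ℕ) : ℝ) / 2 + 0) = 1 by norm_num, Real.rpow_one,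
      mul_div_cancel₀ _ hpi.ne', show (1 - ((2 : ℕ) : ℝ) / (((2 : ℕ) : ℝ) + 1)) = 1 / 3 by norm_num]
      at h2
    refine h2.trans ?_
    have h3 : (t / Real.pi) ^ ((1 : ℝ) / 3) ≤ t ^ ((1 : ℝ) / 3) :=
      Real.rpow_le_rpow (by positivity)
        (div_le_self (by linarith) (by linarith [Real.pi_gt_three])) (by norm_num)
    nlinarith

theorem isHomogeneous_linear_pow (k : ℕ) :
    ((MvPolynomial.X 0 + MvPolynomial.C Complex.I * MvPolynomial.X 1 :
      MvPolynomial (Fin 2) ℂ) ^ k).IsHomogeneous k := by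
  have h : (MvPolynomial.X 0 + MvPolynomial.C Complex.I * MvPolynomial.X 1 :
      MvPolynomial (Fin 2) ℂ).IsHomogeneous 1 :=
    (MvPolynomial.isHomogeneous_X _ _).add ((MvPolynomial.isHomogeneous_X _ _).C_mul _)
  simpa using h.pow k

theorem laplacian_linear_pow (k : ℕ) :
    ∑ i, MvPolynomial.pderiv i (MvPolynomial.pderiv i
      ((MvPolynomial.X 0 + MvPolynomial.C Complex.I * MvPolynomial.X 1 :
        MvPolynomial (Fin 2) ℂ) ^ k)) = 0 := by
  have hI : (MvPolynomial.C Complex.I * MvPolynomial.C Complex.I : MvPolynomial (Fin 2) ℂ) = -1 := by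
    rw [← map_mul, Complex.I_mul_I, map_neg, map_one]
  rw [Fin.sum_univ_two]
  simp only [MvPolynomial.pderiv_pow, map_add, Derivation.leibniz, MvPolynomial.pderiv_C,
    MvPolynomial.pderiv_X_self, MvPolynomial.pderiv_X_of_ne (zero_ne_one : (0 : Fin 2) ≠ 1),
    MvPolynomial.pderiv_X_of_ne (one_ne_zero : (1 : Fin 2) ≠ 0), Derivation.map_natCast,
    smul_eq_mul, mul_zero, mul_one, add_zero, zero_add]
  -- The two second derivatives differ by the factor i² = -1.
  linear_combination ((k : MvPolynomial (Fin 2) ℂ) * (k - 1 : ℕ) *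
    (MvPolynomial.X 0 + MvPolynomial.C Complex.I * MvPolynomial.X 1) ^ (k - 1 - 1)) * hI

theorem exists_norm_sum_pow_le (k : ℕ) (hk : 1 ≤ k) : ∃ C : ℝ, 0 ≤ C ∧ ∀ t : ℝ, 0 < t →
    t ^ (-(k : ℝ) / 2) * ‖∑ z ∈ gaussianDisk t, (z : ℂ) ^ k‖ ≤ C * t ^ ((1 : ℝ) / 3) := by
  obtain ⟨C, hC, h⟩ := exists_norm_sum_harmonic_le le_rfl k hk
  set Q : MvPolynomial (Fin 2) ℂ :=
    (MvPolynomial.X 0 + MvPolynomial.C Complex.I * MvPolynomial.X 1) ^ k with hQ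
  have hcn : 0 ≤ coeffNorm k Q := Finset.sum_nonneg fun _ _ => norm_nonneg _
  refine ⟨C * coeffNorm k Q, by positivity, fun t ht => ?_⟩
  have hpi := Real.pi_pos
  rcases lt_or_ge t Real.pi with htp | htp
  · rw [gaussianDisk_of_lt_pi ht htp, Finset.sum_singleton, map_zero, zero_pow (by omega),
      norm_zero, mul_zero]
    positivity
  · have h1 := h Q (isHomogeneous_linear_pow k) (laplacian_linear_pow k) (t / Real.pi)
      ((one_le_div hpi).2 htp)
    have h2 : ∑ z ∈ gaussianDisk t, (z : ℂ) ^ k =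
        ∑ x ∈ sqBall 2 (t / Real.pi), MvPolynomial.eval (fun i => (x i : ℂ)) Q := by
      rw [sum_gaussianDisk]
      refine Finset.sum_congr rfl fun x _ => ?_
      simp only [hQ, map_pow, map_add, map_mul, MvPolynomial.eval_X, MvPolynomial.eval_C,
        GaussianInt.toComplex_def]
      ring
    have h3 : (t / Real.pi) ^ (((2 : ℕ) : ℝ) / 2 + k / 2 - ((2 : ℕ) : ℝ) / (((2 : ℕ) : ℝ) + 1)) ≤
        t ^ ((k : ℝ) / 2) * t ^ ((1 : ℝ) / 3) := by
      rw [← Real.rpow_add ht, show (((2 : ℕ) : ℝ) / 2 + k / 2 - ((2 : ℕ) : ℝ) / (((2 : ℕ) : ℝ) + 1))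
        = k / 2 + 1 / 3 by push_cast; ring]
      exact Real.rpow_le_rpow (by positivity)
        (div_le_self ht.le (by linarith [Real.pi_gt_three])) (by positivity)
    rw [h2]
    calc _ ≤ t ^ (-(k : ℝ) / 2) *
          (C * coeffNorm k Q * (t ^ ((k : ℝ) / 2) * t ^ ((1 : ℝ) / 3))) := by
          gcongr
          exact h1.trans (by gcongr)
      _ = C * coeffNorm k Q * t ^ ((1 : ℝ) / 3) * (t ^ (-(k : ℝ) / 2) * t ^ ((k : ℝ) / 2)) := by
          ring
      _ = _ := by
          rw [← Real.rpow_add ht, neg_div, neg_add_cancel, Real.rpow_zero, mul_one]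

/-! ### Central factorials and discrete harmonic polynomials -/

/-- The value at `x` of the central factorial polynomial of degree `a`. -/
def centralFactorialFun (a : ℕ) (x : ℂ) : ℂ :=
  ∏ j ∈ Finset.range a, (x + ((j : ℂ) - ((a : ℂ) - 1) / 2))

theorem eval_centralFactorial {d : ℕ} (i : Fin d) (a : ℕ) (v : Fin d → ℂ) :
    MvPolynomial.eval v (centralFactorial i a) = centralFactorialFun a (v i) := by
  simp [centralFactorial, centralFactorialFun, map_prod]

/-- The two extreme factors x ± (a+1)/2 are paired; the inner ones form the central factorial of
degree a. This parity structure is why corrections drop two degrees at a time. -/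
theorem centralFactorialFun_add_two (a : ℕ) (x : ℂ) :
    centralFactorialFun (a + 2) x = (x ^ 2 - ((a + 1) / 2) ^ 2) * centralFactorialFun a x := by
  rw [centralFactorialFun, Finset.prod_range_succ, Finset.prod_range_succ', centralFactorialFun]
  have h : ∀ j ∈ Finset.range a, x + (((j + 1 : ℕ) : ℂ) - (((a + 2 : ℕ) : ℂ) - 1) / 2) =
      x + ((j : ℂ) - ((a : ℂ) - 1) / 2) := fun j _ => by push_cast; ring
  rw [Finset.prod_congr rfl h]
  push_cast
  ring

/-- If `g` agrees with `f` up to terms of degree two less, `g` has the growth of `f`. -/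
theorem norm_le_of_norm_sub_mul_sq_le {f g : ℂ} {C ρ : ℝ} {n : ℕ} (hρ : 0 ≤ ρ)
    (hf : ‖f‖ ≤ (1 + ρ) ^ n) (h : ‖g - f‖ * (1 + ρ) ^ 2 ≤ C * (1 + ρ) ^ n) :
    ‖g‖ ≤ (C + 1) * (1 + ρ) ^ n := by
  have h1 : ‖g - f‖ ≤ ‖g - f‖ * (1 + ρ) ^ 2 :=
    le_mul_of_one_le_right (norm_nonneg _) (one_le_pow₀ (by linarith))
  have h2 : ‖g‖ ≤ ‖g - f‖ + ‖f‖ := by simpa using norm_add_le (g - f) f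
  linarith

/-- The gain of two degrees is written with a factor (1+ρ)² on the left, which avoids negative
exponents when a < 2. A gain of only one degree would leave O(t^{(k+1)/2}) after summation, too much
for (c). -/
theorem exists_norm_centralFactorialFun_sub_le (a : ℕ) : ∃ C : ℝ, 0 ≤ C ∧ ∀ (x : ℂ) (ρ : ℝ),
    ‖x‖ ≤ ρ → ‖centralFactorialFun a x - x ^ a‖ * (1 + ρ) ^ 2 ≤ C * (1 + ρ) ^ a := by
  induction a using Nat.twoStepInduction with
  | zero => exact ⟨0, le_rfl, fun x ρ _ => by simp [centralFactorialFun]⟩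
  | one => exact ⟨0, le_rfl, fun x ρ _ => by simp [centralFactorialFun]⟩
  | more a ih _ =>
    obtain ⟨C, hC, h⟩ := ih
    refine ⟨C + ((a + 1) / 2) ^ 2 * (C + 1), by positivity, fun x ρ hx => ?_⟩
    have hρ : 0 ≤ ρ := (norm_nonneg x).trans hx
    have h0 : ‖x ^ a‖ ≤ (1 + ρ) ^ a := by
      rw [norm_pow]
      exact pow_le_pow_left₀ (norm_nonneg _) (by linarith) _
    have h1 := norm_le_of_norm_sub_mul_sq_le hρ h0 (h x ρ hx)
    have h2 := h x ρ hx
    have h3 : ‖x‖ ^ 2 ≤ (1 + ρ) ^ 2 := pow_le_pow_left₀ (norm_nonneg _) (by linarith) _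
    have hc : ‖((a + 1 : ℂ) / 2) ^ 2‖ = (((a : ℝ) + 1) / 2) ^ 2 := by
      rw [norm_pow, norm_div]
      norm_cast
    calc ‖centralFactorialFun (a + 2) x - x ^ (a + 2)‖ * (1 + ρ) ^ 2
        = ‖x ^ 2 * (centralFactorialFun a x - x ^ a) -
            ((a + 1 : ℂ) / 2) ^ 2 * centralFactorialFun a x‖ * (1 + ρ) ^ 2 := by
          rw [centralFactorialFun_add_two]
          congr 2
          ring
      _ ≤ (‖x‖ ^ 2 * ‖centralFactorialFun a x - x ^ a‖ +
            (((a : ℝ) + 1) / 2) ^ 2 * ‖centralFactorialFun a x‖) * (1 + ρ) ^ 2 := by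
          gcongr
          refine (norm_sub_le _ _).trans_eq ?_
          rw [norm_mul, norm_mul, hc, norm_pow]
      _ = ‖x‖ ^ 2 * (‖centralFactorialFun a x - x ^ a‖ * (1 + ρ) ^ 2) +
            (((a : ℝ) + 1) / 2) ^ 2 * ‖centralFactorialFun a x‖ * (1 + ρ) ^ 2 := by ring
      _ ≤ (1 + ρ) ^ 2 * (C * (1 + ρ) ^ a) +
            (((a : ℝ) + 1) / 2) ^ 2 * ((C + 1) * (1 + ρ) ^ a) * (1 + ρ) ^ 2 := by gcongr
      _ = _ := by ring

theorem exists_norm_prod_centralFactorialFun_sub_le {ι : Type*} (s : Finset ι) (α : ι → ℕ) :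
    ∃ C : ℝ, 0 ≤ C ∧ ∀ (v : ι → ℂ) (ρ : ℝ), 0 ≤ ρ → (∀ i, ‖v i‖ ≤ ρ) →
      ‖∏ i ∈ s, centralFactorialFun (α i) (v i) - ∏ i ∈ s, v i ^ α i‖ * (1 + ρ) ^ 2 ≤
        C * (1 + ρ) ^ ∑ i ∈ s, α i := by
  classical
  induction s using Finset.induction_on with
  | empty => exact ⟨0, le_rfl, fun v ρ _ _ => by simp⟩
  | insert j s hj ih =>
    obtain ⟨C, hC, h⟩ := ih
    obtain ⟨D, hD, h'⟩ := exists_norm_centralFactorialFun_sub_le (α j)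
    refine ⟨D * (C + 1) + C, by positivity, fun v ρ hρ hv => ?_⟩
    have hpow : ∀ i, ‖v i ^ α i‖ ≤ (1 + ρ) ^ α i := fun i => by
      rw [norm_pow]
      exact pow_le_pow_left₀ (norm_nonneg _) (by linarith [hv i]) _
    have h0 : ‖∏ i ∈ s, v i ^ α i‖ ≤ (1 + ρ) ^ ∑ i ∈ s, α i := by
      rw [norm_prod, ← Finset.prod_pow_eq_pow_sum]
      exact Finset.prod_le_prod (fun _ _ => norm_nonneg _) fun i _ => hpow i
    have h1 := h v ρ hρ hv
    have h2 := norm_le_of_norm_sub_mul_sq_le hρ h0 h1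
    have h3 := h' (v j) ρ (hv j)
    rw [Finset.prod_insert hj, Finset.prod_insert hj, Finset.sum_insert hj]
    set A := ∏ i ∈ s, centralFactorialFun (α i) (v i)
    set B := ∏ i ∈ s, v i ^ α i
    set n := ∑ i ∈ s, α i
    -- One factor is exchanged at a time, so each summand contains exactly one difference and
    -- inherits its gain of two degrees.
    calc _ = ‖(centralFactorialFun (α j) (v j) - v j ^ α j) * A + v j ^ α j * (A - B)‖ *
          (1 + ρ) ^ 2 := by
          congr 2
          ring
      _ ≤ (‖centralFactorialFun (α j) (v j) - v j ^ α j‖ * ‖A‖ + ‖v j ^ α j‖ * ‖A - B‖) *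
          (1 + ρ) ^ 2 := by
          gcongr
          exact (norm_add_le _ _).trans_eq (by rw [norm_mul, norm_mul])
      _ = ‖centralFactorialFun (α j) (v j) - v j ^ α j‖ * (1 + ρ) ^ 2 * ‖A‖ +
          ‖v j ^ α j‖ * (‖A - B‖ * (1 + ρ) ^ 2) := by ring
      _ ≤ D * (1 + ρ) ^ α j * ((C + 1) * (1 + ρ) ^ n) + (1 + ρ) ^ α j * (C * (1 + ρ) ^ n) := by
          gcongr
          exact hpow j
      _ = _ := by ring

theorem eval_discretize {d : ℕ} (P : MvPolynomial (Fin d) ℂ) (v : Fin d → ℂ) :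
    MvPolynomial.eval v (discretize d P) =
      ∑ α ∈ P.support, P.coeff α * ∏ i, centralFactorialFun (α i) (v i) := by
  have h : discretize d P = ∑ α ∈ P.support, P.coeff α • ∏ i, centralFactorial i (α i) := by
    rw [discretize, Module.Basis.constr_apply]
    rfl
  rw [h, map_sum]
  refine Finset.sum_congr rfl fun α _ => ?_
  rw [MvPolynomial.smul_eval, map_prod]
  simp only [eval_centralFactorial]

theorem exists_norm_eval_discretize_sub_le {d k : ℕ} (P : MvPolynomial (Fin d) ℂ)
    (hP : P.IsHomogeneous k) : ∃ C : ℝ, 0 ≤ C ∧ ∀ (v : Fin d → ℂ) (ρ : ℝ), 0 ≤ ρ →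
      (∀ i, ‖v i‖ ≤ ρ) →
      ‖MvPolynomial.eval v (discretize d P) - MvPolynomial.eval v P‖ * (1 + ρ) ^ 2 ≤
        C * (1 + ρ) ^ k := by
  choose C hC h using fun α : Fin d →₀ ℕ =>
    exists_norm_prod_centralFactorialFun_sub_le Finset.univ (fun i => α i)
  refine ⟨∑ α ∈ P.support, ‖P.coeff α‖ * C α,
    Finset.sum_nonneg fun α _ => mul_nonneg (norm_nonneg _) (hC α), fun v ρ hρ hv => ?_⟩
  rw [eval_discretize, MvPolynomial.eval_eq', ← Finset.sum_sub_distrib, Finset.sum_mul]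
  calc _ ≤ (∑ α ∈ P.support, ‖P.coeff α‖ * ‖∏ i, centralFactorialFun (α i) (v i) -
          ∏ i, v i ^ α i‖) * (1 + ρ) ^ 2 := by
        gcongr
        refine norm_sum_le_of_le _ fun α _ => ?_
        rw [← mul_sub, norm_mul]
    _ = ∑ α ∈ P.support, ‖P.coeff α‖ * (‖∏ i, centralFactorialFun (α i) (v i) -
          ∏ i, v i ^ α i‖ * (1 + ρ) ^ 2) := by
        rw [Finset.sum_mul]
        exact Finset.sum_congr rfl fun α _ => by ring
    _ ≤ ∑ α ∈ P.support, ‖P.coeff α‖ * (C α * (1 + ρ) ^ k) := by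
        refine Finset.sum_le_sum fun α hα => ?_
        have h1 : ∑ i, α i = k := by
          have h1 := hP (MvPolynomial.mem_support_iff.1 hα)
          rw [Finsupp.weight_apply, Finsupp.sum_fintype _ _ (by simp)] at h1
          simpa using h1
        have h2 := h α v ρ hρ hv
        rw [h1] at h2
        gcongr
    _ = _ := Finset.sum_congr rfl fun α _ => by ring

theorem exists_norm_discretePower_sub_le (k : ℕ) : ∃ C : ℝ, 0 ≤ C ∧ ∀ (z : ℂ) (ρ : ℝ), ‖z‖ ≤ ρ →
    ‖discretePower k z - z ^ k‖ * (1 + ρ) ^ 2 ≤ C * (1 + ρ) ^ k := by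
  obtain ⟨C, hC, h⟩ := exists_norm_eval_discretize_sub_le _ (isHomogeneous_linear_pow k)
  refine ⟨C, hC, fun z ρ hz => ?_⟩
  have h1 := h ![(z.re : ℂ), (z.im : ℂ)] ρ ((norm_nonneg z).trans hz) fun i => by
    fin_cases i
    · simpa using (Complex.abs_re_le_norm z).trans hz
    · simpa using (Complex.abs_im_le_norm z).trans hz
  have h2 : MvPolynomial.eval ![(z.re : ℂ), (z.im : ℂ)]
      ((MvPolynomial.X 0 + MvPolynomial.C Complex.I * MvPolynomial.X 1) ^ k) = z ^ k := by
    simp only [map_pow, map_add, map_mul, MvPolynomial.eval_X, MvPolynomial.eval_C,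
      Matrix.cons_val_zero, Matrix.cons_val_one]
    rw [mul_comm, Complex.re_add_im]
  rwa [h2] at h1

theorem exists_norm_sum_discreteHarmonic_le (k : ℕ) (hk : 1 ≤ k) : ∃ C : ℝ, ∀ t : ℝ, 0 < t →
    t ^ (-(k : ℝ) / 2) * ‖∑ z ∈ gaussianDisk t, discreteHarmonic k (z : ℂ)‖
      ≤ C * t ^ ((1 : ℝ) / 3) := by
  obtain ⟨A, hA, hcard⟩ := exists_abs_card_gaussianDisk_sub_le
  obtain ⟨B, hB, hpow⟩ := exists_norm_sum_pow_le k hk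
  obtain ⟨C, hC, hdisc⟩ := exists_norm_discretePower_sub_le k
  refine ⟨B + (1 + A) * (2 * C * 2 ^ k), fun t ht => ?_⟩
  have hk0 : k ≠ 0 := by omega
  rcases lt_or_ge t Real.pi with htp | htp
  · rw [gaussianDisk_of_lt_pi ht htp, Finset.sum_singleton, map_zero, discreteHarmonic, if_neg hk0,
      sub_self, norm_zero, mul_zero]
    positivity
  · have ht1 : 1 ≤ t := by linarith [Real.pi_gt_three]
    set s := √t with hs
    have hs1 : 1 ≤ s := Real.one_le_sqrt.2 ht1
    have hst : s ^ 2 = t := Real.sq_sqrt ht.le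
    have hsk : s ^ k = t ^ ((k : ℝ) / 2) := by
      rw [hs, Real.sqrt_eq_rpow, ← Real.rpow_natCast, ← Real.rpow_mul ht.le]
      congr 1
      ring
    -- The bound is uniform over the disk of radius s = √t, since (1+s)² ≥ t; taken at w = 0 it also
    -- controls the subtracted constant q_k(0).
    have hdiff : ∀ w : ℂ, ‖w‖ ≤ s → ‖discretePower k w - w ^ k‖ * t ≤ C * 2 ^ k * s ^ k := by
      intro w hw
      calc ‖discretePower k w - w ^ k‖ * t ≤ ‖discretePower k w - w ^ k‖ * (1 + s) ^ 2 := by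
            gcongr
            nlinarith
        _ ≤ C * (1 + s) ^ k := hdisc w s hw
        _ ≤ C * (2 * s) ^ k := by gcongr; linarith
        _ = _ := by ring
    have hterm : ∀ z ∈ gaussianDisk t, ‖discreteHarmonic k (z : ℂ) - (z : ℂ) ^ k‖ ≤
        2 * C * 2 ^ k * s ^ k / t := by
      intro z hz
      have hz1 : ‖(z : ℂ)‖ ≤ s := by
        rw [mem_gaussianDisk] at hz
        refine Real.le_sqrt_of_sq_le ?_
        nlinarith [Real.pi_gt_three, sq_nonneg ‖(z : ℂ)‖]
      have h1 := hdiff z hz1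
      have h2 := hdiff 0 (by rw [norm_zero]; linarith)
      rw [zero_pow hk0, sub_zero] at h2
      rw [le_div_iff₀ ht, discreteHarmonic, if_neg hk0, sub_right_comm]
      calc _ ≤ (‖discretePower k z - (z : ℂ) ^ k‖ + ‖discretePower k 0‖) * t := by
            gcongr
            exact norm_sub_le _ _
        _ ≤ _ := by linarith
    have hcard' : ((gaussianDisk t).card : ℝ) ≤ (1 + A) * t := by
      have h1 := (abs_le.1 (hcard t ht1)).2
      have h2 : t ^ ((1 : ℝ) / 3) ≤ t := by
        simpa using Real.rpow_le_rpow_of_exponent_le ht1 (by norm_num : (1 : ℝ) / 3 ≤ 1)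
      nlinarith
    have hsum : ‖∑ z ∈ gaussianDisk t, (discreteHarmonic k (z : ℂ) - (z : ℂ) ^ k)‖ ≤
        (1 + A) * (2 * C * 2 ^ k) * t ^ ((k : ℝ) / 2) := by
      calc _ ≤ ∑ _z ∈ gaussianDisk t, 2 * C * 2 ^ k * s ^ k / t := norm_sum_le_of_le _ hterm
        _ = (gaussianDisk t).card * (2 * C * 2 ^ k * s ^ k / t) := by
            rw [Finset.sum_const, nsmul_eq_mul]
        _ ≤ (1 + A) * t * (2 * C * 2 ^ k * s ^ k / t) := by gcongr
        _ = _ := by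
            rw [hsk]
            field_simp
    have ht3 : 1 ≤ t ^ ((1 : ℝ) / 3) := Real.one_le_rpow ht1 (by norm_num)
    have hcancel : t ^ (-(k : ℝ) / 2) * t ^ ((k : ℝ) / 2) = 1 := by
      rw [← Real.rpow_add ht, neg_div, neg_add_cancel, Real.rpow_zero]
    calc _ ≤ t ^ (-(k : ℝ) / 2) * (‖∑ z ∈ gaussianDisk t, (z : ℂ) ^ k‖ +
          (1 + A) * (2 * C * 2 ^ k) * t ^ ((k : ℝ) / 2)) := by
          gcongr
          refine le_trans ?_ (add_le_add_right hsum _)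
          rw [Finset.sum_sub_distrib]
          simpa using norm_add_le (∑ z ∈ gaussianDisk t, (z : ℂ) ^ k)
            (∑ z ∈ gaussianDisk t, discreteHarmonic k (z : ℂ) -
              ∑ z ∈ gaussianDisk t, (z : ℂ) ^ k)
      _ = t ^ (-(k : ℝ) / 2) * ‖∑ z ∈ gaussianDisk t, (z : ℂ) ^ k‖ +
          (1 + A) * (2 * C * 2 ^ k) * (t ^ (-(k : ℝ) / 2) * t ^ ((k : ℝ) / 2)) := by ring
      _ ≤ B * t ^ ((1 : ℝ) / 3) + (1 + A) * (2 * C * 2 ^ k) * t ^ ((1 : ℝ) / 3) := by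
          rw [hcancel]
          exact add_le_add (hpow t ht) (by gcongr)
      _ = _ := by ring

end

theorem mainTheorem7 :
    -- (a) the number of Gaussian integers in the disk of area `t`
    (∃ C : ℝ, ∀ t : ℝ, 1 ≤ t →
      |((gaussianDisk t).card : ℝ) - t| ≤ C * t ^ ((1 : ℝ) / 3)) ∧
    -- (b) power sums over the disk of area `t`
    (∀ k : ℕ, 1 ≤ k → ∃ C : ℝ, ∀ t : ℝ, 0 < t →
      t ^ (-(k : ℝ) / 2) * ‖∑ z ∈ gaussianDisk t, (z : ℂ) ^ k‖ ≤ C * t ^ ((1 : ℝ) / 3)) ∧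
    -- (b) in all dimensions, with a constant depending only on `d` and `k`
    (∀ d k : ℕ, 1 ≤ d → 1 ≤ k → ∃ C : ℝ, ∀ P : MvPolynomial (Fin d) ℝ,
      P.IsHomogeneous k → IsHarmonicPoly P →
      IsGreatest ((fun x : EuclideanSpace ℝ (Fin d) => |MvPolynomial.eval (fun i => x i) P|) ''
        Metric.closedBall 0 1) 1 →
      ∀ R : ℝ, 0 < R →
        |1 / R ^ d * ∑ x ∈ latticeBall d R, MvPolynomial.eval (fun i => (x i : ℝ)) P / R ^ k|
          ≤ C * R ^ (-1 - (1 - 2 / ((d : ℝ) + 1)))) ∧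
    -- (c) sums of the discrete harmonic polynomials over the disk of area `t`
    (∀ k : ℕ, 1 ≤ k → ∃ C : ℝ, ∀ t : ℝ, 0 < t →
      t ^ (-(k : ℝ) / 2) * ‖∑ z ∈ gaussianDisk t, discreteHarmonic k (z : ℂ)‖
        ≤ C * t ^ ((1 : ℝ) / 3)) :=
  ⟨exists_abs_card_gaussianDisk_sub_le.imp fun _ h => h.2,
    fun k hk => (exists_norm_sum_pow_le k hk).imp fun _ h => h.2,
    exists_abs_sum_latticeBall_le,
    exists_norm_sum_discreteHarmonic_le⟩
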